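/- Let $X$ be a compact smooth 4-manifold (Hausdorff, without boundary) and let $E \to X$ be an $\mathrm{SO}(3)$-bundle, i.e. a smooth oriented real vector bundle of rank 3 with a fibre metric (the orientation of $E$ plays no role below). The bundle $\mathfrak{so}(E)$ of skew-adjoint endomorphisms carries the inner product $\langle \xi,\zeta\rangle = -\operatorname{tr}(\xi\zeta)$ given by minus the Killing form. A smooth metric connection $A$ in $E$ with curvature $F_A \in \Omega^2(X,\mathfrak{so}(E))$ is called *definite* if $F_A(u,v)\neq 0$ for all linearly independent tangent vectors $u,v$ at a point of $X$. Let $A$ be a definite connection. Write locally $F_A=\sum_{i=1}^3 F_i\otimes e_i$ with respect to an orthonormal frame $e_1,e_2,e_3$ of $\mathfrak{so}(E)$. The 4-form $\mu(A)=\tfrac13\sum_i F_i\wedge F_i$ vanishes nowhere, and $X$ is given the orientation for which $\mu(A)$ is positive. Let $Q(A)$ be the symmetric bilinear form on $\mathfrak{so}(E)\cong E$ with matrix $$Q(A)_{ij}=\frac{F_i\wedge F_j}{\mu(A)},\qquad |Q(A)|^2=\sum_{i,j}Q(A)_{ij}Q(A)_{ji},\qquad \mathcal E(A)=\int_X|Q(A)|^2\,\mu(A).$$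 The connection $A$ is called *perfect* if $F_A$, as a map from $\mathfrak{so}(E)^*$ onto its image $\Lambda^+_A\subset\Lambda^2T^*X$, is an isometry, where the inner product of $\Lambda^+_A$ is given by $\alpha\wedge\beta=\langle\alpha,\beta\rangle\,\mu(A)$; i.e. if $F_i\wedge F_j=\delta_{ij}\,\mu(A)$ for all $i,j$. For a smooth metric connection $B$ in $E$ let $p_1(B)=-\frac1{8\pi^2}\operatorname{tr}(F_B\wedge F_B)$ be its first Pontrjagin form. Then the number $p_1(E)=\int_X p_1(B)$ (the first Pontrjagin number of $E$ with respect to the orientation of $X$ above) is the same for all smooth metric connections $B$ in $E$, and $$\mathcal E(A)\;\ge\;8\pi^2\,p_1(E),$$ with equality if and only if $A$ is perfect. -/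

import Mathlib

open Bundle Manifold Set Topology FiberBundle VectorField
open scoped ContDiff

noncomputable section


section Algebra

theorem update_pair_zero {T : Type*} (a b c : T) : Function.update ![a, b] 0 c = ![c, b] := by
  funext k; fin_cases k <;> rfl

theorem update_pair_one {T : Type*} (a b c : T) : Function.update ![a, b] 1 c = ![a, c] := by
  funext k; fin_cases k <;> rfl

variable {T W : Type*} [AddCommGroup T] [Module ℝ T] [AddCommGroup W] [Module ℝ W]

theorem twoForm_add_left (γ : T [⋀^Fin 2]→ₗ[ℝ] W) (a b c : T) :
    γ ![a + b, c] = γ ![a, c] + γ ![b, c] := by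
  have h := γ.map_update_add ![0, c] 0 a b
  simpa only [update_pair_zero] using h

theorem twoForm_add_right (γ : T [⋀^Fin 2]→ₗ[ℝ] W) (a b c : T) :
    γ ![c, a + b] = γ ![c, a] + γ ![c, b] := by
  have h := γ.map_update_add ![c, 0] 1 a b
  simpa only [update_pair_one] using h

theorem twoForm_smul_left (γ : T [⋀^Fin 2]→ₗ[ℝ] W) (r : ℝ) (a c : T) :
    γ ![r • a, c] = r • γ ![a, c] := by
  have h := γ.map_update_smul ![0, c] 0 r a
  simpa only [update_pair_zero] using h

theorem twoForm_smul_right (γ : T [⋀^Fin 2]→ₗ[ℝ] W) (r : ℝ) (a c : T) :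
    γ ![c, r • a] = r • γ ![c, a] := by
  have h := γ.map_update_smul ![c, 0] 1 r a
  simpa only [update_pair_one] using h

theorem twoForm_self (γ : T [⋀^Fin 2]→ₗ[ℝ] W) (a : T) : γ ![a, a] = 0 :=
  γ.map_eq_zero_of_eq ![a, a] (i := 0) (j := 1) rfl (by decide)

theorem twoForm_swap (γ : T [⋀^Fin 2]→ₗ[ℝ] W) (a b : T) : γ ![b, a] = - γ ![a, b] := by
  have h := twoForm_self γ (a + b)
  rw [twoForm_add_left, twoForm_add_right, twoForm_add_right, twoForm_self, twoForm_self,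
    zero_add, add_zero] at h
  exact eq_neg_of_add_eq_zero_right h

/-- The wedge product of two `W`-valued 2-forms on `T`, with the values multiplied by means of the
bilinear form `B`; with the usual normalisation
`(α ∧ β)(v₀, …, v₃) = ∑ sign(σ) B (α (v_{σ 0}, v_{σ 1})) (β (v_{σ 2}, v_{σ 3}))`,
the sum being over the six (2,2)-shuffles `σ`. -/
def wedge (B : W →ₗ[ℝ] W →ₗ[ℝ] ℝ) (α β : T [⋀^Fin 2]→ₗ[ℝ] W) : T [⋀^Fin 4]→ₗ[ℝ] ℝ where
  toFun v :=
    B (α ![v 0, v 1]) (β ![v 2, v 3]) - B (α ![v 0, v 2]) (β ![v 1, v 3])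
      + B (α ![v 0, v 3]) (β ![v 1, v 2]) + B (α ![v 1, v 2]) (β ![v 0, v 3])
      - B (α ![v 1, v 3]) (β ![v 0, v 2]) + B (α ![v 2, v 3]) (β ![v 0, v 1])
  map_update_add' {inst} v i a b := by
    obtain rfl : inst = instDecidableEqFin 4 := Subsingleton.elim _ _
    fin_cases i <;>
      simp [twoForm_add_left, twoForm_add_right] <;> ring
  map_update_smul' {inst} v i c a := by
    obtain rfl : inst = instDecidableEqFin 4 := Subsingleton.elim _ _
    fin_cases i <;>
      simp [twoForm_smul_left, twoForm_smul_right] <;> ring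
  map_eq_zero_of_eq' v i j h hij := by
    have key : ∀ i j : Fin 4, i < j → v i = v j →
        B (α ![v 0, v 1]) (β ![v 2, v 3]) - B (α ![v 0, v 2]) (β ![v 1, v 3])
      + B (α ![v 0, v 3]) (β ![v 1, v 2]) + B (α ![v 1, v 2]) (β ![v 0, v 3])
      - B (α ![v 1, v 3]) (β ![v 0, v 2]) + B (α ![v 2, v 3]) (β ![v 0, v 1]) = 0 := by
      intro i j hlt h
      fin_cases i <;> fin_cases j <;> simp at hlt h <;>
        simp only [h, twoForm_self, map_zero, LinearMap.zero_apply, map_neg, LinearMap.neg_apply,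
          twoForm_swap _ (v 1) (v 2), twoForm_swap _ (v 1) (v 3), twoForm_swap _ (v 2) (v 3)] <;>
        ring
    rcases lt_or_gt_of_ne hij with h' | h'
    · exact key i j h' h
    · exact key j i h' h.symm

end Algebra

section OrthogonalLieAlgebra

variable (W : Type*) [NormedAddCommGroup W] [InnerProductSpace ℝ W]

/-- The Lie algebra `𝔰𝔬(W)` of skew-adjoint endomorphisms of a Euclidean space `W`. -/
def soAlgebra : Submodule ℝ (W →ₗ[ℝ] W) where
  carrier := {S | ∀ v w, inner ℝ (S v) w = - inner ℝ v (S w)}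
  add_mem' {S T} hS hT v w := by
    simp only [LinearMap.add_apply, inner_add_left, inner_add_right, hS v w, hT v w]
    ring
  zero_mem' v w := by simp
  smul_mem' c S hS v w := by
    simp only [LinearMap.smul_apply, inner_smul_left, inner_smul_right, hS v w]
    simp

/-- The bilinear form `(S, T) ↦ tr (S ∘ T)`. -/
def tracePairing : (W →ₗ[ℝ] W) →ₗ[ℝ] (W →ₗ[ℝ] W) →ₗ[ℝ] ℝ :=
  (LinearMap.mul ℝ (Module.End ℝ W)).compr₂ (LinearMap.trace ℝ W)

/-- The form `⟨S, T⟩ = - tr (S ∘ T)`. If `dim W = 3`, the Killing form `tr (ad S ∘ ad T)` of `𝔰𝔬(W)`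
equals `tr (S ∘ T)`, so that this is the inner product on `𝔰𝔬(W)` given by (minus) the Killing
form. -/
def soInner : (W →ₗ[ℝ] W) →ₗ[ℝ] (W →ₗ[ℝ] W) →ₗ[ℝ] ℝ := - tracePairing W

variable {W}

/-- The orthonormal frame `e₀, e₁, e₂` of `𝔰𝔬(W)` induced by an orthonormal basis `b` of the
3-dimensional Euclidean space `W`: `e_i` is `1/√2` times the cross product with `b_i`, that is,
`√2 e_i (w) = ⟨b_{i+1}, w⟩ b_{i+2} - ⟨b_{i+2}, w⟩ b_{i+1}`, indices modulo 3. -/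
def soFrame (b : OrthonormalBasis (Fin 3) ℝ W) (i : Fin 3) : W →ₗ[ℝ] W :=
  (√2)⁻¹ • ((innerₗ W (b (i + 1))).smulRight (b (i + 2)) -
    (innerₗ W (b (i + 2))).smulRight (b (i + 1)))

theorem soFrame_mem (b : OrthonormalBasis (Fin 3) ℝ W) (i : Fin 3) :
    soFrame b i ∈ soAlgebra W := by
  intro v w
  simp [soFrame, inner_sub_left, inner_sub_right, inner_smul_left, inner_smul_right,
    real_inner_comm]
  ring

theorem soInner_soFrame (b : OrthonormalBasis (Fin 3) ℝ W) (i j : Fin 3) :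
    soInner W (soFrame b i) (soFrame b j) = if i = j then 1 else 0 := by
  have h2 : (√2)⁻¹ * (√2)⁻¹ = (1 / 2 : ℝ) := by
    rw [← mul_inv, Real.mul_self_sqrt (by norm_num)]; norm_num
  have hb : ∀ k l, inner ℝ (b k) (b l) = if k = l then (1 : ℝ) else 0 :=
    orthonormal_iff_ite.1 b.orthonormal
  simp only [soInner, tracePairing, LinearMap.neg_apply, LinearMap.compr₂_apply,
    LinearMap.mul_apply', LinearMap.trace_eq_sum_inner _ b, Fin.sum_univ_three]
  fin_cases i <;> fin_cases j <;>
    simp [soFrame, hb, inner_smul_right, h2] <;> norm_num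

end OrthogonalLieAlgebra

section Connections

variable {E : Type*} [NormedAddCommGroup E] [NormedSpace ℝ E] [FiniteDimensional ℝ E]
  {H : Type*} [TopologicalSpace H] (I : ModelWithCorners ℝ E H)
  {X : Type*} [TopologicalSpace X] [ChartedSpace H X] [IsManifold I ∞ X]
  (F : Type*) [NormedAddCommGroup F] [NormedSpace ℝ F] [FiniteDimensional ℝ F]
  (V : X → Type*) [TopologicalSpace (TotalSpace F V)]
  [∀ x, NormedAddCommGroup (V x)] [∀ x, InnerProductSpace ℝ (V x)]
  [FiberBundle F V] [VectorBundle ℝ F V]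
  [ContMDiffVectorBundle ∞ F V I] [IsContMDiffRiemannianBundle I ∞ F V]

/-- A smooth metric connection in the Riemannian vector bundle `V`: a covariant derivative which
maps smooth sections to smooth sections and is compatible with the fibre metric. -/
structure MetricConnection extends CovariantDerivative I F V where
  smooth : toCovariantDerivative.ContMDiffCovariantDerivative ∞
  metric : toCovariantDerivative.IsMetricCompatible

variable {I F V}
namespace MetricConnection
variable (A : MetricConnection I F V)

theorem mdiffAt_cov [T2Space X] {σ : Π x : X, V x} {x : X} {u : Set X} (hu : u ∈ 𝓝 x)
    (hσ : CMDiff[u] ∞ (T% σ)) :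
    MDifferentiableAt I (I.prod 𝓘(ℝ, E →L[ℝ] F))
      (fun y => (⟨y, A.toFun σ y⟩ :
        TotalSpace (E →L[ℝ] F) fun y => TangentSpace I y →L[ℝ] V y)) x := by
  have hi : interior u ∈ 𝓝 x := interior_mem_nhds.2 hu
  obtain ⟨f, -, hf⟩ := (SmoothBumpFunction.nhds_basis_tsupport (I := I) x).mem_iff.1 hi
  have h1 : CMDiff ∞ (T% ((f : X → ℝ) • σ)) :=
    ContMDiffOn.smul_section_of_tsupport (u := interior u) f.contMDiff.contMDiffOn
      isOpen_interior hf (hσ.mono interior_subset)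
  have h2 := A.smooth.contMDiff.contMDiff (σ := (f : X → ℝ) • σ) (by simpa using! h1.contMDiffOn)
  have h3 := (h2.contMDiffAt (x := x) Filter.univ_mem).mdifferentiableAt (by simp)
  refine h3.congr_of_eventuallyEq ?_
  have h4 : ∀ᶠ y in 𝓝 x, (∀ᶠ z in 𝓝 y, f z = 1) ∧ y ∈ interior u :=
    (f.eventuallyEq_one.eventually_nhds).and hi
  filter_upwards [h4] with y hy
  have hσy : MDiffAt (T% σ) y :=
    (hσ.contMDiffAt (mem_interior_iff_mem_nhds.1 hy.2)).mdifferentiableAt (by simp)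
  congr 1
  refine A.isCovariantDerivativeOnUniv.congr_of_eventuallyEq hσy
    (h1.contMDiffAt.mdifferentiableAt (by simp)) Filter.univ_mem ?_
  filter_upwards [hy.1] with z hz
  simp [hz]

theorem mdiffAt_cov_apply [T2Space X] {σ : Π x : X, V x} {x : X} {u : Set X} (hu : u ∈ 𝓝 x)
    (hσ : CMDiff[u] ∞ (T% σ)) {Y : Π x : X, TangentSpace I x} (hY : MDiffAt (T% Y) x) :
    MDiffAt (T% (fun y => A.toFun σ y (Y y))) x :=
  (A.mdiffAt_cov hu hσ).clm_bundle_apply hY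

/-- `∇_Y ∇_Z σ - ∇_Z ∇_Y σ - ∇_[Y,Z] σ`. -/
def curvatureAux (σ : Π x : X, V x) (Y Z : Π x : X, TangentSpace I x) (x : X) : V x :=
  A.toFun (fun y => A.toFun σ y (Z y)) x (Y x) - A.toFun (fun y => A.toFun σ y (Y y)) x (Z x) -
    A.toFun σ x (mlieBracket I Y Z x)

theorem tensorial_curvatureAux₂ [T2Space X] {σ : Π x : X, V x} {x : X} {u : Set X} (hu : u ∈ 𝓝 x)
    (hσ : CMDiff[u] ∞ (T% σ)) (Y : Π x : X, TangentSpace I x) :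
    TensorialAt I E (A.curvatureAux σ Y · x) x where
  smul {f Z} hf hZ := by
    have h := A.isCovariantDerivativeOnUniv.leibniz (A.mdiffAt_cov_apply hu hσ hZ) hf
    have e : (fun y => A.toFun σ y ((f • Z) y)) = f • (fun y => A.toFun σ y (Z y)) := by
      ext y; simp
    simp only [curvatureAux]
    rw [e, h, mlieBracket_smul_right hf hZ]
    simp
    module
  add {Z Z'} hZ hZ' := by
    have h := A.isCovariantDerivativeOnUniv.add (A.mdiffAt_cov_apply hu hσ hZ)
      (A.mdiffAt_cov_apply hu hσ hZ')
    have e : (fun y => A.toFun σ y ((Z + Z') y)) =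
        (fun y => A.toFun σ y (Z y)) + (fun y => A.toFun σ y (Z' y)) := by
      ext y; simp
    simp only [curvatureAux]
    rw [e, h, mlieBracket_add_right hZ hZ']
    simp
    module

theorem curvatureAux_swap (σ : Π x : X, V x) (Y Z : Π x : X, TangentSpace I x) (x : X) :
    A.curvatureAux σ Y Z x = - A.curvatureAux σ Z Y x := by
  simp only [curvatureAux]
  rw [mlieBracket_swap_apply]
  simp only [map_neg]
  abel

theorem curvatureAux_add [T2Space X] {σ τ : Π x : X, V x} {x : X} {u : Set X} (hu : u ∈ 𝓝 x)
    (hσ : CMDiff[u] ∞ (T% σ)) (hτ : CMDiff[u] ∞ (T% τ)) {Y Z : Π x : X, TangentSpace I x}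
    (hY : MDiffAt (T% Y) x) (hZ : MDiffAt (T% Z) x) :
    A.curvatureAux (σ + τ) Y Z x = A.curvatureAux σ Y Z x + A.curvatureAux τ Y Z x := by
  have hd : ∀ {ρ : Π x : X, V x}, CMDiff[u] ∞ (T% ρ) → ∀ᶠ y in 𝓝 x, MDiffAt (T% ρ) y := by
    intro ρ hρ
    filter_upwards [eventually_mem_nhds_iff.2 hu] with y hy
    exact (hρ.contMDiffAt hy).mdifferentiableAt (by simp)
  have key : ∀ {W : Π x : X, TangentSpace I x}, MDiffAt (T% W) x →
      A.toFun (fun y => A.toFun (σ + τ) y (W y)) x =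
        A.toFun (fun y => A.toFun σ y (W y)) x + A.toFun (fun y => A.toFun τ y (W y)) x := by
    intro W hW
    rw [← A.isCovariantDerivativeOnUniv.add (A.mdiffAt_cov_apply hu hσ hW)
      (A.mdiffAt_cov_apply hu hτ hW)]
    refine A.isCovariantDerivativeOnUniv.congr_of_eventuallyEq
      (A.mdiffAt_cov_apply hu (hσ.add_section hτ) hW)
      (mdifferentiableAt_add_section (A.mdiffAt_cov_apply hu hσ hW)
        (A.mdiffAt_cov_apply hu hτ hW)) Filter.univ_mem ?_
    filter_upwards [hd hσ, hd hτ] with y h1 h2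
    rw [A.isCovariantDerivativeOnUniv.add h1 h2]
    simp
  have h0 := A.isCovariantDerivativeOnUniv.add (hd hσ).self_of_nhds (hd hτ).self_of_nhds
  simp only [curvatureAux]
  rw [key hY, key hZ, h0]
  simp
  abel

theorem curvatureAux_smul [T2Space X] {σ : Π x : X, V x} {x : X} {u : Set X} (hu : u ∈ 𝓝 x)
    (hσ : CMDiff[u] ∞ (T% σ)) {Y Z : Π x : X, TangentSpace I x}
    (hY : MDiffAt (T% Y) x) (hZ : MDiffAt (T% Z) x) (c : ℝ) :
    A.curvatureAux (c • σ) Y Z x = c • A.curvatureAux σ Y Z x := by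
  have hd : ∀ᶠ y in 𝓝 x, MDiffAt (T% σ) y := by
    filter_upwards [eventually_mem_nhds_iff.2 hu] with y hy
    exact (hσ.contMDiffAt hy).mdifferentiableAt (by simp)
  have key : ∀ {W : Π x : X, TangentSpace I x}, MDiffAt (T% W) x →
      A.toFun (fun y => A.toFun (c • σ) y (W y)) x =
        c • A.toFun (fun y => A.toFun σ y (W y)) x := by
    intro W hW
    rw [← A.isCovariantDerivativeOnUniv.smul_const c (A.mdiffAt_cov_apply hu hσ hW)]
    refine A.isCovariantDerivativeOnUniv.congr_of_eventuallyEq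
      (A.mdiffAt_cov_apply hu hσ.const_smul_section hW)
      (mdifferentiableAt_const.smul_section (A.mdiffAt_cov_apply hu hσ hW)) Filter.univ_mem ?_
    filter_upwards [hd] with y h1
    rw [A.isCovariantDerivativeOnUniv.smul_const c h1]
    simp
  have h0 := A.isCovariantDerivativeOnUniv.smul_const c hd.self_of_nhds
  simp only [curvatureAux]
  rw [key hY, key hZ, h0]
  simp [smul_sub]


theorem curvatureAux_congr [T2Space X] {σ τ : Π x : X, V x} {x : X} {u : Set X} (hu : u ∈ 𝓝 x)
    (hσ : CMDiff[u] ∞ (T% σ)) (hτ : CMDiff[u] ∞ (T% τ)) (h : ∀ᶠ y in 𝓝 x, σ y = τ y)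
    {Y Z : Π x : X, TangentSpace I x} (hY : MDiffAt (T% Y) x) (hZ : MDiffAt (T% Z) x) :
    A.curvatureAux σ Y Z x = A.curvatureAux τ Y Z x := by
  have hd : ∀ {ρ : Π x : X, V x}, CMDiff[u] ∞ (T% ρ) → ∀ᶠ y in 𝓝 x, MDiffAt (T% ρ) y := by
    intro ρ hρ
    filter_upwards [eventually_mem_nhds_iff.2 hu] with y hy
    exact (hρ.contMDiffAt hy).mdifferentiableAt (by simp)
  have h0 : ∀ᶠ y in 𝓝 x, A.toFun σ y = A.toFun τ y := by
    filter_upwards [hd hσ, hd hτ, h.eventually_nhds] with y h1 h2 h3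
    exact A.isCovariantDerivativeOnUniv.congr_of_eventuallyEq h1 h2 Filter.univ_mem h3
  have key : ∀ {W : Π x : X, TangentSpace I x}, MDiffAt (T% W) x →
      A.toFun (fun y => A.toFun σ y (W y)) x = A.toFun (fun y => A.toFun τ y (W y)) x := by
    intro W hW
    refine A.isCovariantDerivativeOnUniv.congr_of_eventuallyEq
      (A.mdiffAt_cov_apply hu hσ hW) (A.mdiffAt_cov_apply hu hτ hW) Filter.univ_mem ?_
    filter_upwards [h0] with y hy
    rw [hy]
  simp only [curvatureAux]
  rw [key hY, key hZ, h0.self_of_nhds]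

theorem extend_eventually_add (x : X) (v w : V x) :
    ∀ᶠ y in 𝓝 x, extend F (v + w) y = (extend F v + extend F w) y := by
  filter_upwards [(trivializationAt F V x).open_baseSet.mem_nhds
    (mem_baseSet_trivializationAt' x)] with y hy
  have h := (trivializationAt F V x).linear ℝ (mem_baseSet_trivializationAt' (F := F) (E := V) x)
  simp only [extend, Pi.add_apply, ← (trivializationAt F V x).coe_symmₗ (R := ℝ) hy, h.map_add,
    map_add]

theorem extend_eventually_smul (x : X) (c : ℝ) (v : V x) :
    ∀ᶠ y in 𝓝 x, extend F (c • v) y = (c • extend F v) y := by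
  filter_upwards [(trivializationAt F V x).open_baseSet.mem_nhds
    (mem_baseSet_trivializationAt' x)] with y hy
  have h := (trivializationAt F V x).linear ℝ (mem_baseSet_trivializationAt' (F := F) (E := V) x)
  simp only [extend, Pi.smul_apply, ← (trivializationAt F V x).coe_symmₗ (R := ℝ) hy, h.map_smul,
    map_smul]

variable [T2Space X]

/-- The curvature endomorphism `F_A(u, v)` of `V x`, for tangent vectors `u`, `v` at `x`: the value
at `x` of `∇_Y ∇_Z σ - ∇_Z ∇_Y σ - ∇_[Y,Z] σ`, where the vector fields `Y`, `Z` extend `u`, `v` and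
the section `σ` extends `w` smoothly near `x`. -/
def curvatureEnd (x : X) (u v : TangentSpace I x) : V x →ₗ[ℝ] V x where
  toFun w := A.curvatureAux (extend F w) (extend E u) (extend E v) x
  map_add' w w' := by
    obtain ⟨s, hs, h⟩ := exists_contMDiffOn_extend (k := ∞) I F w
    obtain ⟨s', hs', h'⟩ := exists_contMDiffOn_extend (k := ∞) I F w'
    obtain ⟨t, ht, h''⟩ := exists_contMDiffOn_extend (k := ∞) I F (w + w')
    have hu := Filter.inter_mem (Filter.inter_mem hs hs') ht
    replace h := h.mono (inter_subset_left.trans inter_subset_left : (s ∩ s') ∩ t ⊆ s)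
    replace h' := h'.mono (inter_subset_left.trans inter_subset_right : (s ∩ s') ∩ t ⊆ s')
    replace h'' := h''.mono (inter_subset_right : (s ∩ s') ∩ t ⊆ t)
    rw [A.curvatureAux_congr hu h'' (h.add_section h') (extend_eventually_add x w w')
      (mdifferentiableAt_extend ..) (mdifferentiableAt_extend ..),
      A.curvatureAux_add hu h h' (mdifferentiableAt_extend ..) (mdifferentiableAt_extend ..)]
  map_smul' c w := by
    obtain ⟨s, hs, h⟩ := exists_contMDiffOn_extend (k := ∞) I F w
    obtain ⟨t, ht, h''⟩ := exists_contMDiffOn_extend (k := ∞) I F (c • w)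
    have hu := Filter.inter_mem hs ht
    replace h := h.mono (inter_subset_left : s ∩ t ⊆ s)
    replace h'' := h''.mono (inter_subset_right : s ∩ t ⊆ t)
    rw [A.curvatureAux_congr hu h'' h.const_smul_section (extend_eventually_smul x c w)
      (mdifferentiableAt_extend ..) (mdifferentiableAt_extend ..),
      A.curvatureAux_smul hu h (mdifferentiableAt_extend ..) (mdifferentiableAt_extend ..)]
    rfl

theorem curvatureEnd_swap (x : X) (u v : TangentSpace I x) :
    A.curvatureEnd x u v = - A.curvatureEnd x v u := by
  ext w
  exact A.curvatureAux_swap _ _ _ _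

theorem curvatureEnd_add (x : X) (u v v' : TangentSpace I x) :
    A.curvatureEnd x u (v + v') = A.curvatureEnd x u v + A.curvatureEnd x u v' := by
  ext w
  obtain ⟨s, hs, hw⟩ := exists_contMDiffOn_extend (k := ∞) I F w
  have h := A.tensorial_curvatureAux₂ hs hw (extend E u)
  exact (TensorialAt.mkHom _ x h).map_add v v'

theorem curvatureEnd_smul (x : X) (c : ℝ) (u v : TangentSpace I x) :
    A.curvatureEnd x u (c • v) = c • A.curvatureEnd x u v := by
  ext w
  obtain ⟨s, hs, hw⟩ := exists_contMDiffOn_extend (k := ∞) I F w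
  have h := A.tensorial_curvatureAux₂ hs hw (extend E u)
  exact (TensorialAt.mkHom _ x h).map_smul c v

/-- The curvature of `A` as a 2-form with values in the endomorphisms of `V`. -/
def curvature (x : X) : TangentSpace I x [⋀^Fin 2]→ₗ[ℝ] (V x →ₗ[ℝ] V x) where
  toFun v := A.curvatureEnd x (v 0) (v 1)
  map_update_add' {_} v i a b := by
    fin_cases i
    · simp [A.curvatureEnd_swap x _ (v 1), A.curvatureEnd_add, add_comm]
    · simp [A.curvatureEnd_add]
  map_update_smul' {_} v i c a := by
    fin_cases i
    · simp [A.curvatureEnd_swap x _ (v 1), A.curvatureEnd_smul]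
    · simp [A.curvatureEnd_smul]
  map_eq_zero_of_eq' v i j h hij := by
    have h01 : v 0 = v 1 := by
      fin_cases i <;> fin_cases j <;> simp_all
    rw [← h01]
    ext w
    simp [curvatureEnd, curvatureAux]

end MetricConnection
end Connections

section FourManifolds

variable {X : Type*} [TopologicalSpace X] [ChartedSpace (EuclideanSpace ℝ (Fin 4)) X]

/-- A 4-form on the 4-manifold `X` (no regularity required). -/
abbrev FourForm (X : Type*) [TopologicalSpace X] [ChartedSpace (EuclideanSpace ℝ (Fin 4)) X] :
    Type _ :=
  ∀ x : X, TangentSpace (𝓡 4) x [⋀^Fin 4]→ₗ[ℝ] ℝ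

/-- A choice of an orientation of each tangent space of `X`. -/
abbrev TangentOrientation (X : Type*) [TopologicalSpace X]
    [ChartedSpace (EuclideanSpace ℝ (Fin 4)) X] : Type _ :=
  ∀ x : X, Orientation ℝ (TangentSpace (𝓡 4) x) (Fin 4)

/-- A basis of the tangent space at `x`. -/
def tangentBasis (x : X) : Module.Basis (Fin 4) ℝ (TangentSpace (𝓡 4) x) :=
  (EuclideanSpace.basisFun (Fin 4) ℝ).toBasis

/-- The quotient `α / β` of two elements of the line `Λ⁴ T*_x X`, where `β ≠ 0`. (It does not depend
on the basis at which `α` and `β` are evaluated.) -/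
def fourFormRatio (x : X) (α β : TangentSpace (𝓡 4) x [⋀^Fin 4]→ₗ[ℝ] ℝ) : ℝ :=
  α (tangentBasis x) / β (tangentBasis x)

/-- The coordinate vectors `∂₁, …, ∂₄` at `x` of the chart of `X` around `p`. -/
def coordVec (p x : X) (k : Fin 4) : TangentSpace (𝓡 4) x :=
  mfderivWithin 𝓘(ℝ, EuclideanSpace ℝ (Fin 4)) (𝓡 4) (extChartAt (𝓡 4) p).symm (range (𝓡 4))
    (extChartAt (𝓡 4) p x) (EuclideanSpace.single k 1)

/-- The sign (`1` or `-1` on bases) of a family of four vectors with respect to an orientation. -/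
def orientationSign {T : Type*} [AddCommGroup T] [Module ℝ T]
    (o : Orientation ℝ T (Fin 4)) (v : Fin 4 → T) : ℝ :=
  (SignType.sign (o.someVector v) : ℝ)

variable [IsManifold (𝓡 4) ∞ X] [T2Space X] [CompactSpace X]

variable (X) in
/-- A smooth partition of unity on `X`, indexed by the points of `X`, with the function of index `p`
supported in the domain of the chart around `p`. -/
def chartPartition : SmoothPartitionOfUnity X (𝓡 4) X univ :=
  (SmoothPartitionOfUnity.exists_isSubordinate_chartAt_source (𝓡 4) X).choose

/-- The integral of a 4-form over the compact 4-manifold `X` with the orientation `o`, by means of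
charts and a partition of unity. (Locally finite families on a compact space are finite, so all but
finitely many terms of the sum vanish. The value for a continuous form and a continuous orientation
does not depend on the partition of unity.) -/
def integralFourForm (o : TangentOrientation X) (η : FourForm X) : ℝ :=
  ∑ᶠ p : X, ∫ y in (extChartAt (𝓡 4) p).target,
    let x := (extChartAt (𝓡 4) p).symm y
    chartPartition X p x * (orientationSign (o x) (coordVec p x) * η x (coordVec p x))

end FourManifolds

section DefiniteConnections

variable {X : Type*} [TopologicalSpace X] [ChartedSpace (EuclideanSpace ℝ (Fin 4)) X]
  [IsManifold (𝓡 4) ∞ X] [T2Space X]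
  {V : X → Type*} [TopologicalSpace (TotalSpace (EuclideanSpace ℝ (Fin 3)) V)]
  [∀ x, NormedAddCommGroup (V x)] [∀ x, InnerProductSpace ℝ (V x)]
  [FiberBundle (EuclideanSpace ℝ (Fin 3)) V] [VectorBundle ℝ (EuclideanSpace ℝ (Fin 3)) V]
  [ContMDiffVectorBundle ∞ (EuclideanSpace ℝ (Fin 3)) V (𝓡 4)]
  [IsContMDiffRiemannianBundle (𝓡 4) ∞ (EuclideanSpace ℝ (Fin 3)) V]

variable (V) in
/-- An orthonormal basis of the fibre `V x`. -/
def fibreBasis (x : X) : OrthonormalBasis (Fin 3) ℝ (V x) :=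
  haveI : FiniteDimensional ℝ (V x) :=
    VectorBundle.finiteDimensional ℝ (EuclideanSpace ℝ (Fin 3)) V x
  (stdOrthonormalBasis ℝ (V x)).reindex (finCongr (by
    rw [(VectorBundle.continuousLinearEquivAt ℝ (EuclideanSpace ℝ (Fin 3)) V
      x).toLinearEquiv.finrank_eq]
    simp))

variable (V) in
/-- An orthonormal basis of the fibre `𝔰𝔬(V x)` of the bundle of Lie algebras. -/
def soBasis (x : X) (i : Fin 3) : V x →ₗ[ℝ] V x := soFrame (fibreBasis V x) i

namespace MetricConnection
variable (A : MetricConnection (𝓡 4) (EuclideanSpace ℝ (Fin 3)) V)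

/-- `A` is definite: its curvature is nonzero on every tangent 2-plane. -/
def IsDefinite : Prop :=
  ∀ (x : X) (u v : TangentSpace (𝓡 4) x), LinearIndependent ℝ ![u, v] → A.curvature x ![u, v] ≠ 0

/-- The curvature as a map `𝔰𝔬(V x) ≅ 𝔰𝔬(V x)* → Λ² T*_x X`, `ξ ↦ ⟨F_A, ξ⟩`. -/
def curvatureForm (x : X) (ξ : V x →ₗ[ℝ] V x) : TangentSpace (𝓡 4) x [⋀^Fin 2]→ₗ[ℝ] ℝ :=
  (soInner (V x) ξ).compAlternatingMap (A.curvature x)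

/-- The 4-form `F_A(ξ) ∧ F_A(ζ)` at `x`. -/
def curvatureWedge (x : X) (ξ ζ : V x →ₗ[ℝ] V x) : TangentSpace (𝓡 4) x [⋀^Fin 4]→ₗ[ℝ] ℝ :=
  wedge (LinearMap.mul ℝ ℝ) (A.curvatureForm x ξ) (A.curvatureForm x ζ)

/-- The first Pontrjagin form `p₁(A) = - (1 / 8π²) tr (F_A ∧ F_A)`. -/
def pontrjaginForm : FourForm X := fun x =>
  (-(1 / (8 * Real.pi ^ 2))) • wedge (tracePairing (V x)) (A.curvature x) (A.curvature x)

/-- The volume form `μ(A) = (1 / 3) ∑ F_i ∧ F_i`, where `F_A = ∑ F_i ⊗ e_i` for an orthonormal basis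
`e_i` of `𝔰𝔬(V x)`. -/
def volumeForm : FourForm X := fun x =>
  (1 / 3 : ℝ) • ∑ i : Fin 3, A.curvatureWedge x (soBasis V x i) (soBasis V x i)

open scoped Classical in
/-- The orientation of `X` for which the volume form `μ(A)` of the definite connection `A` is
positive. (The volume form of a definite connection vanishes nowhere; where `μ(A) = 0` the value is
a dummy.) -/
def orientation : TangentOrientation X := fun x =>
  if h : A.volumeForm x ≠ 0 then rayOfNeZero ℝ (A.volumeForm x) h else (tangentBasis x).orientation

/-- The symmetric bilinear form `Q(A)(ξ, ζ) = (F_A(ξ) ∧ F_A(ζ)) / μ(A)`. -/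
def Q (x : X) (ξ ζ : V x →ₗ[ℝ] V x) : ℝ :=
  fourFormRatio x (A.curvatureWedge x ξ ζ) (A.volumeForm x)

/-- `|Q(A)|² = ∑ Q(A)_ij Q(A)_ji` in an orthonormal basis. -/
def normSqQ (x : X) : ℝ :=
  ∑ i : Fin 3, ∑ j : Fin 3,
    A.Q x (soBasis V x i) (soBasis V x j) * A.Q x (soBasis V x j) (soBasis V x i)

/-- `A` is perfect: `F_A : 𝔰𝔬(V x)* → Λ⁺_A` is an isometry for every `x`. The inner product on the
image `Λ⁺_A` of `F_A`, the bundle of self-dual forms of the Riemannian metric of `A`, is given by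
`α ∧ β = ⟨α, β⟩ μ(A)`. -/
def IsPerfect : Prop :=
  ∀ x : X, ∀ ξ ∈ soAlgebra (V x), ∀ ζ ∈ soAlgebra (V x),
    A.curvatureWedge x ξ ζ = soInner (V x) ξ ζ • A.volumeForm x

/-- The energy `∫_X |Q(A)|² μ(A)` of a definite connection. -/
def energy [CompactSpace X] : ℝ :=
  integralFourForm A.orientation fun x => A.normSqQ x • A.volumeForm x

end MetricConnection

variable (V) in
open scoped Classical in
/-- The Pontrjagin number `p₁(V) = ⟨p₁(V), [X]⟩` of `V` over the compact manifold `X` with the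
orientation `o`, in the sense of Chern and Weil: the integral of the Pontrjagin form of a metric
connection in `V`. (It does not depend on the connection, and there is always one.) -/
def pontrjaginNumber [CompactSpace X] (o : TangentOrientation X) : ℝ :=
  if h : Nonempty (MetricConnection (𝓡 4) (EuclideanSpace ℝ (Fin 3)) V) then
    integralFourForm o (Classical.choice h).pontrjaginForm
  else 0

end DefiniteConnections
end

/-!
Write `F_A = ∑ F_i ⊗ e_i` in an orthonormal frame of `𝔰𝔬(V)`. Then
`tr (F_A ∧ F_A) = -∑ F_i ∧ F_i = -3 μ(A)`, so that `8π² p₁(A) = 3 μ(A)` pointwise, while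
`tr Q(A) = 3` gives `|Q(A)|² - 3 = ∑ (Q(A)_ij - δ_ij)² ≥ 0`. Hence `𝓔(A) - 8π² p₁(V)` is the
integral of the non-negative form `(|Q(A)|² - 3) μ(A)`. The integrand being continuous, the
integral vanishes only if `Q(A)` is the identity everywhere, that is, if `A` is perfect. Three
facts are needed to make this rigorous.

* The form `μ(A)` of a definite connection vanishes nowhere
  (`MetricConnection.IsDefinite.volumeForm_ne_zero`). If `⟨F_A, ξ⟩` had square zero for some
  `ξ ≠ 0`, it would be degenerate on the 4-dimensional tangent space; a vector `u` in its kernel is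
  mapped by `F_A(u, ·)` into the 2-dimensional complement of `ξ`, so `F_A(u, v) = 0` for some `v`
  independent of `u`. Thus `ξ ↦ ⟨F_A, ξ⟩²` has no isotropic vectors, its values have one sign, and
  its trace cannot vanish. This uses that the curvature is skew-adjoint
  (`MetricConnection.curvature_mem_soAlgebra`), a consequence of the compatibility of `A` with the
  metric and of the symmetry of second derivatives.

* The integral of `tr (F_B ∧ F_B)` does not depend on `B`
  (`MetricConnection.integralFourForm_traceForm_eq`). The curvature is computed in a chart and a
  local trivialization as `∂_k θ_l - ∂_l θ_k + [θ_k, θ_l]` (`MetricConnection.repr_curvature`). The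
  Chern-Simons form `tr (a ∧ (F_B + F_B')) - (1/3) tr (a ∧ a ∧ a)`, `a = B - B'`, is globally
  defined, and its exterior derivative is the difference of the two forms (`transgression`).
  Stokes' theorem on the closed manifold `X` (`integralFourForm_eq_zero_of_exact`) is proved with
  the partition of unity which defines the integral: the integral over `X` of `ρ_p dη` is minus
  that of `dρ_p ∧ η` by integration by parts in the chart around `p`, and the sum of the latter
  over `p` is zero since `∑ dρ_p = 0`. This rests on the change of variables between charts
  (`chartIntegral_eq_chartIntegral`).

* The orientation defined by `μ(A)` is locally constant in charts, and `|Q(A)|² μ(A)` is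
  continuous. For the latter, `∑ (F_i ∧ F_j)²` is written in terms of the functions
  `tr (F_A(u, v) F_A(u', v'))` (`MetricConnection.sum_curvatureWedge_mul_curvatureWedge`), which
  involve no frame.
-/

noncomputable section

local notation "ℝ⁴" => EuclideanSpace ℝ (Fin 4)

/-! ### Coordinate vector fields -/

section Coordinates

variable {X : Type*} [TopologicalSpace X] [ChartedSpace (ℝ⁴) X]

theorem extChartAt_target_mem_nhds_of_source {p x : X} (hx : x ∈ (extChartAt (𝓡 4) p).source) :
    (extChartAt (𝓡 4) p).target ∈ 𝓝 (extChartAt (𝓡 4) p x) :=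
  (isOpen_extChartAt_target p).mem_nhds ((extChartAt (𝓡 4) p).map_source hx)

variable [IsManifold (𝓡 4) ∞ X]

theorem contMDiffAt_extChartAt_symm_of_source {p x : X}
    (hx : x ∈ (extChartAt (𝓡 4) p).source) :
    ContMDiffAt 𝓘(ℝ, ℝ⁴) (𝓡 4) ∞ (extChartAt (𝓡 4) p).symm
      (extChartAt (𝓡 4) p x) :=
  (contMDiffOn_extChartAt_symm p).contMDiffAt (extChartAt_target_mem_nhds_of_source hx)

theorem ContMDiffAt.contDiffAt_comp_extChartAt_symm {G : Type*} [NormedAddCommGroup G]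
    [NormedSpace ℝ G] {n : ℕ∞ω} (hn : n ≤ ∞) {p x : X} (hx : x ∈ (extChartAt (𝓡 4) p).source)
    {f : X → G} (hf : ContMDiffAt (𝓡 4) 𝓘(ℝ, G) n f x) :
    ContDiffAt ℝ n (fun y => f ((extChartAt (𝓡 4) p).symm y)) (extChartAt (𝓡 4) p x) := by
  rw [← contMDiffAt_iff_contDiffAt]
  refine ContMDiffAt.comp (g := f) (I' := 𝓡 4) _ ?_
    ((contMDiffAt_extChartAt_symm_of_source hx).of_le hn)
  rwa [(extChartAt (𝓡 4) p).left_inv hx]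

/-- The partial derivatives of a function read in a chart are its derivatives along the coordinate
vectors. -/
theorem MDifferentiableAt.hasFDerivAt_comp_extChartAt_symm {G : Type*} [NormedAddCommGroup G]
    [NormedSpace ℝ G] {p x : X} (hx : x ∈ (extChartAt (𝓡 4) p).source)
    {f : X → G} (hf : MDifferentiableAt (𝓡 4) 𝓘(ℝ, G) f x) :
    DifferentiableAt ℝ (fun y => f ((extChartAt (𝓡 4) p).symm y)) (extChartAt (𝓡 4) p x) ∧
    ∀ k, fderiv ℝ (fun y => f ((extChartAt (𝓡 4) p).symm y)) (extChartAt (𝓡 4) p x)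
      (EuclideanSpace.single k 1) = mvfderiv (𝓡 4) f x (coordVec p x k) := by
  have h1 := (contMDiffAt_extChartAt_symm_of_source hx).mdifferentiableAt (by simp)
  have hxx := (extChartAt (𝓡 4) p).left_inv hx
  have h2 := h1.hasMFDerivAt
  have h3 : HasMFDerivAt (𝓡 4) 𝓘(ℝ, G) f ((extChartAt (𝓡 4) p).symm (extChartAt (𝓡 4) p x))
    (mfderiv (𝓡 4) 𝓘(ℝ, G) f ((extChartAt (𝓡 4) p).symm (extChartAt (𝓡 4) p x))) :=
    MDifferentiableAt.hasMFDerivAt (by rwa [hxx])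
  have h4 : ∃ L : ℝ⁴ →L[ℝ] G,
      HasFDerivAt (fun y => f ((extChartAt (𝓡 4) p).symm y)) L (extChartAt (𝓡 4) p x) ∧
      ∀ k, L (EuclideanSpace.single k 1) = mvfderiv (𝓡 4) f x (coordVec p x k) := by
    refine ⟨_, (HasMFDerivAt.comp _ h3 h2).hasFDerivAt, fun k => ?_⟩
    have : range (𝓡 4) = univ := by simp
    rw [coordVec, this, mfderivWithin_univ]
    simp only [mvfderiv]
    exact congrArg (fun z => mfderiv (𝓡 4) 𝓘(ℝ, G) f z
      (mfderiv 𝓘(ℝ, ℝ⁴) (𝓡 4) (extChartAt (𝓡 4) p).symm (extChartAt (𝓡 4) p x)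
        (EuclideanSpace.single k 1))) hxx
  obtain ⟨L, hL, h5⟩ := h4
  exact ⟨hL.differentiableAt, fun k => by rw [hL.fderiv, h5]⟩

/-- The coordinate vector field `∂_k` of the chart around `p`. -/
def coordField (p : X) (k : Fin 4) : Π x : X, TangentSpace (𝓡 4) x := fun x => coordVec p x k

theorem coordVec_eq_symmL {p x : X} (hx : x ∈ (extChartAt (𝓡 4) p).source) (k : Fin 4) :
    coordVec p x k = (trivializationAt (ℝ⁴)
      (TangentSpace (𝓡 4) : X → Type _) p).symm x (EuclideanSpace.single k 1) := by
  rw [extChartAt_source] at hx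
  exact (DFunLike.congr_fun (TangentBundle.symmL_trivializationAt (𝕜 := ℝ) (I := 𝓡 4) hx)
    (EuclideanSpace.single k 1)).symm.trans
      (Trivialization.symmL_apply (R := ℝ) _ (by simpa using hx) _)

theorem contMDiffAt_coordField {p x : X} (hx : x ∈ (extChartAt (𝓡 4) p).source) (k : Fin 4) :
    ContMDiffAt (𝓡 4) ((𝓡 4).prod 𝓘(ℝ, ℝ⁴)) ∞
      (fun x => (⟨x, coordField p k x⟩ : TangentBundle (𝓡 4) X)) x := by
  set e := trivializationAt (ℝ⁴) (TangentSpace (𝓡 4) : X → Type _) p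
  have hb : x ∈ e.baseSet := by
    rw [extChartAt_source] at hx; simpa [e] using hx
  rw [e.contMDiffAt_section_iff hb]
  refine (contMDiffAt_const (c := EuclideanSpace.single k 1)).congr_of_eventuallyEq ?_
  filter_upwards [(isOpen_extChartAt_source p).mem_nhds hx, e.open_baseSet.mem_nhds hb]
    with y hy hy'
  simp only [coordField, coordVec_eq_symmL hy]
  rw [e.apply_mk_symm hy']

theorem two_le_infty : (2 : ℕ∞ω) ≤ ∞ :=
  (mod_cast le_top : ((2 : ℕ∞) : ℕ∞ω) ≤ ∞)

theorem lieBracketWithin_const (v w y : ℝ⁴) :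
    lieBracketWithin ℝ (fun _ => v) (fun _ => w) univ y = 0 := by
  simp [lieBracketWithin]

/-- The constant vector field `v` on `ℝ⁴`. -/
def constField (v : ℝ⁴) : Π z : ℝ⁴, TangentSpace 𝓘(ℝ, ℝ⁴) z := fun _ => v

theorem coordField_eq_mpullback {p x : X} (hx : x ∈ (extChartAt (𝓡 4) p).source) (k : Fin 4) :
    coordField p k x = mpullback (𝓡 4) 𝓘(ℝ, ℝ⁴) (extChartAt (𝓡 4) p)
      (constField (EuclideanSpace.single k 1)) x := by
  have hy := (extChartAt (𝓡 4) p).map_source hx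
  have h1 := mfderivWithin_extChartAt_symm_comp_mfderiv_extChartAt (I := 𝓡 4) hy
  have h2 := mfderiv_extChartAt_comp_mfderivWithin_extChartAt_symm (I := 𝓡 4) hy
  rw [(extChartAt (𝓡 4) p).left_inv hx] at h1 h2
  rw [mpullback_apply, ContinuousLinearMap.inverse_eq h2 h1]
  rfl

theorem mlieBracket_coordField {p x : X} (hx : x ∈ (extChartAt (𝓡 4) p).source) (k l : Fin 4) :
    mlieBracket (𝓡 4) (coordField p k) (coordField p l) x = 0 := by
  have hn : ∀ k : Fin 4, coordField p k =ᶠ[𝓝 x] mpullback (𝓡 4) 𝓘(ℝ, ℝ⁴)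
      (extChartAt (𝓡 4) p) (constField (EuclideanSpace.single k 1)) := by
    intro k
    filter_upwards [(isOpen_extChartAt_source p).mem_nhds hx] with y hy
    exact coordField_eq_mpullback hy k
  have hc : ∀ (v y : ℝ⁴), MDifferentiableAt 𝓘(ℝ, ℝ⁴) (𝓘(ℝ, ℝ⁴).prod 𝓘(ℝ, ℝ⁴))
      (fun z => (⟨z, constField v z⟩ : TangentBundle 𝓘(ℝ, ℝ⁴) ℝ⁴)) y := by
    intro v y
    refine (mdifferentiableAt_section _ (constField v)).2 ?_
    simpa [constField] using! mdifferentiableAt_const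
  have : IsManifold (𝓡 4) (minSmoothness ℝ 2) X := by
    rw [minSmoothness_of_isRCLikeNormedField]
    exact IsManifold.of_le (n := ∞) (by exact two_le_infty)
  rw [(hn k).mlieBracket_vectorField_eq (hn l),
    ← mpullback_mlieBracket (n := ∞) (hc _ _) (hc _ _) _
      (by rw [minSmoothness_of_isRCLikeNormedField]; exact two_le_infty)]
  · rw [mpullback_apply]
    have : mlieBracket 𝓘(ℝ, ℝ⁴) (constField (EuclideanSpace.single k 1))
      (constField (EuclideanSpace.single l 1)) (extChartAt (𝓡 4) p x) = 0 := by
      rw [← mlieBracketWithin_univ, mlieBracketWithin_eq_lieBracketWithin]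
      exact lieBracketWithin_const _ _ _
    rw [this, map_zero]
  · exact contMDiffAt_extChartAt' (by simpa using hx)

end Coordinates

/-! ### Connections in a chart and a trivialization -/

section LocalForm

set_option linter.unusedSectionVars false

variable {X : Type*} [TopologicalSpace X] [ChartedSpace ℝ⁴ X] [IsManifold (𝓡 4) ∞ X] [T2Space X]
  {F : Type*} [NormedAddCommGroup F] [NormedSpace ℝ F] [FiniteDimensional ℝ F]
  {V : X → Type*} [TopologicalSpace (TotalSpace F V)]
  [∀ x, NormedAddCommGroup (V x)] [∀ x, InnerProductSpace ℝ (V x)]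
  [FiberBundle F V] [VectorBundle ℝ F V]
  [ContMDiffVectorBundle ∞ F V (𝓡 4)] [IsContMDiffRiemannianBundle (𝓡 4) ∞ F V]

/-- Smoothness of a section of `V` at a point. -/
abbrev SmoothSectionAt (F : Type*) [NormedAddCommGroup F] [NormedSpace ℝ F]
    {V : X → Type*} [TopologicalSpace (TotalSpace F V)] [∀ x, TopologicalSpace (V x)]
    [FiberBundle F V] (σ : Π x : X, V x) (x : X) : Prop :=
  ContMDiffAt (𝓡 4) ((𝓡 4).prod 𝓘(ℝ, F)) ∞ (fun y => (⟨y, σ y⟩ : TotalSpace F V)) x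

/-- Differentiability of a section of `V` at a point. -/
abbrev DiffSectionAt (F : Type*) [NormedAddCommGroup F] [NormedSpace ℝ F]
    {V : X → Type*} [TopologicalSpace (TotalSpace F V)] [∀ x, TopologicalSpace (V x)]
    [FiberBundle F V] (σ : Π x : X, V x) (x : X) : Prop :=
  MDifferentiableAt (𝓡 4) ((𝓡 4).prod 𝓘(ℝ, F)) (fun y => (⟨y, σ y⟩ : TotalSpace F V)) x

/-- The section `σ` read in the chart of `X` around `p` and the trivialization `e` of `V`. -/
def localRep (p : X) (e : Trivialization F (TotalSpace.proj : TotalSpace F V → X))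
    (σ : Π x : X, V x) (y : ℝ⁴) : F :=
  (e ⟨(extChartAt (𝓡 4) p).symm y, σ ((extChartAt (𝓡 4) p).symm y)⟩).2

namespace MetricConnection

variable (A : MetricConnection (𝓡 4) F V)

/-- Smoothness is required near `x`, since being `C^∞` at `x` only means being `C^m` near `x` for
each finite `m`. -/
theorem contMDiffAt_cov {σ : Π x : X, V x} {x : X} (hσ : ∀ᶠ y in 𝓝 x, SmoothSectionAt F σ y) :
    ContMDiffAt (𝓡 4) ((𝓡 4).prod 𝓘(ℝ, ℝ⁴ →L[ℝ] F)) ∞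
      (fun y => (⟨y, A.toFun σ y⟩ :
        TotalSpace (ℝ⁴ →L[ℝ] F) fun y => TangentSpace (𝓡 4) y →L[ℝ] V y)) x := by
  obtain ⟨u, hu, hσu⟩ := Filter.eventually_iff_exists_mem.1 hσ
  have hi : interior u ∈ 𝓝 x := interior_mem_nhds.2 hu
  obtain ⟨f, -, hf⟩ := (SmoothBumpFunction.nhds_basis_tsupport (I := 𝓡 4) x).mem_iff.1 hi
  have h1 : ContMDiff (𝓡 4) ((𝓡 4).prod 𝓘(ℝ, F)) ∞
      (fun y => (⟨y, ((f : X → ℝ) • σ) y⟩ : TotalSpace F V)) :=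
    ContMDiffOn.smul_section_of_tsupport (u := interior u) f.contMDiff.contMDiffOn
      isOpen_interior hf fun y hy => (hσu y (interior_subset hy)).contMDiffWithinAt
  have h2 := A.smooth.contMDiff.contMDiff (σ := (f : X → ℝ) • σ) (by simpa using! h1.contMDiffOn)
  have h3 := h2.contMDiffAt (x := x) Filter.univ_mem
  refine h3.congr_of_eventuallyEq ?_
  have h4 : ∀ᶠ y in 𝓝 x, (∀ᶠ z in 𝓝 y, f z = 1) ∧ y ∈ u :=
    (f.eventuallyEq_one.eventually_nhds).and hu
  filter_upwards [h4] with y hy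
  congr 1
  refine A.isCovariantDerivativeOnUniv.congr_of_eventuallyEq
    ((hσu y hy.2).mdifferentiableAt (by simp))
    (h1.contMDiffAt.mdifferentiableAt (by simp)) Filter.univ_mem ?_
  filter_upwards [hy.1] with z hz
  simp [hz]

/-- `∇_k σ`, the covariant derivative of `σ` along the coordinate field `∂_k` of the chart
around `p`. -/
def covCoord (p : X) (k : Fin 4) (σ : Π x : X, V x) : Π x : X, V x :=
  fun x => A.toFun σ x (coordVec p x k)

theorem contMDiffAt_covCoord {p x : X} (hx : x ∈ (extChartAt (𝓡 4) p).source) (k : Fin 4)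
    {σ : Π x : X, V x} (hσ : ∀ᶠ y in 𝓝 x, SmoothSectionAt F σ y) :
    ∀ᶠ y in 𝓝 x, SmoothSectionAt F (A.covCoord p k σ) y := by
  filter_upwards [hσ.eventually_nhds, (isOpen_extChartAt_source p).mem_nhds hx] with y hy hys
  exact (A.contMDiffAt_cov hy).clm_bundle_apply (contMDiffAt_coordField hys k)

variable (p : X) (e : Trivialization F (TotalSpace.proj : TotalSpace F V → X))

/-- The `k`-th component of the connection form of `A` in the chart around `p` and the
trivialization `e`: the endomorphism `θ_k` of `F` for which `∇_k = ∂_k + θ_k`. -/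
def connForm [MemTrivializationAtlas e] (k : Fin 4) (y : ℝ⁴) : F →L[ℝ] F :=
  ∑ i, ((Module.finBasis ℝ F).coord i).toContinuousLinearMap.smulRight
    (localRep p e (A.covCoord p k (e.localFrame (Module.finBasis ℝ F) i)) y)

variable {p e} [MemTrivializationAtlas e]

theorem mdifferentiableAt_repr {σ : Π x : X, V x} {x : X} (hx : x ∈ e.baseSet)
    (hσ : DiffSectionAt F σ x) : MDifferentiableAt (𝓡 4) 𝓘(ℝ, F) (fun x => (e ⟨x, σ x⟩).2) x := by
  exact (e.mdifferentiableAt_section_iff _ _ hx).1 hσ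

theorem contDiffAt_localRep {σ : Π x : X, V x} {x : X} (hx : x ∈ (extChartAt (𝓡 4) p).source)
    (hxe : x ∈ e.baseSet) (hσ : SmoothSectionAt F σ x) :
    ContDiffAt ℝ ∞ (localRep p e σ) (extChartAt (𝓡 4) p x) :=
  ContMDiffAt.contDiffAt_comp_extChartAt_symm le_rfl hx ((e.contMDiffAt_section_iff hxe).1 hσ)

theorem contDiffAt_connForm {x : X} (hx : x ∈ (extChartAt (𝓡 4) p).source)
    (hxe : x ∈ e.baseSet) (k : Fin 4) :
    ContDiffAt ℝ ∞ (A.connForm p e k) (extChartAt (𝓡 4) p x) := by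
  unfold connForm
  refine ContDiffAt.sum fun i _ => ?_
  refine ContDiffAt.smulRight contDiffAt_const ?_
  refine contDiffAt_localRep hx hxe (A.contMDiffAt_covCoord hx k ?_).self_of_nhds
  filter_upwards [e.open_baseSet.mem_nhds hxe] with y hy
  exact contMDiffAt_localFrame_of_mem ∞ e _ i hy

omit [T2Space X] in
theorem cov_sum_smul {ι : Type*} (s : Finset ι) {x : X} {c : ι → X → ℝ} {S : ι → Π x : X, V x}
    (hc : ∀ i, MDifferentiableAt (𝓡 4) 𝓘(ℝ, ℝ) (c i) x) (hS : ∀ i, DiffSectionAt F (S i) x) :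
    A.toFun (∑ i ∈ s, c i • S i) x =
      ∑ i ∈ s, (c i x • A.toFun (S i) x + (mvfderiv (𝓡 4) (c i) x).smulRight (S i x)) := by
  classical
  induction s using Finset.induction_on with
  | empty => simp
  | insert a s ha ih =>
    have hs : DiffSectionAt F (∑ i ∈ s, c i • S i) x := by
      have := MDifferentiableAt.sum_section (s := s) (fun i _ => (hc i).smul_section (hS i))
      refine this.congr_of_eventuallyEq (Filter.Eventually.of_forall fun y => ?_)
      simp
    rw [Finset.sum_insert ha, Finset.sum_insert ha,
      A.isCovariantDerivativeOnUniv.add ((hc a).smul_section (hS a)) hs, ih,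
      A.isCovariantDerivativeOnUniv.leibniz (hS a) (hc a)]

/-- The covariant derivative in coordinates: `∇_k = ∂_k + θ_k`. -/
theorem localRep_covCoord {σ : Π x : X, V x} {x : X} (hx : x ∈ (extChartAt (𝓡 4) p).source)
    (hxe : x ∈ e.baseSet) (hσ : DiffSectionAt F σ x) (k : Fin 4) :
    localRep p e (A.covCoord p k σ) (extChartAt (𝓡 4) p x) =
      fderiv ℝ (localRep p e σ) (extChartAt (𝓡 4) p x) (EuclideanSpace.single k 1) +
      A.connForm p e k (extChartAt (𝓡 4) p x) (localRep p e σ (extChartAt (𝓡 4) p x)) := by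
  set b := Module.finBasis ℝ F
  have hxx := (extChartAt (𝓡 4) p).left_inv hx
  have hr := mdifferentiableAt_repr hxe hσ
  let L : Fin (Module.finrank ℝ F) → F →L[ℝ] ℝ := fun i => (b.coord i).toContinuousLinearMap
  let c : Fin (Module.finrank ℝ F) → X → ℝ := fun i x => L i (e ⟨x, σ x⟩).2
  have hc : ∀ i, MDifferentiableAt (𝓡 4) 𝓘(ℝ, ℝ) (c i) x := fun i =>
    (L i).differentiableAt.comp_mdifferentiableAt hr
  have hS : ∀ i, DiffSectionAt F (e.localFrame b i) x := fun i =>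
    (contMDiffAt_localFrame_of_mem ∞ e b i hxe).mdifferentiableAt (by simp)
  have hσ' : ∀ᶠ y in 𝓝 x, σ y = (∑ i, c i • e.localFrame b i) y := by
    filter_upwards [Trivialization.eventually_eq_localFrame_sum_coeff_smul (I := 𝓡 4) (s := σ) e b
      hxe, e.open_baseSet.mem_nhds hxe] with y hy hye
    rw [hy]
    simp [e.localFrameCoeff_eq_coeff (I := 𝓡 4) (b := b) (s := σ) hye, c, L]
  have hsum : DiffSectionAt F (∑ i, c i • e.localFrame b i) x :=
    hσ.congr_of_eventuallyEq (hσ'.mono fun y hy => congrArg (TotalSpace.mk' F y) hy.symm)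
  have h1 : A.toFun σ x = _ := (A.isCovariantDerivativeOnUniv.congr_of_eventuallyEq hσ hsum
    Filter.univ_mem hσ').trans (A.cov_sum_smul Finset.univ hc hS)
  obtain ⟨hd, hd'⟩ := MDifferentiableAt.hasFDerivAt_comp_extChartAt_symm hx hr
  have h2 : ∀ i, mvfderiv (𝓡 4) (c i) x (coordVec p x k) =
      L i (fderiv ℝ (localRep p e σ) (extChartAt (𝓡 4) p x) (EuclideanSpace.single k 1)) := by
    intro i
    rw [← (MDifferentiableAt.hasFDerivAt_comp_extChartAt_symm hx (hc i)).2 k]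
    have := ((L i).hasFDerivAt.comp (extChartAt (𝓡 4) p x) hd.hasFDerivAt).fderiv
    exact congrArg (fun M : ℝ⁴ →L[ℝ] ℝ => M (EuclideanSpace.single k 1)) this
  have hb : ∀ v : F, ∑ i, L i v • b i = v := fun v => b.sum_repr v
  have hcv : ∀ v : V x, (e ⟨x, v⟩).2 = e.continuousLinearEquivAt ℝ x hxe v := fun v => by simp
  have hloc : ∀ τ : Π x : X, V x, localRep p e τ (extChartAt (𝓡 4) p x) = (e ⟨x, τ x⟩).2 := by
    intro τ; rw [localRep, hxx]
  rw [hloc, hloc, covCoord, h1, hcv]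
  simp only [sum_apply, add_apply,
    smul_apply, ContinuousLinearMap.smulRight_apply, map_sum, map_add,
    map_smul, Finset.sum_add_distrib, h2]
  rw [add_comm]
  congr 1
  · conv_rhs =>
      rw [← hb (fderiv ℝ (localRep p e σ) (extChartAt (𝓡 4) p x) (EuclideanSpace.single k 1))]
    refine Finset.sum_congr rfl fun i _ => ?_
    congr 1
    rw [e.localFrame_apply_of_mem_baseSet b hxe]
    simp [Trivialization.basisAt, e.apply_mk_symm hxe]
  · simp only [connForm, sum_apply, ContinuousLinearMap.smulRight_apply, hloc]
    refine Finset.sum_congr rfl fun i _ => ?_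
    rw [hcv]
    rfl

end MetricConnection
end LocalForm

/-! ### Curvature in a chart and a trivialization -/

section LocalCurvature

set_option linter.unusedSectionVars false

variable {X : Type*} [TopologicalSpace X] [ChartedSpace ℝ⁴ X]

/-- Transport of a property that holds near `x` to the chart around `p`. -/
theorem eventually_extChartAt_symm {p x : X} (hx : x ∈ (extChartAt (𝓡 4) p).source)
    {P : X → ℝ⁴ → Prop} (h : ∀ᶠ z in 𝓝 x, P z (extChartAt (𝓡 4) p z)) :
    ∀ᶠ y in 𝓝 (extChartAt (𝓡 4) p x), P ((extChartAt (𝓡 4) p).symm y) y := by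
  have hc : Filter.Tendsto (extChartAt (𝓡 4) p).symm (𝓝 (extChartAt (𝓡 4) p x)) (𝓝 x) := by
    have := continuousAt_extChartAt_symm' (I := 𝓡 4) hx
    rwa [ContinuousAt, (extChartAt (𝓡 4) p).left_inv hx] at this
  filter_upwards [hc.eventually h, extChartAt_target_mem_nhds_of_source hx] with y hy hyt
  rwa [(extChartAt (𝓡 4) p).right_inv hyt] at hy

theorem coordVec_self (x : X) (k : Fin 4) [IsManifold (𝓡 4) ∞ X] :
    coordVec x x k = tangentBasis x k := by
  rw [coordVec, mfderivWithin_range_extChartAt_symm]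
  simp only [tangentBasis]
  exact (EuclideanSpace.basisFun_apply (Fin 4) ℝ k).symm

theorem fderiv_fderiv_apply_comm {G : Type*} [NormedAddCommGroup G] [NormedSpace ℝ G]
    {c : ℝ⁴ → G} {y : ℝ⁴} (hc : ContDiffAt ℝ ∞ c y) (v w : ℝ⁴) :
    fderiv ℝ (fun z => fderiv ℝ c z v) y w = fderiv ℝ (fun z => fderiv ℝ c z w) y v := by
  have hs : IsSymmSndFDerivAt ℝ c y := hc.isSymmSndFDerivAt (by
    rw [minSmoothness_of_isRCLikeNormedField]; exact two_le_infty)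
  have hd : DifferentiableAt ℝ (fderiv ℝ c) y :=
    (hc.fderiv_right (m := 1) (by exact two_le_infty)).differentiableAt (by simp)
  have : ∀ v, fderiv ℝ (fun z => fderiv ℝ c z v) y = (fderiv ℝ (fderiv ℝ c) y).flip v := by
    intro v
    ext u
    have := hd.hasFDerivAt.clm_apply (hasFDerivAt_const v y)
    rw [this.fderiv]
    simp
  rw [this, this]
  exact hs w v

/-- The component `∂_k θ_l - ∂_l θ_k + [θ_k, θ_l]` of the curvature of the connection form `θ`. -/
def curvOf {R : Type*} [NormedRing R] [NormedAlgebra ℝ R] (θ : Fin 4 → ℝ⁴ → R)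
    (k l : Fin 4) (y : ℝ⁴) : R :=
  fderiv ℝ (θ l) y (EuclideanSpace.single k 1) - fderiv ℝ (θ k) y (EuclideanSpace.single l 1) +
    (θ k y * θ l y - θ l y * θ k y)

variable [IsManifold (𝓡 4) ∞ X] [T2Space X]
  {F : Type*} [NormedAddCommGroup F] [NormedSpace ℝ F] [FiniteDimensional ℝ F]
  {V : X → Type*} [TopologicalSpace (TotalSpace F V)]
  [∀ x, NormedAddCommGroup (V x)] [∀ x, InnerProductSpace ℝ (V x)]
  [FiberBundle F V] [VectorBundle ℝ F V]
  [ContMDiffVectorBundle ∞ F V (𝓡 4)] [IsContMDiffRiemannianBundle (𝓡 4) ∞ F V]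

namespace MetricConnection

variable (A : MetricConnection (𝓡 4) F V)

theorem eventually_smoothSectionAt_extend {x : X} (w : V x) :
    ∀ᶠ y in 𝓝 x, SmoothSectionAt F (extend F w) y := by
  obtain ⟨s, hs, h⟩ := exists_contMDiffOn_extend (k := ∞) (𝓡 4) F w
  filter_upwards [eventually_mem_nhds_iff.2 hs] with y hy
  exact h.contMDiffAt hy

/-- The coordinate fields commute, so the curvature is the commutator of covariant derivatives along
them. -/
theorem curvature_coordVec {p x : X} (hx : x ∈ (extChartAt (𝓡 4) p).source) (k l : Fin 4)
    (w : V x) :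
    A.curvature x ![coordVec p x k, coordVec p x l] w =
      A.covCoord p k (A.covCoord p l (extend F w)) x -
      A.covCoord p l (A.covCoord p k (extend F w)) x := by
  obtain ⟨s, hs, hw⟩ := exists_contMDiffOn_extend (k := ∞) (𝓡 4) F w
  have hk := (contMDiffAt_coordField hx k).mdifferentiableAt (by simp)
  have hl := (contMDiffAt_coordField hx l).mdifferentiableAt (by simp)
  have h2 : ∀ (Y : Π x : X, TangentSpace (𝓡 4) x) (v : TangentSpace (𝓡 4) x)
      (Z : Π x : X, TangentSpace (𝓡 4) x)
      (hZ : MDifferentiableAt (𝓡 4) ((𝓡 4).prod 𝓘(ℝ, ℝ⁴))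
        (fun y => (⟨y, Z y⟩ : TangentBundle (𝓡 4) X)) x) (hv : Z x = v),
      A.curvatureAux (extend F w) Y (extend ℝ⁴ v) x = A.curvatureAux (extend F w) Y Z x := by
    intro Y v Z hZ hv
    exact (A.tensorial_curvatureAux₂ hs hw Y).pointwise (mdifferentiableAt_extend ..) hZ
      (by simp [hv])
  have h3 : A.curvature x ![coordVec p x k, coordVec p x l] w =
      A.curvatureAux (extend F w) (extend ℝ⁴ (coordVec p x k)) (extend ℝ⁴ (coordVec p x l)) x := rfl
  rw [h3, h2 _ (coordVec p x l) (coordField p l) hl rfl, A.curvatureAux_swap,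
    h2 _ (coordVec p x k) (coordField p k) hk rfl,
    ← A.curvatureAux_swap, curvatureAux, mlieBracket_coordField hx, map_zero, sub_zero]
  rfl

/-- The Leibniz rule for the metric, in coordinates. -/
theorem mvfderiv_inner_coordVec {p x : X} (k : Fin 4) {σ τ : Π x : X, V x}
    (hσ : DiffSectionAt F σ x) (hτ : DiffSectionAt F τ x) :
    mvfderiv (𝓡 4) (fun y => inner ℝ (σ y) (τ y)) x (coordVec p x k) =
      inner ℝ (A.covCoord p k σ x) (τ x) + inner ℝ (σ x) (A.covCoord p k τ x) :=
  A.metric.mvfderiv_inner_eq (coordField p k) hσ hτ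

/-- The curvature endomorphisms are skew-adjoint: the second derivatives of the function `⟨σ, τ⟩`
commute, and so do the contributions of first covariant derivatives of `σ` and `τ`. -/
theorem inner_curvature_coordVec {p x : X} (hx : x ∈ (extChartAt (𝓡 4) p).source) (k l : Fin 4)
    (w w' : V x) :
    inner ℝ (A.curvature x ![coordVec p x k, coordVec p x l] w) w' =
      - inner ℝ w (A.curvature x ![coordVec p x k, coordVec p x l] w') := by
  rw [A.curvature_coordVec hx, A.curvature_coordVec hx]
  set σ := extend F w with hσdef
  set τ := extend F w' with hτdef
  have hσ : ∀ᶠ y in 𝓝 x, SmoothSectionAt F σ y := eventually_smoothSectionAt_extend w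
  have hτ : ∀ᶠ y in 𝓝 x, SmoothSectionAt F τ y := eventually_smoothSectionAt_extend w'
  have hw : σ x = w := by simp [σ]
  have hw' : τ x = w' := by simp [τ]
  have hd : ∀ {ρ : Π x : X, V x} {y : X}, SmoothSectionAt F ρ y → DiffSectionAt F ρ y :=
    fun h => h.mdifferentiableAt (by simp)
  set f : X → ℝ := fun y => inner ℝ (σ y) (τ y) with hf
  have hfs : ContMDiffAt (𝓡 4) 𝓘(ℝ, ℝ) ∞ f x := hσ.self_of_nhds.inner_bundle hτ.self_of_nhds
  have hg := hfs.contDiffAt_comp_extChartAt_symm le_rfl hx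
  have h1 : ∀ k : Fin 4, (fun y => fderiv ℝ (fun y => f ((extChartAt (𝓡 4) p).symm y)) y
        (EuclideanSpace.single k 1)) =ᶠ[𝓝 (extChartAt (𝓡 4) p x)]
      fun y => (fun z => inner ℝ (A.covCoord p k σ z) (τ z) + inner ℝ (σ z) (A.covCoord p k τ z))
        ((extChartAt (𝓡 4) p).symm y) := by
    intro k
    refine eventually_extChartAt_symm hx (P := fun z y =>
      fderiv ℝ (fun y => f ((extChartAt (𝓡 4) p).symm y)) y (EuclideanSpace.single k 1) =
      inner ℝ (A.covCoord p k σ z) (τ z) + inner ℝ (σ z) (A.covCoord p k τ z)) ?_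
    filter_upwards [hσ, hτ, (isOpen_extChartAt_source p).mem_nhds hx] with z h1 h2 hz
    rw [← A.mvfderiv_inner_coordVec k (hd h1) (hd h2)]
    exact (MDifferentiableAt.hasFDerivAt_comp_extChartAt_symm hz
      ((hd h1).inner_bundle (hd h2))).2 k
  have h2 : ∀ k l : Fin 4, fderiv ℝ (fun y => fderiv ℝ
      (fun y => f ((extChartAt (𝓡 4) p).symm y)) y (EuclideanSpace.single l 1))
      (extChartAt (𝓡 4) p x) (EuclideanSpace.single k 1) =
      (inner ℝ (A.covCoord p k (A.covCoord p l σ) x) w' +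
        inner ℝ (A.covCoord p l σ x) (A.covCoord p k τ x)) +
      (inner ℝ (A.covCoord p k σ x) (A.covCoord p l τ x) +
        inner ℝ w (A.covCoord p k (A.covCoord p l τ) x)) := by
    intro k l
    have hσl := hd (A.contMDiffAt_covCoord hx l hσ).self_of_nhds
    have hτl := hd (A.contMDiffAt_covCoord hx l hτ).self_of_nhds
    have hσ0 := hd hσ.self_of_nhds
    have hτ0 := hd hτ.self_of_nhds
    have hsum : MDifferentiableAt (𝓡 4) 𝓘(ℝ, ℝ) (fun z => inner ℝ (A.covCoord p l σ z) (τ z) +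
        inner ℝ (σ z) (A.covCoord p l τ z)) x := (hσl.inner_bundle hτ0).add (hσ0.inner_bundle hτl)
    rw [(h1 l).fderiv_eq, (MDifferentiableAt.hasFDerivAt_comp_extChartAt_symm hx hsum).2 k,
      ← hw, ← hw', ← A.mvfderiv_inner_coordVec k hσl hτ0, ← A.mvfderiv_inner_coordVec k hσ0 hτl,
      mvfderiv_fun_add (hσl.inner_bundle hτ0) (hσ0.inner_bundle hτl)]
    rfl
  have h3 := fderiv_fderiv_apply_comm hg (EuclideanSpace.single l 1) (EuclideanSpace.single k 1)
  rw [h2 k l, h2 l k] at h3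
  rw [inner_sub_left, inner_sub_right]
  linarith

theorem curvature_mem_soAlgebra (x : X) (v : Fin 2 → TangentSpace (𝓡 4) x) :
    A.curvature x v ∈ soAlgebra (V x) := by
  have h : (soAlgebra (V x)).mkQ.compAlternatingMap (A.curvature x) = 0 := by
    refine (tangentBasis x).ext_alternating fun i _ => ?_
    simp only [LinearMap.compAlternatingMap_apply, AlternatingMap.zero_apply]
    rw [Submodule.mkQ_apply, Submodule.Quotient.mk_eq_zero]
    have : (fun j => tangentBasis x (i j)) = ![coordVec x x (i 0), coordVec x x (i 1)] := by
      ext1 j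
      fin_cases j <;> simp [coordVec_self]
    rw [this]
    exact A.inner_curvature_coordVec (mem_extChartAt_source x) _ _
  have := DFunLike.congr_fun h v
  simpa using this

variable {p : X} {e : Trivialization F (TotalSpace.proj : TotalSpace F V → X)}
  [MemTrivializationAtlas e]

theorem localRep_covCoord_covCoord {σ : Π x : X, V x} {x : X}
    (hx : x ∈ (extChartAt (𝓡 4) p).source)
    (hxe : x ∈ e.baseSet) (hσ : ∀ᶠ y in 𝓝 x, SmoothSectionAt F σ y) (k l : Fin 4) :
    localRep p e (A.covCoord p k (A.covCoord p l σ)) (extChartAt (𝓡 4) p x) =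
      fderiv ℝ (fun z => fderiv ℝ (localRep p e σ) z (EuclideanSpace.single l 1))
        (extChartAt (𝓡 4) p x) (EuclideanSpace.single k 1) +
      fderiv ℝ (A.connForm p e l) (extChartAt (𝓡 4) p x) (EuclideanSpace.single k 1)
        (localRep p e σ (extChartAt (𝓡 4) p x)) +
      A.connForm p e l (extChartAt (𝓡 4) p x)
        (fderiv ℝ (localRep p e σ) (extChartAt (𝓡 4) p x) (EuclideanSpace.single k 1)) +
      A.connForm p e k (extChartAt (𝓡 4) p x)
        (fderiv ℝ (localRep p e σ) (extChartAt (𝓡 4) p x) (EuclideanSpace.single l 1)) +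
      A.connForm p e k (extChartAt (𝓡 4) p x) (A.connForm p e l (extChartAt (𝓡 4) p x)
        (localRep p e σ (extChartAt (𝓡 4) p x))) := by
  have hd : ∀ {ρ : Π x : X, V x} {y : X}, SmoothSectionAt F ρ y → DiffSectionAt F ρ y :=
    fun h => h.mdifferentiableAt (by simp)
  have h1 : localRep p e (A.covCoord p l σ) =ᶠ[𝓝 (extChartAt (𝓡 4) p x)] fun y =>
      fderiv ℝ (localRep p e σ) y (EuclideanSpace.single l 1) +
      A.connForm p e l y (localRep p e σ y) := by
    refine eventually_extChartAt_symm hx (P := fun _ y => localRep p e (A.covCoord p l σ) y =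
      fderiv ℝ (localRep p e σ) y (EuclideanSpace.single l 1) +
      A.connForm p e l y (localRep p e σ y)) ?_
    filter_upwards [hσ, (isOpen_extChartAt_source p).mem_nhds hx, e.open_baseSet.mem_nhds hxe]
      with z h1 h2 h3
    exact A.localRep_covCoord h2 h3 (hd h1) l
  have hc := contDiffAt_localRep hx hxe hσ.self_of_nhds
  have hc' : DifferentiableAt ℝ (localRep p e σ) (extChartAt (𝓡 4) p x) :=
    hc.differentiableAt (by simp)
  have hdc : DifferentiableAt ℝ (fderiv ℝ (localRep p e σ)) (extChartAt (𝓡 4) p x) :=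
    (hc.fderiv_right (m := 1) (by exact two_le_infty)).differentiableAt (by simp)
  have hθ : DifferentiableAt ℝ (A.connForm p e l) (extChartAt (𝓡 4) p x) :=
    (A.contDiffAt_connForm hx hxe l).differentiableAt (by simp)
  rw [A.localRep_covCoord hx hxe (hd (A.contMDiffAt_covCoord hx l hσ).self_of_nhds), h1.fderiv_eq,
    h1.self_of_nhds]
  have h2 := (hdc.clm_apply (differentiableAt_const (EuclideanSpace.single l 1 : ℝ⁴)))
  have h3 := hθ.hasFDerivAt.clm_apply hc'.hasFDerivAt
  rw [fderiv_fun_add h2 h3.differentiableAt, h3.fderiv]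
  simp only [add_apply, map_add, ContinuousLinearMap.comp_apply, ContinuousLinearMap.flip_apply]
  abel

/-- The endomorphism `F_A(∂_k, ∂_l)` is `∂_k θ_l - ∂_l θ_k + [θ_k, θ_l]` in the trivialization. -/
theorem repr_curvature {x : X} (hx : x ∈ (extChartAt (𝓡 4) p).source)
    (hxe : x ∈ e.baseSet) (k l : Fin 4) (w : V x) :
    (e ⟨x, A.curvature x ![coordVec p x k, coordVec p x l] w⟩).2 =
      curvOf (A.connForm p e) k l (extChartAt (𝓡 4) p x) (e ⟨x, w⟩).2 := by
  have hσ := eventually_smoothSectionAt_extend (F := F) w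
  have hxx := (extChartAt (𝓡 4) p).left_inv hx
  have hloc : ∀ τ : Π x : X, V x, localRep p e τ (extChartAt (𝓡 4) p x) = (e ⟨x, τ x⟩).2 := by
    intro τ; rw [localRep, hxx]
  have hcv : ∀ v : V x, (e ⟨x, v⟩).2 = e.continuousLinearEquivAt ℝ x hxe v := fun v => by simp
  have hw : extend F w x = w := by simp
  rw [A.curvature_coordVec hx, hcv, map_sub, ← hcv, ← hcv, ← hloc, ← hloc,
    A.localRep_covCoord_covCoord hx hxe hσ, A.localRep_covCoord_covCoord hx hxe hσ,
    fderiv_fderiv_apply_comm (contDiffAt_localRep hx hxe hσ.self_of_nhds)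
      (EuclideanSpace.single l 1) (EuclideanSpace.single k 1), curvOf]
  simp only [add_apply, sub_apply, mul_apply_eq_comp, hloc, hw]
  abel

end MetricConnection
end LocalCurvature

/-! ### The Chern-Simons transgression formula on `ℝ⁴` -/

section ChernSimonsAlgebra

variable {R : Type*} [Ring R] [Algebra ℝ R] (t : R →ₗ[ℝ] ℝ)

/-- The derivative of a trace may be computed with the covariant derivative `X ↦ X' + [m, X]` in
place of the ordinary one. -/
theorem trace_leibniz_covariant (ht : ∀ x y, t (x * y) = t (y * x)) (m x y x' y' : R) :
    t (x' * y) + t (x * y') =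
      t ((x' + (m * x - x * m)) * y) + t (x * (y' + (m * y - y * m))) := by
  have h := ht m (x * y)
  simp only [add_mul, mul_add, sub_mul, mul_sub, map_add, map_sub, ← mul_assoc] at h ⊢
  linarith

/-- The algebra behind the transgression formula: `b` is half the difference of two connections,
`β i k = D_i b_k` are its covariant derivatives for the mean connection, `M` is the curvature of the
mean connection and `DM i k l = D_i M_kl` its covariant derivative, subject to the Bianchi
identity. -/
theorem transgression_algebra (ht : ∀ x y, t (x * y) = t (y * x)) (b : Fin 4 → R)
    (β M : Fin 4 → Fin 4 → R) (DM : Fin 4 → Fin 4 → Fin 4 → R)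
    (hB : ∀ i k l, DM i k l - DM k i l + DM l i k = 0)
    (H : Fin 4 → Fin 4 → Fin 4 → Fin 4 → ℝ)
    (hH : ∀ i k l m, H i k l m = (t (β i k * M l m) + t (b k * DM i l m)) -
      (t (β i l * M k m) + t (b l * DM i k m)) + (t (β i m * M k l) + t (b m * DM i k l)) +
      (t (β i k * (b l * b m - b m * b l)) +
        t (b k * ((β i l * b m + b l * β i m) - (β i m * b l + b m * β i l)))))
    (B N : Fin 4 → Fin 4 → R) (hBβ : ∀ k l, B k l = β k l - β l k)
    (hN : ∀ k l, N k l = M k l + (b k * b l - b l * b k)) :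
    H 0 1 2 3 - H 1 0 2 3 + H 2 0 1 3 - H 3 0 1 2 =
      (t (B 0 1 * N 2 3) + t (N 0 1 * B 2 3)) - (t (B 0 2 * N 1 3) + t (N 0 2 * B 1 3)) +
      (t (B 0 3 * N 1 2) + t (N 0 3 * B 1 2)) := by
  have h1 : ∀ k i l m, t (b k * (β i l * b m)) = t (β i l * (b m * b k)) := by
    intro k i l m; rw [ht, mul_assoc]
  have h2 : ∀ k l i m, t (b k * (b l * β i m)) = t (β i m * (b k * b l)) := by
    intro k l i m; rw [← mul_assoc, ht]
  have h3 : ∀ k l i m, t (M k l * β i m) = t (β i m * M k l) := fun _ _ _ _ => ht _ _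
  have hB' : ∀ j i k l, t (b j * DM i k l) - t (b j * DM k i l) + t (b j * DM l i k) = 0 := by
    intro j i k l
    rw [← map_sub, ← map_add, ← mul_sub, ← mul_add, hB, mul_zero, map_zero]
  simp only [hH, hBβ, hN, add_mul, mul_add, sub_mul, mul_sub, map_add, map_sub, mul_assoc, h1, h2,
    h3]
  linear_combination hB' 3 0 1 2 * (1) - hB' 2 0 1 3 + hB' 1 0 2 3 - hB' 0 1 2 3

end ChernSimonsAlgebra

section ChernSimons

variable {R : Type*} [NormedRing R] [NormedAlgebra ℝ R]

/-- The component of index `(k, l, m)` of the Chern-Simons form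
`t (a ∧ (Θ + Θ')) - (1/3) t (a ∧ a ∧ a)`, in terms of the components of `a = θ - θ'` and of
`S = Θ + Θ'`. -/
def csComponent (t : R →L[ℝ] ℝ) (a : Fin 4 → R) (S : Fin 4 → Fin 4 → R) (k l m : Fin 4) : ℝ :=
  t (a k * S l m) - t (a l * S k m) + t (a m * S k l) - t (a k * (a l * a m - a m * a l))

/-- The component of `t (Θ ∧ Θ)`, in terms of the components of `Θ`. -/
def sqComponent (t : R →L[ℝ] ℝ) (Θ : Fin 4 → Fin 4 → R) : ℝ :=
  2 * (t (Θ 0 1 * Θ 2 3) - t (Θ 0 2 * Θ 1 3) + t (Θ 0 3 * Θ 1 2))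

theorem contDiffAt_fderiv_single {G : Type*} [NormedAddCommGroup G] [NormedSpace ℝ G]
    {c : ℝ⁴ → G} {y : ℝ⁴} (hc : ContDiffAt ℝ ∞ c y) (v : ℝ⁴) :
    ContDiffAt ℝ ∞ (fun z => fderiv ℝ c z v) y :=
  (hc.fderiv_right (m := ∞) (by simp)).clm_apply contDiffAt_const

theorem contDiffAt_curvOf {θ : Fin 4 → ℝ⁴ → R} {y : ℝ⁴} (hθ : ∀ k, ContDiffAt ℝ ∞ (θ k) y)
    (k l : Fin 4) : ContDiffAt ℝ ∞ (curvOf θ k l) y :=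
  ((contDiffAt_fderiv_single (hθ l) _).sub (contDiffAt_fderiv_single (hθ k) _)).add
    (((hθ k).mul (hθ l)).sub ((hθ l).mul (hθ k)))

theorem fderiv_mul_single {f g : ℝ⁴ → R} {y : ℝ⁴} (hf : ContDiffAt ℝ ∞ f y)
    (hg : ContDiffAt ℝ ∞ g y) (v : ℝ⁴) :
    fderiv ℝ (fun z => f z * g z) y v = fderiv ℝ f y v * g y + f y * fderiv ℝ g y v := by
  rw [fderiv_fun_mul' (hf.differentiableAt (by simp)) (hg.differentiableAt (by simp))]
  simp [add_comm]

/-- The Bianchi identity. -/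
theorem bianchi_curvOf {θ : Fin 4 → ℝ⁴ → R} {y : ℝ⁴} (hθ : ∀ k, ContDiffAt ℝ ∞ (θ k) y)
    (D : Fin 4 → Fin 4 → Fin 4 → R)
    (hD : ∀ i k l, D i k l = fderiv ℝ (curvOf θ k l) y (EuclideanSpace.single i 1) +
      (θ i y * curvOf θ k l y - curvOf θ k l y * θ i y)) (i k l : Fin 4) :
    D i k l - D k i l + D l i k = 0 := by
  have h : ∀ i k l, fderiv ℝ (curvOf θ k l) y (EuclideanSpace.single i 1) =
      fderiv ℝ (fun z => fderiv ℝ (θ l) z (EuclideanSpace.single k 1)) y (EuclideanSpace.single i 1)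
      - fderiv ℝ (fun z => fderiv ℝ (θ k) z (EuclideanSpace.single l 1)) y
        (EuclideanSpace.single i 1) +
      ((fderiv ℝ (θ k) y (EuclideanSpace.single i 1) * θ l y +
        θ k y * fderiv ℝ (θ l) y (EuclideanSpace.single i 1)) -
      (fderiv ℝ (θ l) y (EuclideanSpace.single i 1) * θ k y +
        θ l y * fderiv ℝ (θ k) y (EuclideanSpace.single i 1))) := by
    intro i k l
    have hd : ∀ {G : ℝ⁴ → R}, ContDiffAt ℝ ∞ G y → DifferentiableAt ℝ G y :=
      fun h => h.differentiableAt (by simp)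
    have h1 := contDiffAt_fderiv_single (hθ l) (EuclideanSpace.single k 1)
    have h2 := contDiffAt_fderiv_single (hθ k) (EuclideanSpace.single l 1)
    have h3 := (hθ k).mul (hθ l)
    have h4 := (hθ l).mul (hθ k)
    unfold curvOf
    rw [fderiv_fun_add (hd (h1.sub h2)) (hd (h3.sub h4)), fderiv_fun_sub (hd h1) (hd h2),
      fderiv_fun_sub (hd h3) (hd h4)]
    simp only [add_apply, sub_apply, fderiv_mul_single (hθ _) (hθ _)]
  simp only [hD, h]
  rw [fderiv_fderiv_apply_comm (hθ l) (EuclideanSpace.single i 1) (EuclideanSpace.single k 1),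
    fderiv_fderiv_apply_comm (hθ k) (EuclideanSpace.single i 1) (EuclideanSpace.single l 1),
    fderiv_fderiv_apply_comm (hθ i) (EuclideanSpace.single l 1) (EuclideanSpace.single k 1)]
  simp only [curvOf]
  noncomm_ring

/-- The transgression formula for the connection forms `m + b` and `m - b`. -/
theorem transgression_midpoint (t : R →L[ℝ] ℝ) (ht : ∀ x y, t (x * y) = t (y * x))
    {m b : Fin 4 → ℝ⁴ → R} {y : ℝ⁴} (hm : ∀ k, ContDiffAt ℝ ∞ (m k) y)
    (hb : ∀ k, ContDiffAt ℝ ∞ (b k) y) {θ θ' : Fin 4 → ℝ⁴ → R} (hθ : ∀ k y, θ k y = m k y + b k y)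
    (hθ' : ∀ k y, θ' k y = m k y - b k y) {η : Fin 4 → Fin 4 → Fin 4 → ℝ⁴ → ℝ}
    (hη : ∀ k l m' z, η k l m' z = csComponent t (fun k => θ k z - θ' k z)
      (fun k l => curvOf θ k l z + curvOf θ' k l z) k l m') :
    (∀ k l m', ContDiffAt ℝ ∞ (η k l m') y) ∧
    fderiv ℝ (η 1 2 3) y (EuclideanSpace.single 0 1) -
      fderiv ℝ (η 0 2 3) y (EuclideanSpace.single 1 1) +
      fderiv ℝ (η 0 1 3) y (EuclideanSpace.single 2 1) -
      fderiv ℝ (η 0 1 2) y (EuclideanSpace.single 3 1) =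
    sqComponent t (fun k l => curvOf θ k l y) - sqComponent t (fun k l => curvOf θ' k l y) := by
  have hd : ∀ {G : ℝ⁴ → R} {z : ℝ⁴}, ContDiffAt ℝ ∞ G z → DifferentiableAt ℝ G z :=
    fun h => h.differentiableAt (by simp)
  set β : ℝ⁴ → Fin 4 → Fin 4 → R := fun z i k => fderiv ℝ (b k) z (EuclideanSpace.single i 1) +
    (m i z * b k z - b k z * m i z) with hβ
  set C : ℝ⁴ → Fin 4 → Fin 4 → R := fun z k l => b k z * b l z - b l z * b k z with hC
  have hev : ∀ᶠ z in 𝓝 y, (∀ k, DifferentiableAt ℝ (m k) z) ∧ ∀ k, DifferentiableAt ℝ (b k) z := by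
    have key : ∀ {G : ℝ⁴ → R}, ContDiffAt ℝ ∞ G y → ∀ᶠ z in 𝓝 y, DifferentiableAt ℝ G z := by
      intro G hG
      filter_upwards [(hG.of_le (m := 1) (by simp)).eventually (by simp)] with z hz
      exact hz.differentiableAt (by simp)
    exact (Filter.eventually_all.2 fun k => key (hm k)).and
      (Filter.eventually_all.2 fun k => key (hb k))
  -- The curvature of `m ± b` is `M + b ∧ b ± D b`.
  have hΘ : ∀ z, (∀ k, DifferentiableAt ℝ (m k) z) → (∀ k, DifferentiableAt ℝ (b k) z) →
      ∀ k l, curvOf θ k l z = (curvOf m k l z + C z k l) + (β z k l - β z l k) ∧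
        curvOf θ' k l z = (curvOf m k l z + C z k l) - (β z k l - β z l k) := by
    intro z h1 h2 k l
    have e1 : ∀ k, fderiv ℝ (θ k) z = fderiv ℝ (m k) z + fderiv ℝ (b k) z := fun k => by
      rw [funext (hθ k), fderiv_fun_add (h1 k) (h2 k)]
    have e2 : ∀ k, fderiv ℝ (θ' k) z = fderiv ℝ (m k) z - fderiv ℝ (b k) z := fun k => by
      rw [funext (hθ' k), fderiv_fun_sub (h1 k) (h2 k)]
    constructor
    · simp only [curvOf, e1, hβ, hC, hθ, add_apply]
      noncomm_ring
    · simp only [curvOf, e2, hβ, hC, hθ', sub_apply]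
      noncomm_ring
  -- With `M` the curvature of `m`, the Chern-Simons form is `4 t (b ∧ M + (1/3) b ∧ b ∧ b)`.
  set G : Fin 4 → Fin 4 → Fin 4 → ℝ⁴ → R := fun k l n z =>
    (b k z * curvOf m l n z - b l z * curvOf m k n z + b n z * curvOf m k l z) +
      b k z * (b l z * b n z - b n z * b l z) with hG
  have hηG : ∀ k l n, η k l n =ᶠ[𝓝 y] fun z => 4 * t (G k l n z) := by
    intro k l n
    filter_upwards [hev] with z hz
    have h1 : ∀ k l, curvOf θ k l z + curvOf θ' k l z =
        (2 : ℝ) • (curvOf m k l z + C z k l) := fun k l => by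
      rw [(hΘ z hz.1 hz.2 k l).1, (hΘ z hz.1 hz.2 k l).2]; module
    have h2 : ∀ k, θ k z - θ' k z = (2 : ℝ) • b k z := fun k => by rw [hθ, hθ']; module
    have c1 : ∀ k l n, t (b k z * (b l z * b n z)) = t (b n z * (b k z * b l z)) := by
      intro k l n; rw [← mul_assoc, ht]
    rw [hη]
    simp only [csComponent, h1, h2, hG, hC, smul_mul_assoc, mul_smul_comm, map_smul, smul_eq_mul,
      map_add, map_sub, mul_add, mul_sub]
    have := c1 k l n
    have := c1 k n l
    have := c1 n k l
    have := c1 l k n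
    have := c1 l n k
    have := c1 n l k
    linarith
  have hM := contDiffAt_curvOf hm
  have hGs : ∀ k l n, ContDiffAt ℝ ∞ (G k l n) y := fun k l n =>
    ((((hb k).mul (hM l n)).sub ((hb l).mul (hM k n))).add ((hb n).mul (hM k l))).add
      ((hb k).mul (((hb l).mul (hb n)).sub ((hb n).mul (hb l))))
  have hηs : ∀ k l n, ContDiffAt ℝ ∞ (η k l n) y := fun k l n =>
    (contDiffAt_const.mul (t.contDiff.contDiffAt.comp y (hGs k l n))).congr_of_eventuallyEq
      (hηG k l n)
  refine ⟨hηs, ?_⟩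
  have hηd : ∀ i k l n, fderiv ℝ (η k l n) y (EuclideanSpace.single i 1) =
      4 * t (fderiv ℝ (G k l n) y (EuclideanSpace.single i 1)) := by
    intro i k l n
    have h1 := (t.hasFDerivAt.comp y (hd (hGs k l n)).hasFDerivAt).const_mul (4 : ℝ)
    rw [(hηG k l n).fderiv_eq]
    exact congrArg (fun L : ℝ⁴ →L[ℝ] ℝ => L (EuclideanSpace.single i 1)) h1.fderiv
  have hGd : ∀ i k l n, fderiv ℝ (G k l n) y (EuclideanSpace.single i 1) =
      ((fderiv ℝ (b k) y (EuclideanSpace.single i 1) * curvOf m l n y +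
          b k y * fderiv ℝ (curvOf m l n) y (EuclideanSpace.single i 1)) -
        (fderiv ℝ (b l) y (EuclideanSpace.single i 1) * curvOf m k n y +
          b l y * fderiv ℝ (curvOf m k n) y (EuclideanSpace.single i 1)) +
        (fderiv ℝ (b n) y (EuclideanSpace.single i 1) * curvOf m k l y +
          b n y * fderiv ℝ (curvOf m k l) y (EuclideanSpace.single i 1))) +
      (fderiv ℝ (b k) y (EuclideanSpace.single i 1) * (b l y * b n y - b n y * b l y) +
        b k y * ((fderiv ℝ (b l) y (EuclideanSpace.single i 1) * b n y +
          b l y * fderiv ℝ (b n) y (EuclideanSpace.single i 1)) -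
          (fderiv ℝ (b n) y (EuclideanSpace.single i 1) * b l y +
          b n y * fderiv ℝ (b l) y (EuclideanSpace.single i 1)))) := by
    intro i k l n
    have a1 := (hb k).mul (hM l n)
    have a2 := (hb l).mul (hM k n)
    have a3 := (hb n).mul (hM k l)
    have a4 := (hb l).mul (hb n)
    have a5 := (hb n).mul (hb l)
    have a6 := (hb k).mul (a4.sub a5)
    simp only [hG]
    rw [fderiv_fun_add (hd ((a1.sub a2).add a3)) (hd a6), fderiv_fun_add (hd (a1.sub a2)) (hd a3),
      fderiv_fun_sub (hd a1) (hd a2)]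
    simp only [add_apply, sub_apply]
    rw [fderiv_mul_single (hb k) (a4.sub a5), fderiv_fun_sub (hd a4) (hd a5)]
    simp only [sub_apply, fderiv_mul_single (hb _) (hb _), fderiv_mul_single (hb _) (hM _ _)]
  -- The derivatives under the trace are replaced by covariant derivatives for `m`.
  have hL : ∀ u x z x' z' : R, t (x' * z + x * z') =
      t ((x' + (u * x - x * u)) * z) + t (x * (z' + (u * z - z * u))) := fun u x z x' z' => by
    rw [map_add]; exact trace_leibniz_covariant t.toLinearMap ht u x z x' z'
  set DM : Fin 4 → Fin 4 → Fin 4 → R := fun i k l =>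
    fderiv ℝ (curvOf m k l) y (EuclideanSpace.single i 1) +
      (m i y * curvOf m k l y - curvOf m k l y * m i y) with hDM
  have hH : ∀ i k l n, t (fderiv ℝ (G k l n) y (EuclideanSpace.single i 1)) =
      (t (β y i k * curvOf m l n y) + t (b k y * DM i l n)) -
      (t (β y i l * curvOf m k n y) + t (b l y * DM i k n)) +
      (t (β y i n * curvOf m k l y) + t (b n y * DM i k l)) +
      (t (β y i k * (b l y * b n y - b n y * b l y)) +
        t (b k y * ((β y i l * b n y + b l y * β y i n) -
          (β y i n * b l y + b n y * β y i l)))) := by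
    intro i k l n
    rw [hGd, map_add, map_add, map_sub, hL (m i y), hL (m i y), hL (m i y), hL (m i y)]
    simp only [hβ, hDM]
    congr 3
    noncomm_ring
  have hfin := transgression_algebra t.toLinearMap ht (fun k => b k y) (β y)
    (fun k l => curvOf m k l y) DM (bianchi_curvOf hm DM fun i k l => rfl)
    (fun i k l n => t (fderiv ℝ (G k l n) y (EuclideanSpace.single i 1))) hH
    (fun k l => β y k l - β y l k) (fun k l => curvOf m k l y + C y k l) (fun _ _ => rfl)
    (fun _ _ => rfl)
  have hP := fun k l => (hΘ y (fun k => hd (hm k)) (fun k => hd (hb k)) k l).1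
  have hP' := fun k l => (hΘ y (fun k => hd (hm k)) (fun k => hd (hb k)) k l).2
  simp only [hηd, sqComponent, hP, hP']
  simp only [ContinuousLinearMap.coe_coe] at hfin
  generalize hB : (fun k l => β y k l - β y l k) = B at hfin
  have hB' : ∀ k l, β y k l - β y l k = B k l := fun k l => congrFun (congrFun hB k) l
  generalize hN : (fun k l => curvOf m k l y + C y k l) = N at hfin
  have hN' : ∀ k l, curvOf m k l y + C y k l = N k l := fun k l => congrFun (congrFun hN k) l
  simp only [hB', hN'] at hfin ⊢
  simp only [add_mul, mul_add, sub_mul, mul_sub, map_add, map_sub]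
  linear_combination 4 * hfin

/-- **Transgression.** The difference of the forms `t (Θ ∧ Θ)` of two connection forms is the
exterior derivative of the Chern-Simons form. -/
theorem transgression (t : R →L[ℝ] ℝ) (ht : ∀ x y, t (x * y) = t (y * x))
    {θ θ' : Fin 4 → ℝ⁴ → R} {y : ℝ⁴} (hθ : ∀ k, ContDiffAt ℝ ∞ (θ k) y)
    (hθ' : ∀ k, ContDiffAt ℝ ∞ (θ' k) y) {η : Fin 4 → Fin 4 → Fin 4 → ℝ⁴ → ℝ}
    (hη : ∀ k l m' z, η k l m' z = csComponent t (fun k => θ k z - θ' k z)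
      (fun k l => curvOf θ k l z + curvOf θ' k l z) k l m') :
    (∀ k l m', ContDiffAt ℝ ∞ (η k l m') y) ∧
    fderiv ℝ (η 1 2 3) y (EuclideanSpace.single 0 1) -
      fderiv ℝ (η 0 2 3) y (EuclideanSpace.single 1 1) +
      fderiv ℝ (η 0 1 3) y (EuclideanSpace.single 2 1) -
      fderiv ℝ (η 0 1 2) y (EuclideanSpace.single 3 1) =
    sqComponent t (fun k l => curvOf θ k l y) - sqComponent t (fun k l => curvOf θ' k l y) :=
  transgression_midpoint t ht (m := fun k y => (1 / 2 : ℝ) • (θ k y + θ' k y))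
    (b := fun k y => (1 / 2 : ℝ) • (θ k y - θ' k y))
    (fun k => ((hθ k).add (hθ' k)).const_smul (1 / 2 : ℝ))
    (fun k => ((hθ k).sub (hθ' k)).const_smul (1 / 2 : ℝ))
    (fun k y => by module) (fun k y => by module) hη

end ChernSimons

/-! ### Integration of 4-forms in charts -/

section ChartIntegrals

open MeasureTheory

set_option linter.unusedSectionVars false

variable {X : Type*} [TopologicalSpace X] [ChartedSpace ℝ⁴ X] [IsManifold (𝓡 4) ∞ X]

theorem exists_linearEquiv_coordVec {p x : X} (hx : x ∈ (extChartAt (𝓡 4) p).source) :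
    ∃ L : ℝ⁴ ≃ₗ[ℝ] TangentSpace (𝓡 4) x,
      (∀ k, L (EuclideanSpace.single k 1) = coordVec p x k) ∧
      ∀ v, L (mvfderiv (𝓡 4) (extChartAt (𝓡 4) p) x v) = v := by
  have hy := (extChartAt (𝓡 4) p).map_source hx
  have h1 := mfderivWithin_extChartAt_symm_comp_mfderiv_extChartAt (I := 𝓡 4) hy
  have h2 := mfderiv_extChartAt_comp_mfderivWithin_extChartAt_symm (I := 𝓡 4) hy
  rw [(extChartAt (𝓡 4) p).left_inv hx] at h1 h2
  have h1' : ∀ v : TangentSpace (𝓡 4) x, mfderivWithin 𝓘(ℝ, ℝ⁴) (𝓡 4) (extChartAt (𝓡 4) p).symm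
      (range (𝓡 4)) (extChartAt (𝓡 4) p x) (mfderiv (𝓡 4) 𝓘(ℝ, ℝ⁴) (extChartAt (𝓡 4) p) x v) = v :=
    fun v => DFunLike.congr_fun h1 v
  have h2' : ∀ v : ℝ⁴, mfderiv (𝓡 4) 𝓘(ℝ, ℝ⁴) (extChartAt (𝓡 4) p) x
      (mfderivWithin 𝓘(ℝ, ℝ⁴) (𝓡 4) (extChartAt (𝓡 4) p).symm
      (range (𝓡 4)) (extChartAt (𝓡 4) p x) v) = v :=
    fun v => DFunLike.congr_fun h2 v
  refine ⟨LinearEquiv.ofLinearMap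
    (mfderivWithin 𝓘(ℝ, ℝ⁴) (𝓡 4) (extChartAt (𝓡 4) p).symm (range (𝓡 4))
      (extChartAt (𝓡 4) p x)).toLinearMap
    (mfderiv (𝓡 4) 𝓘(ℝ, ℝ⁴) (extChartAt (𝓡 4) p) x).toLinearMap
    (LinearMap.ext h1') (LinearMap.ext h2'), fun k => rfl, fun v => h1' v⟩

/-- The coordinate vectors form a basis of the tangent space. -/
theorem exists_basis_coordVec {p x : X} (hx : x ∈ (extChartAt (𝓡 4) p).source) :
    ∃ b : Module.Basis (Fin 4) ℝ (TangentSpace (𝓡 4) x), ⇑b = coordVec p x := by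
  obtain ⟨L, hL, -⟩ := exists_linearEquiv_coordVec hx
  exact ⟨(EuclideanSpace.basisFun (Fin 4) ℝ).toBasis.map L, by ext1 k; simpa using! hL k⟩

theorem apply_coordVec_ne_zero {p x : X} (hx : x ∈ (extChartAt (𝓡 4) p).source)
    {η : TangentSpace (𝓡 4) x [⋀^Fin 4]→ₗ[ℝ] ℝ} : η (coordVec p x) ≠ 0 ↔ η ≠ 0 := by
  obtain ⟨b, hb⟩ := exists_basis_coordVec hx
  rw [← hb]
  exact η.map_basis_ne_zero_iff b

/-- The coordinate change between the charts around `p` and `q`. -/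
def chartChange (p q : X) (y : ℝ⁴) : ℝ⁴ :=
  extChartAt (𝓡 4) q ((extChartAt (𝓡 4) p).symm y)

/-- The components of a 4-form in two charts differ by the Jacobian of the coordinate change. -/
theorem hasFDerivAt_chartChange {p q x : X} (hp : x ∈ (extChartAt (𝓡 4) p).source)
    (hq : x ∈ (extChartAt (𝓡 4) q).source) :
    ∃ T : ℝ⁴ →L[ℝ] ℝ⁴, HasFDerivAt (chartChange p q) T (extChartAt (𝓡 4) p x) ∧
      ∀ η : TangentSpace (𝓡 4) x [⋀^Fin 4]→ₗ[ℝ] ℝ,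
        η (coordVec p x) = T.det * η (coordVec q x) := by
  obtain ⟨L, hL, hL'⟩ := exists_linearEquiv_coordVec hq
  have hm : MDifferentiableAt (𝓡 4) 𝓘(ℝ, ℝ⁴) (extChartAt (𝓡 4) q) x :=
    mdifferentiableAt_extChartAt (by simpa using hq)
  obtain ⟨hd, hd'⟩ := MDifferentiableAt.hasFDerivAt_comp_extChartAt_symm hp hm
  refine ⟨_, hd.hasFDerivAt, fun η => ?_⟩
  set T := fderiv ℝ (fun y => extChartAt (𝓡 4) q ((extChartAt (𝓡 4) p).symm y))
    (extChartAt (𝓡 4) p x)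
  set B := (EuclideanSpace.basisFun (Fin 4) ℝ).toBasis
  have hB : ∀ k, B k = EuclideanSpace.single k 1 := fun k => by simp [B]
  set ζ : ℝ⁴ [⋀^Fin 4]→ₗ[ℝ] ℝ := η.compLinearMap L.toLinearMap
  have h1 : η (coordVec p x) = ζ (T.toLinearMap ∘ B) := by
    simp only [ζ, AlternatingMap.compLinearMap_apply]
    congr 1
    ext1 k
    simp only [Function.comp_apply, hB, ContinuousLinearMap.coe_coe, T, hd', LinearEquiv.coe_coe]
    exact (hL' _).symm
  have h2 : η (coordVec q x) = ζ B := by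
    simp only [ζ, AlternatingMap.compLinearMap_apply]
    congr 1
    ext1 k
    rw [hB]
    exact (hL k).symm
  rw [h1, h2, ζ.eq_smul_basis_det B, AlternatingMap.smul_apply, AlternatingMap.smul_apply,
    Module.Basis.det_comp, ContinuousLinearMap.det]
  simp only [smul_eq_mul, Module.Basis.det_self]
  ring

/-- The component of the 4-form `α` in the chart around `p`. -/
def chartComponent (p : X) (α : FourForm X) (y : ℝ⁴) : ℝ :=
  α ((extChartAt (𝓡 4) p).symm y) (coordVec p ((extChartAt (𝓡 4) p).symm y))

/-- The sign of the chart around `p` with respect to the orientation `o`. -/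
def chartSign (o : TangentOrientation X) (p : X) (y : ℝ⁴) : ℝ :=
  orientationSign (o ((extChartAt (𝓡 4) p).symm y)) (coordVec p ((extChartAt (𝓡 4) p).symm y))

theorem chartComponent_extChartAt {p x : X} (hx : x ∈ (extChartAt (𝓡 4) p).source)
    (α : FourForm X) : chartComponent p α (extChartAt (𝓡 4) p x) = α x (coordVec p x) := by
  rw [chartComponent, (extChartAt (𝓡 4) p).left_inv hx]

theorem chartSign_extChartAt {p x : X} (hx : x ∈ (extChartAt (𝓡 4) p).source)
    (o : TangentOrientation X) :
    chartSign o p (extChartAt (𝓡 4) p x) = orientationSign (o x) (coordVec p x) := by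
  rw [chartSign, (extChartAt (𝓡 4) p).left_inv hx]

/-- The integral of the 4-form `α` over the domain of the chart around `p`. -/
def chartIntegral (o : TangentOrientation X) (p : X) (α : FourForm X) : ℝ :=
  ∫ y in (extChartAt (𝓡 4) p).target, chartSign o p y * chartComponent p α y

theorem orientationSign_mul_of_eq_mul {T : Type*} [AddCommGroup T] [Module ℝ T]
    (o : Orientation ℝ T (Fin 4)) {v w : Fin 4 → T} {c : ℝ}
    (h : ∀ η : T [⋀^Fin 4]→ₗ[ℝ] ℝ, η v = c * η w) (η : T [⋀^Fin 4]→ₗ[ℝ] ℝ) :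
    orientationSign o v * η v = |c| * (orientationSign o w * η w) := by
  simp only [orientationSign, h, sign_mul]
  rw [← self_mul_sign c]
  push_cast
  ring

/-- The integral over a chart domain does not depend on the chart. -/
theorem chartIntegral_eq_chartIntegral (o : TangentOrientation X) (p q : X) {α : FourForm X}
    (hα : ∀ x, α x ≠ 0 → x ∈ (extChartAt (𝓡 4) p).source ∩ (extChartAt (𝓡 4) q).source) :
    chartIntegral o p α = chartIntegral o q α := by
  have hsub : ∀ p q : X, (∀ x, α x ≠ 0 → x ∈ (extChartAt (𝓡 4) p).source ∩
      (extChartAt (𝓡 4) q).source) → chartIntegral o p α =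
      ∫ y in (extChartAt (𝓡 4) p) '' ((extChartAt (𝓡 4) p).source ∩ (extChartAt (𝓡 4) q).source),
        chartSign o p y * chartComponent p α y := by
    intro p q hα
    refine setIntegral_eq_of_subset_of_forall_sdiff_eq_zero
      (isOpen_extChartAt_target p).measurableSet ?_ ?_
    · rintro _ ⟨x, hx, rfl⟩
      exact (extChartAt (𝓡 4) p).map_source hx.1
    · intro y hy
      by_contra hne
      have h0 : α ((extChartAt (𝓡 4) p).symm y) ≠ 0 := by
        intro h0
        exact hne (by rw [chartComponent, h0, AlternatingMap.zero_apply, mul_zero])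
      exact hy.2 ⟨_, hα _ h0, (extChartAt (𝓡 4) p).right_inv hy.1⟩
  rw [hsub p q hα, hsub q p (fun x hx => (hα x hx).symm)]
  set S := (extChartAt (𝓡 4) p).source ∩ (extChartAt (𝓡 4) q).source with hS
  have himg : (extChartAt (𝓡 4) q) '' ((extChartAt (𝓡 4) q).source ∩ (extChartAt (𝓡 4) p).source) =
      chartChange p q '' ((extChartAt (𝓡 4) p) '' S) := by
    rw [image_image, inter_comm]
    refine image_congr fun x hx => ?_
    rw [chartChange, (extChartAt (𝓡 4) p).left_inv hx.1]
  have hopen : IsOpen ((extChartAt (𝓡 4) p) '' S) := by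
    have : (extChartAt (𝓡 4) p) '' S = (extChartAt (𝓡 4) p).target ∩
        (extChartAt (𝓡 4) p).symm ⁻¹' (extChartAt (𝓡 4) q).source := by
      rw [hS, (extChartAt (𝓡 4) p).image_source_inter_eq']
    rw [this]
    exact (continuousOn_extChartAt_symm p).isOpen_inter_preimage (isOpen_extChartAt_target p)
      (isOpen_extChartAt_source q)
  have hder : ∀ y ∈ (extChartAt (𝓡 4) p) '' S, ∃ T : ℝ⁴ →L[ℝ] ℝ⁴,
      HasFDerivWithinAt (chartChange p q) T ((extChartAt (𝓡 4) p) '' S) y ∧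
      chartSign o p y * chartComponent p α y = |T.det| *
        (chartSign o q (chartChange p q y) * chartComponent q α (chartChange p q y)) := by
    rintro _ ⟨x, hx, rfl⟩
    obtain ⟨T, hT, hT'⟩ := hasFDerivAt_chartChange hx.1 hx.2
    refine ⟨T, hT.hasFDerivWithinAt, ?_⟩
    rw [chartChange, (extChartAt (𝓡 4) p).left_inv hx.1, chartComponent_extChartAt hx.1,
      chartComponent_extChartAt hx.2, chartSign_extChartAt hx.1, chartSign_extChartAt hx.2]
    exact orientationSign_mul_of_eq_mul _ hT' _
  choose! T hT hT' using hder
  rw [himg, integral_image_eq_integral_abs_det_fderiv_smul volume hopen.measurableSet hT]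
  · exact setIntegral_congr_fun hopen.measurableSet fun y hy => by rw [hT' y hy, smul_eq_mul]
  · rintro _ ⟨x, hx, rfl⟩ _ ⟨x', hx', rfl⟩ h
    simp only [chartChange, (extChartAt (𝓡 4) p).left_inv hx.1,
      (extChartAt (𝓡 4) p).left_inv hx'.1] at h
    rw [(extChartAt (𝓡 4) q).injOn hx.2 hx'.2 h]

end ChartIntegrals

/-! ### Stokes' theorem -/

section Stokes

open MeasureTheory

set_option linter.unusedSectionVars false

theorem integrableOn_of_eq_zero_off_compact {U K : Set ℝ⁴} (hU : IsOpen U) (hK : IsCompact K)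
    (hKU : K ⊆ U) {g : ℝ⁴ → ℝ} (hg : ContinuousOn g U) (h0 : ∀ y ∈ U \ K, g y = 0) :
    IntegrableOn g U :=
  ((hg.mono hKU).integrableOn_compact hK).of_forall_sdiff_eq_zero hU.measurableSet h0

/-- A derivative of a function with compact support in the open set `U` has integral zero. -/
theorem setIntegral_fderiv_eq_zero {U K : Set ℝ⁴} (hU : IsOpen U) (hK : IsCompact K)
    (hKU : K ⊆ U) {g : ℝ⁴ → ℝ} (hg : ∀ y ∈ U, ContDiffAt ℝ 1 g y) (h0 : ∀ y ∈ U \ K, g y = 0)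
    (v : ℝ⁴) : ∫ y in U, fderiv ℝ g y v = 0 := by
  have hU1 : ∀ y ∈ U, U.indicator g =ᶠ[𝓝 y] g := fun y hy => by
    filter_upwards [hU.mem_nhds hy] with z hz
    exact indicator_of_mem hz g
  have hK0 : ∀ y ∉ K, U.indicator g =ᶠ[𝓝 y] fun _ => 0 := fun y hy => by
    filter_upwards [hK.isClosed.isOpen_compl.mem_nhds hy] with z hz
    by_cases hzU : z ∈ U
    · rw [indicator_of_mem hzU, h0 z ⟨hzU, hz⟩]
    · exact indicator_of_notMem hzU g
  have hc : ContDiff ℝ 1 (U.indicator g) := by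
    rw [contDiff_iff_contDiffAt]
    intro y
    by_cases hy : y ∈ U
    · exact (hg y hy).congr_of_eventuallyEq (hU1 y hy)
    · exact contDiffAt_const.congr_of_eventuallyEq (hK0 y fun h => hy (hKU h))
  have hs : HasCompactSupport (U.indicator g) :=
    HasCompactSupport.intro hK fun y hy => (hK0 y hy).self_of_nhds
  have hs' : HasCompactSupport fun y => fderiv ℝ (U.indicator g) y v := hs.fderiv_apply ℝ v
  have hcd : Continuous fun y => fderiv ℝ (U.indicator g) y v :=
    (hc.continuous_fderiv (by simp)).clm_apply continuous_const
  have h1 : ∫ y, fderiv ℝ (U.indicator g) y v = 0 := by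
    have := integral_mul_fderiv_eq_neg_fderiv_mul_of_integrable (μ := volume)
      (f := fun _ : ℝ⁴ => (1 : ℝ)) (g := U.indicator g) (v := v) (by simp)
      (by simpa using hcd.integrable_of_hasCompactSupport hs')
      (by simpa using hc.continuous.integrable_of_hasCompactSupport hs)
      (fun _ _ => differentiableAt_const _) (fun _ _ => hc.differentiable (by simp) _)
    simpa using this
  rw [← h1, setIntegral_congr_fun hU.measurableSet
    (g := fun y => fderiv ℝ (U.indicator g) y v) (fun y hy => by
      simp only; rw [(hU1 y hy).fderiv_eq])]
  refine setIntegral_eq_integral_of_forall_compl_eq_zero fun y hy => ?_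
  rw [(hK0 y fun h => hy (hKU h)).fderiv_eq]
  simp

variable {X : Type*} [TopologicalSpace X] [ChartedSpace ℝ⁴ X]

/-- The component of the 3-form `η` in the chart around `p` at the coordinate vectors other than
`∂_i`. -/
def chartComponent₃ (p : X) (η : ∀ x : X, TangentSpace (𝓡 4) x [⋀^Fin 3]→ₗ[ℝ] ℝ) (i : Fin 4)
    (y : ℝ⁴) : ℝ :=
  η ((extChartAt (𝓡 4) p).symm y) (i.removeNth (coordVec p ((extChartAt (𝓡 4) p).symm y)))

/-- The 4-form `df ∧ η`, for a function `f` and a 3-form `η`. -/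
def dWedge (f : X → ℝ) (η : ∀ x : X, TangentSpace (𝓡 4) x [⋀^Fin 3]→ₗ[ℝ] ℝ) : FourForm X :=
  fun x => AlternatingMap.alternatizeUncurryFin
    ((mvfderiv (𝓡 4) f x).toLinearMap.smulRight (η x))

/-- An orientation of the tangent spaces is continuous if the charts have locally constant sign. -/
def IsContinuousOrientation (o : TangentOrientation X) : Prop :=
  ∀ p : X, ∀ y ∈ (extChartAt (𝓡 4) p).target, ∀ᶠ z in 𝓝 y, chartSign o p z = chartSign o p y

theorem IsContinuousOrientation.continuousOn {o : TangentOrientation X}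
    (ho : IsContinuousOrientation o) (p : X) :
    ContinuousOn (chartSign o p) (extChartAt (𝓡 4) p).target := fun y hy =>
  (continuousAt_const.congr ((ho p y hy).mono fun _ h => h.symm)).continuousWithinAt

variable [IsManifold (𝓡 4) ∞ X]

theorem contDiffAt_comp_extChartAt_symm_of_target {p : X} {y : ℝ⁴}
    (hy : y ∈ (extChartAt (𝓡 4) p).target) {f : X → ℝ} (hf : ContMDiff (𝓡 4) 𝓘(ℝ, ℝ) ∞ f) :
    ContDiffAt ℝ ∞ (fun z => f ((extChartAt (𝓡 4) p).symm z)) y := by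
  have := ContMDiffAt.contDiffAt_comp_extChartAt_symm (p := p) le_rfl
    ((extChartAt (𝓡 4) p).map_target hy) (hf _)
  rwa [(extChartAt (𝓡 4) p).right_inv hy] at this

theorem chartComponent_dWedge {f : X → ℝ} (hf : ContMDiff (𝓡 4) 𝓘(ℝ, ℝ) ∞ f)
    (η : ∀ x : X, TangentSpace (𝓡 4) x [⋀^Fin 3]→ₗ[ℝ] ℝ) {p : X} {y : ℝ⁴}
    (hy : y ∈ (extChartAt (𝓡 4) p).target) :
    chartComponent p (dWedge f η) y = ∑ i : Fin 4, (-1) ^ (i : ℕ) *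
      (fderiv ℝ (fun z => f ((extChartAt (𝓡 4) p).symm z)) y (EuclideanSpace.single i 1) *
        chartComponent₃ p η i y) := by
  have hd := (MDifferentiableAt.hasFDerivAt_comp_extChartAt_symm
    ((extChartAt (𝓡 4) p).map_target hy) ((hf _).mdifferentiableAt (by simp))).2
  rw [(extChartAt (𝓡 4) p).right_inv hy] at hd
  simp only [chartComponent, dWedge, AlternatingMap.alternatizeUncurryFin_apply, hd]
  refine Finset.sum_congr rfl fun i _ => ?_
  simp only [zsmul_eq_mul, Int.cast_pow, Int.cast_neg, Int.cast_one]
  rfl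

variable [T2Space X] [CompactSpace X]

theorem tsupport_chartPartition_subset (p : X) :
    tsupport (chartPartition X p) ⊆ (extChartAt (𝓡 4) p).source := by
  rw [extChartAt_source]
  exact (SmoothPartitionOfUnity.exists_isSubordinate_chartAt_source (𝓡 4) X).choose_spec p

variable (X) in
/-- The finitely many indices for which the function of the partition of unity does not vanish. -/
def chartIndices : Finset X :=
  (chartPartition X).locallyFinite.finite_nonempty_of_compact.toFinset

theorem chartPartition_eq_zero {p : X} (hp : p ∉ chartIndices X) (x : X) :
    chartPartition X p x = 0 := by
  by_contra h
  exact hp ((Set.Finite.mem_toFinset _).2 ⟨x, h⟩)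

theorem sum_chartPartition (x : X) : ∑ p ∈ chartIndices X, chartPartition X p x = 1 := by
  rw [← (chartPartition X).sum_eq_one (mem_univ x), finsum_eq_sum_of_support_subset]
  intro p hp
  by_contra h
  exact hp (chartPartition_eq_zero h x)

theorem integralFourForm_eq_sum (o : TangentOrientation X) (α : FourForm X) :
    integralFourForm o α =
      ∑ p ∈ chartIndices X, chartIntegral o p fun x => chartPartition X p x • α x := by
  have h : ∀ p : X, (∫ y in (extChartAt (𝓡 4) p).target,
      let x := (extChartAt (𝓡 4) p).symm y
      chartPartition X p x * (orientationSign (o x) (coordVec p x) * α x (coordVec p x))) =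
      chartIntegral o p fun x => chartPartition X p x • α x := by
    intro p
    refine integral_congr_ae (Filter.Eventually.of_forall fun y => ?_)
    simp only [chartSign, chartComponent, AlternatingMap.smul_apply, smul_eq_mul]
    ring
  rw [integralFourForm]
  simp only [h]
  refine finsum_eq_sum_of_support_subset _ fun p hp => ?_
  by_contra hp'
  refine hp ?_
  refine setIntegral_eq_zero_of_forall_eq_zero fun y _ => ?_
  change chartSign o p y *
    (chartPartition X p ((extChartAt (𝓡 4) p).symm y) * chartComponent p α y) = 0
  rw [chartPartition_eq_zero hp', zero_mul, mul_zero]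

theorem isCompact_chart_tsupport (p : X) :
    IsCompact (extChartAt (𝓡 4) p '' tsupport (chartPartition X p)) :=
  (isClosed_tsupport _).isCompact.image_of_continuousOn
    ((continuousOn_extChartAt p).mono (tsupport_chartPartition_subset p))

theorem chart_tsupport_subset (p : X) :
    extChartAt (𝓡 4) p '' tsupport (chartPartition X p) ⊆ (extChartAt (𝓡 4) p).target := by
  rintro _ ⟨x, hx, rfl⟩
  exact (extChartAt (𝓡 4) p).map_source (tsupport_chartPartition_subset p hx)

theorem symm_notMem_tsupport {p : X} {y : ℝ⁴} (hy : y ∈ (extChartAt (𝓡 4) p).target \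
    (extChartAt (𝓡 4) p '' tsupport (chartPartition X p))) :
    (extChartAt (𝓡 4) p).symm y ∉ tsupport (chartPartition X p) := fun h =>
  hy.2 ⟨_, h, (extChartAt (𝓡 4) p).right_inv hy.1⟩

theorem dWedge_chartPartition_eq_zero {p x : X} (hx : x ∉ tsupport (chartPartition X p))
    (η : ∀ x : X, TangentSpace (𝓡 4) x [⋀^Fin 3]→ₗ[ℝ] ℝ) :
    dWedge (chartPartition X p) η x = 0 := by
  have h0 : mvfderiv (𝓡 4) (chartPartition X p) x = 0 := by
    have : (chartPartition X p : X → ℝ) =ᶠ[𝓝 x] fun _ => 0 :=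
      notMem_tsupport_iff_eventuallyEq.1 hx
    rw [mvfderiv, this.mfderiv_eq, mfderiv_const]
    rfl
  rw [dWedge, h0]
  ext v
  simp [AlternatingMap.alternatizeUncurryFin_apply]

/-- **Stokes' theorem** on a compact 4-manifold: the integral of `α = dη` vanishes. By the Leibniz
rule the integral is minus the sum over `p` of the integrals of `dρ_p ∧ η`, where the `ρ_p` form the
partition of unity. Cutting these off with the `ρ_q` and changing charts, it becomes the
sum over `q` of the integrals of `ρ_q ∑_p dρ_p ∧ η = 0`. -/
theorem integralFourForm_eq_zero_of_exact {o : TangentOrientation X}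
    (ho : IsContinuousOrientation o) {α : FourForm X}
    {η : ∀ x : X, TangentSpace (𝓡 4) x [⋀^Fin 3]→ₗ[ℝ] ℝ}
    (hη : ∀ p i, ∀ y ∈ (extChartAt (𝓡 4) p).target, ContDiffAt ℝ 1 (chartComponent₃ p η i) y)
    (hα : ∀ p, ∀ y ∈ (extChartAt (𝓡 4) p).target, chartComponent p α y = ∑ i : Fin 4,
      (-1) ^ (i : ℕ) * fderiv ℝ (chartComponent₃ p η i) y (EuclideanSpace.single i 1)) :
    integralFourForm o α = 0 := by
  set ρ : X → X → ℝ := fun p => chartPartition X p with hρ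
  have hρs : ∀ p, ContMDiff (𝓡 4) 𝓘(ℝ, ℝ) ∞ (ρ p) := fun p => (chartPartition X p).contMDiff
  have hopen : ∀ p : X, IsOpen (extChartAt (𝓡 4) p).target := fun p => isOpen_extChartAt_target p
  -- continuity and integrability of the forms which occur
  have hρc : ∀ p q : X, ContinuousOn (fun y => ρ p ((extChartAt (𝓡 4) q).symm y))
      (extChartAt (𝓡 4) q).target := fun p q y hy =>
    (contDiffAt_comp_extChartAt_symm_of_target hy (hρs p)).continuousAt.continuousWithinAt
  have hγc : ∀ p q : X, ContinuousOn (chartComponent q (dWedge (ρ p) η))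
      (extChartAt (𝓡 4) q).target := by
    intro p q
    refine ContinuousOn.congr ?_ fun y hy => chartComponent_dWedge (hρs p) η hy
    refine continuousOn_finsetSum _ fun i _ => continuousOn_const.mul ?_
    refine ContinuousOn.mul (fun y hy => ?_)
      fun y hy => (hη q i y hy).continuousAt.continuousWithinAt
    exact (contDiffAt_fderiv_single (contDiffAt_comp_extChartAt_symm_of_target hy (hρs p))
      _).continuousAt.continuousWithinAt
  have hint : ∀ (p : X) {g : ℝ⁴ → ℝ}, ContinuousOn g (extChartAt (𝓡 4) p).target →
      (∀ y ∈ (extChartAt (𝓡 4) p).target,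
        (extChartAt (𝓡 4) p).symm y ∉ tsupport (chartPartition X p) → g y = 0) →
      IntegrableOn g (extChartAt (𝓡 4) p).target := fun p g hg h0 =>
    integrableOn_of_eq_zero_off_compact (hopen p) (isCompact_chart_tsupport p)
      (chart_tsupport_subset p) hg fun y hy => h0 y hy.1 (symm_notMem_tsupport hy)
  have hcc : ∀ (c : X → ℝ) (β : FourForm X) (p : X) (y : ℝ⁴),
      chartComponent p (fun x => c x • β x) y =
        c ((extChartAt (𝓡 4) p).symm y) * chartComponent p β y := fun c β p y => rfl
  have hzero : ∀ (p : X) (y : ℝ⁴),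
      (extChartAt (𝓡 4) p).symm y ∉ tsupport (chartPartition X p) →
      chartComponent p (dWedge (ρ p) η) y = 0 := fun p y hy => by
    rw [chartComponent, dWedge_chartPartition_eq_zero hy, AlternatingMap.zero_apply]
  -- the Leibniz rule
  have h1 : ∀ p : X, chartIntegral o p (fun x => ρ p x • α x) =
      - chartIntegral o p (dWedge (ρ p) η) := by
    intro p
    set g : Fin 4 → ℝ⁴ → ℝ := fun i y => chartSign o p y *
      (ρ p ((extChartAt (𝓡 4) p).symm y) * chartComponent₃ p η i y) with hg
    have hgc : ∀ i, ∀ y ∈ (extChartAt (𝓡 4) p).target,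
        g i =ᶠ[𝓝 y] fun z => chartSign o p y *
          (ρ p ((extChartAt (𝓡 4) p).symm z) * chartComponent₃ p η i z) := fun i y hy =>
      (ho p y hy).mono fun z hz => by simp only [hg, hz]
    have hprod : ∀ i, ∀ y ∈ (extChartAt (𝓡 4) p).target, ContDiffAt ℝ 1
        (fun z => ρ p ((extChartAt (𝓡 4) p).symm z) * chartComponent₃ p η i z) y := fun i y hy =>
      ((contDiffAt_comp_extChartAt_symm_of_target hy (hρs p)).of_le (by simp)).mul (hη p i y hy)
    have hgs : ∀ i, ∀ y ∈ (extChartAt (𝓡 4) p).target, ContDiffAt ℝ 1 (g i) y := fun i y hy =>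
      (contDiffAt_const.mul (hprod i y hy)).congr_of_eventuallyEq (hgc i y hy)
    have hg0 : ∀ i, ∀ y ∈ (extChartAt (𝓡 4) p).target \
        (extChartAt (𝓡 4) p '' tsupport (chartPartition X p)), g i y = 0 := fun i y hy => by
      have : ρ p ((extChartAt (𝓡 4) p).symm y) = 0 :=
        image_eq_zero_of_notMem_tsupport (symm_notMem_tsupport hy)
      simp only [hg, this, zero_mul, mul_zero]
    have hgi : ∀ i, ∫ y in (extChartAt (𝓡 4) p).target,
        fderiv ℝ (g i) y (EuclideanSpace.single i 1) = 0 := fun i =>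
      setIntegral_fderiv_eq_zero (hopen p) (isCompact_chart_tsupport p) (chart_tsupport_subset p)
        (hgs i) (hg0 i) _
    have hdg : ∀ i, ∀ y ∈ (extChartAt (𝓡 4) p).target,
        fderiv ℝ (g i) y (EuclideanSpace.single i 1) = chartSign o p y *
        (fderiv ℝ (fun z => ρ p ((extChartAt (𝓡 4) p).symm z)) y (EuclideanSpace.single i 1) *
          chartComponent₃ p η i y + ρ p ((extChartAt (𝓡 4) p).symm y) *
          fderiv ℝ (chartComponent₃ p η i) y (EuclideanSpace.single i 1)) := by
      intro i y hy
      have e1 := (contDiffAt_comp_extChartAt_symm_of_target hy (hρs p)).differentiableAt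
        (n := ∞) (by simp)
      have e2 := (hη p i y hy).differentiableAt (by simp)
      rw [(hgc i y hy).fderiv_eq, fderiv_const_mul ((hprod i y hy).differentiableAt (by simp)),
        fderiv_fun_mul e1 e2]
      simp only [smul_apply, add_apply, smul_eq_mul]
      ring
    have hgint : ∀ i, IntegrableOn (fun y => fderiv ℝ (g i) y (EuclideanSpace.single i 1))
        (extChartAt (𝓡 4) p).target := by
      intro i
      refine hint p (fun y hy => ?_) fun y hy hy' => ?_
      · exact (((hgs i y hy).fderiv_right (m := 0) (by simp)).continuousAt.clm_apply
          continuousAt_const).continuousWithinAt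
      · have : g i =ᶠ[𝓝 y] fun _ => 0 := by
          have hopen' : (extChartAt (𝓡 4) p).target \
              (extChartAt (𝓡 4) p '' tsupport (chartPartition X p)) ∈ 𝓝 y := by
            refine ((hopen p).sdiff (isCompact_chart_tsupport p).isClosed).mem_nhds ⟨hy, ?_⟩
            rintro ⟨x, hx, rfl⟩
            rw [(extChartAt (𝓡 4) p).left_inv (tsupport_chartPartition_subset p hx)] at hy'
            exact hy' hx
          filter_upwards [hopen'] with z hz using hg0 i z hz
        rw [this.fderiv_eq]; simp
    have hkey : ∀ y ∈ (extChartAt (𝓡 4) p).target,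
        chartSign o p y * chartComponent p (fun x => ρ p x • α x) y =
        (∑ i : Fin 4, (-1) ^ (i : ℕ) * fderiv ℝ (g i) y (EuclideanSpace.single i 1)) -
        chartSign o p y * chartComponent p (dWedge (ρ p) η) y := by
      intro y hy
      rw [hcc, hα p y hy, chartComponent_dWedge (hρs p) η hy]
      simp only [hdg _ y hy, Fin.sum_univ_four]
      ring
    have hγint : IntegrableOn (fun y => chartSign o p y * chartComponent p (dWedge (ρ p) η) y)
        (extChartAt (𝓡 4) p).target :=
      hint p ((ho.continuousOn p).mul (hγc p p)) fun y _ hy => by rw [hzero p y hy, mul_zero]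
    rw [chartIntegral, setIntegral_congr_fun (hopen p).measurableSet hkey,
      integral_sub (integrable_finsetSum _ fun i _ => (hgint i).const_mul _) hγint,
      integral_finsetSum _ fun i _ => (hgint i).const_mul _]
    simp only [integral_const_mul, hgi, mul_zero, Finset.sum_const_zero, zero_sub, chartIntegral]
  -- cutting off with the partition of unity
  have h2 : ∀ p : X, chartIntegral o p (dWedge (ρ p) η) =
      ∑ q ∈ chartIndices X, chartIntegral o p (fun x => ρ q x • dWedge (ρ p) η x) := by
    intro p
    simp only [chartIntegral, hcc]
    rw [← integral_finsetSum]
    · refine setIntegral_congr_fun (hopen p).measurableSet fun y _ => ?_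
      rw [← Finset.mul_sum, ← Finset.sum_mul, sum_chartPartition, one_mul]
    · intro q _
      refine hint p ((ho.continuousOn p).mul ((hρc q p).mul (hγc p p))) fun y _ hy => ?_
      rw [hzero p y hy, mul_zero, mul_zero]
  have h3 : ∀ p q : X, chartIntegral o p (fun x => ρ q x • dWedge (ρ p) η x) =
      chartIntegral o q (fun x => ρ q x • dWedge (ρ p) η x) := by
    intro p q
    refine chartIntegral_eq_chartIntegral o p q fun x hx => ⟨?_, ?_⟩
    · refine tsupport_chartPartition_subset p ?_
      by_contra h
      exact hx (by rw [dWedge_chartPartition_eq_zero h, smul_zero])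
    · refine tsupport_chartPartition_subset q ?_
      by_contra h
      exact hx (by
        rw [show ρ q x = 0 from image_eq_zero_of_notMem_tsupport h, zero_smul])
  have h4 : ∀ q : X, ∑ p ∈ chartIndices X,
      chartIntegral o q (fun x => ρ q x • dWedge (ρ p) η x) = 0 := by
    intro q
    simp only [chartIntegral, hcc]
    rw [← integral_finsetSum]
    · refine setIntegral_eq_zero_of_forall_eq_zero fun y hy => ?_
      rw [← Finset.mul_sum, ← Finset.mul_sum]
      have hsum : ∑ p ∈ chartIndices X, chartComponent q (dWedge (ρ p) η) y = 0 := by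
        simp only [chartComponent_dWedge (hρs _) η hy]
        rw [Finset.sum_comm]
        refine Finset.sum_eq_zero fun i _ => ?_
        rw [← Finset.mul_sum, ← Finset.sum_mul]
        have : ∑ p ∈ chartIndices X, fderiv ℝ (fun z => ρ p ((extChartAt (𝓡 4) q).symm z)) y
            (EuclideanSpace.single i 1) = 0 := by
          rw [← sum_apply, ← fderiv_fun_sum fun p _ =>
            (contDiffAt_comp_extChartAt_symm_of_target hy (hρs p)).differentiableAt
              (n := ∞) (by simp)]
          simp only [hρ, sum_chartPartition]
          simp
        rw [this, zero_mul, mul_zero]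
      rw [hsum, mul_zero, mul_zero]
    · intro p _
      refine hint q ((ho.continuousOn q).mul ((hρc q q).mul (hγc p q))) fun y _ hy => ?_
      rw [show ρ q _ = 0 from image_eq_zero_of_notMem_tsupport hy, zero_mul, mul_zero]
  rw [integralFourForm_eq_sum]
  calc ∑ p ∈ chartIndices X, chartIntegral o p (fun x => ρ p x • α x)
      = -∑ p ∈ chartIndices X, ∑ q ∈ chartIndices X,
          chartIntegral o q (fun x => ρ q x • dWedge (ρ p) η x) := by
        rw [← Finset.sum_neg_distrib]
        refine Finset.sum_congr rfl fun p _ => ?_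
        rw [h1, h2]
        exact congrArg Neg.neg (Finset.sum_congr rfl fun q _ => h3 p q)
    _ = 0 := by
        rw [Finset.sum_comm, Finset.sum_congr rfl fun q _ => h4 q, Finset.sum_const_zero, neg_zero]

end Stokes

/-! ### Independence of the Chern-Weil integral of the connection -/

section IntegralLinear

open MeasureTheory

variable {X : Type*} [TopologicalSpace X] [ChartedSpace ℝ⁴ X]

/-- A 4-form is continuous if its components in all charts are. -/
def IsContinuousForm (α : FourForm X) : Prop :=
  ∀ p : X, ContinuousOn (chartComponent p α) (extChartAt (𝓡 4) p).target

theorem IsContinuousForm.smul {α : FourForm X} (hα : IsContinuousForm α) (c : ℝ) :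
    IsContinuousForm fun x => c • α x := fun p => continuousOn_const.mul (hα p)

variable [IsManifold (𝓡 4) ∞ X] [T2Space X] [CompactSpace X]

theorem IsContinuousForm.continuousOn_integrand {o : TangentOrientation X}
    (ho : IsContinuousOrientation o) {α : FourForm X} (hα : IsContinuousForm α) (p : X) :
    ContinuousOn (fun y => chartSign o p y *
      chartComponent p (fun x => chartPartition X p x • α x) y) (extChartAt (𝓡 4) p).target := by
  refine (ho.continuousOn p).mul (ContinuousOn.mul (fun y hy => ?_) (hα p))
  exact (contDiffAt_comp_extChartAt_symm_of_target hy
    (chartPartition X p).contMDiff).continuousAt.continuousWithinAt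

theorem IsContinuousForm.integrableOn {o : TangentOrientation X} (ho : IsContinuousOrientation o)
    {α : FourForm X} (hα : IsContinuousForm α) (p : X) :
    IntegrableOn (fun y => chartSign o p y *
      chartComponent p (fun x => chartPartition X p x • α x) y) (extChartAt (𝓡 4) p).target := by
  refine integrableOn_of_eq_zero_off_compact (isOpen_extChartAt_target p)
    (isCompact_chart_tsupport p) (chart_tsupport_subset p) (hα.continuousOn_integrand ho p)
    fun y hy => ?_
  change chartSign o p y *
    (chartPartition X p ((extChartAt (𝓡 4) p).symm y) * chartComponent p α y) = 0
  rw [image_eq_zero_of_notMem_tsupport (symm_notMem_tsupport hy), zero_mul, mul_zero]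

theorem integralFourForm_sub {o : TangentOrientation X} (ho : IsContinuousOrientation o)
    {α β : FourForm X} (hα : IsContinuousForm α) (hβ : IsContinuousForm β) :
    integralFourForm o (fun x => α x - β x) = integralFourForm o α - integralFourForm o β := by
  simp only [integralFourForm_eq_sum]
  rw [← Finset.sum_sub_distrib]
  refine Finset.sum_congr rfl fun p _ => ?_
  rw [chartIntegral, chartIntegral, chartIntegral,
    ← integral_sub (hα.integrableOn ho p) (hβ.integrableOn ho p)]
  refine integral_congr_ae (Filter.Eventually.of_forall fun y => ?_)
  simp only [chartComponent, AlternatingMap.smul_apply, AlternatingMap.sub_apply, smul_eq_mul]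
  ring

theorem integralFourForm_smul (o : TangentOrientation X) (c : ℝ) (α : FourForm X) :
    integralFourForm o (fun x => c • α x) = c * integralFourForm o α := by
  simp only [integralFourForm_eq_sum]
  rw [Finset.mul_sum]
  refine Finset.sum_congr rfl fun p _ => ?_
  rw [chartIntegral, chartIntegral, ← integral_const_mul]
  refine integral_congr_ae (Filter.Eventually.of_forall fun y => ?_)
  simp only [chartComponent, AlternatingMap.smul_apply, smul_eq_mul]
  ring

end IntegralLinear

section ChernSimonsForm

set_option linter.unusedSectionVars false

theorem removeNth_four {T : Type*} (v : Fin 4 → T) (i : Fin 4) :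
    i.removeNth v = ![v (i.succAbove 0), v (i.succAbove 1), v (i.succAbove 2)] := by
  ext1 k; fin_cases k <;> rfl

/-- The `End(W)`-valued 2-form `a ∧ a`, that is, `(u, v) ↦ [a u, a v]`. -/
def commutatorForm {T W : Type*} [AddCommGroup T] [Module ℝ T] [AddCommGroup W] [Module ℝ W]
    (a : T →ₗ[ℝ] (W →ₗ[ℝ] W)) : T [⋀^Fin 2]→ₗ[ℝ] (W →ₗ[ℝ] W) where
  toFun v := a (v 0) ∘ₗ a (v 1) - a (v 1) ∘ₗ a (v 0)
  map_update_add' {_} v i u w := by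
    fin_cases i <;> simp [LinearMap.add_comp, LinearMap.comp_add] <;> abel
  map_update_smul' {_} v i c u := by
    fin_cases i <;> simp [LinearMap.smul_comp, LinearMap.comp_smul, smul_sub]
  map_eq_zero_of_eq' v i j h hij := by
    have h01 : v 0 = v 1 := by
      fin_cases i <;> fin_cases j <;> simp_all
    rw [h01, sub_self]

/-- The 3-form `tr (a ∧ G)`. -/
def traceWedge {T W : Type*} [AddCommGroup T] [Module ℝ T] [NormedAddCommGroup W]
    [InnerProductSpace ℝ W] (a : T →ₗ[ℝ] (W →ₗ[ℝ] W)) (G : T [⋀^Fin 2]→ₗ[ℝ] (W →ₗ[ℝ] W)) :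
    T [⋀^Fin 3]→ₗ[ℝ] ℝ :=
  AlternatingMap.alternatizeUncurryFin
    { toFun := fun u => (tracePairing W (a u)).compAlternatingMap G
      map_add' := fun u v => by ext w; simp
      map_smul' := fun c u => by ext w; simp }

theorem traceWedge_apply {T W : Type*} [AddCommGroup T] [Module ℝ T] [NormedAddCommGroup W]
    [InnerProductSpace ℝ W] (a : T →ₗ[ℝ] (W →ₗ[ℝ] W)) (G : T [⋀^Fin 2]→ₗ[ℝ] (W →ₗ[ℝ] W))
    (u v w : T) : traceWedge a G ![u, v, w] = tracePairing W (a u) (G ![v, w]) -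
      tracePairing W (a v) (G ![u, w]) + tracePairing W (a w) (G ![u, v]) := by
  have h0 : (0 : Fin 3).removeNth ![u, v, w] = ![v, w] := by ext1 k; fin_cases k <;> rfl
  have h1 : (1 : Fin 3).removeNth ![u, v, w] = ![u, w] := by ext1 k; fin_cases k <;> rfl
  have h2 : (2 : Fin 3).removeNth ![u, v, w] = ![u, v] := by ext1 k; fin_cases k <;> rfl
  simp only [traceWedge, AlternatingMap.alternatizeUncurryFin_apply]
  rw [Fin.sum_univ_three, h0, h1, h2]
  simp
  ring

/-- The trace as a continuous linear form on `End(F)`. -/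
def traceCLM (F : Type*) [NormedAddCommGroup F] [NormedSpace ℝ F] [FiniteDimensional ℝ F] :
    (F →L[ℝ] F) →L[ℝ] ℝ :=
  LinearMap.toContinuousLinearMap ((LinearMap.trace ℝ F) ∘ₗ ContinuousLinearMap.coeLM ℝ)

theorem traceCLM_mul_comm {F : Type*} [NormedAddCommGroup F] [NormedSpace ℝ F]
    [FiniteDimensional ℝ F] (S T : F →L[ℝ] F) : traceCLM F (S * T) = traceCLM F (T * S) :=
  LinearMap.trace_mul_comm ℝ S.toLinearMap T.toLinearMap

/-- Traces in a fibre may be computed in a trivialization `L`. -/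
theorem tracePairing_eq_traceCLM {F W : Type*} [NormedAddCommGroup F] [NormedSpace ℝ F]
    [FiniteDimensional ℝ F] [NormedAddCommGroup W] [InnerProductSpace ℝ W] (L : W ≃ₗ[ℝ] F)
    {S S' : W →ₗ[ℝ] W} {T T' : F →L[ℝ] F} (h : ∀ w, L (S w) = T (L w))
    (h' : ∀ w, L (S' w) = T' (L w)) : tracePairing W S S' = traceCLM F (T * T') := by
  have : L.conj (S ∘ₗ S') = (T * T').toLinearMap := by
    ext v
    simp [LinearEquiv.conj_apply, h, h']
  change LinearMap.trace ℝ W (S ∘ₗ S') = LinearMap.trace ℝ F (T * T').toLinearMap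
  rw [← this, LinearMap.trace_conj']

variable {X : Type*} [TopologicalSpace X] [ChartedSpace ℝ⁴ X] [IsManifold (𝓡 4) ∞ X] [T2Space X]
  {F : Type*} [NormedAddCommGroup F] [NormedSpace ℝ F] [FiniteDimensional ℝ F]
  {V : X → Type*} [TopologicalSpace (TotalSpace F V)]
  [∀ x, NormedAddCommGroup (V x)] [∀ x, InnerProductSpace ℝ (V x)]
  [FiberBundle F V] [VectorBundle ℝ F V]
  [ContMDiffVectorBundle ∞ F V (𝓡 4)] [IsContMDiffRiemannianBundle (𝓡 4) ∞ F V]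

namespace MetricConnection

variable (A A' : MetricConnection (𝓡 4) F V)

/-- The difference of two connections, a 1-form with values in the endomorphisms of `V`. -/
def differenceForm (x : X) : TangentSpace (𝓡 4) x →ₗ[ℝ] (V x →ₗ[ℝ] V x) :=
  LinearMap.mk₂ ℝ (fun u w => A.isCovariantDerivativeOnUniv.difference
      A'.isCovariantDerivativeOnUniv x w u)
    (fun _ _ _ => map_add _ _ _) (fun _ _ _ => map_smul _ _ _)
    (fun _ _ _ => by simp) (fun _ _ _ => by simp)

/-- The 4-form `tr (F_A ∧ F_A)`. -/
def traceForm : FourForm X := fun x =>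
  wedge (tracePairing (V x)) (A.curvature x) (A.curvature x)

/-- The Chern-Simons form `tr (a ∧ (F_A + F_A')) - (1/3) tr (a ∧ a ∧ a)` of two connections, where
`a` is the difference of `A` and `A'`. -/
def chernSimonsForm (x : X) : TangentSpace (𝓡 4) x [⋀^Fin 3]→ₗ[ℝ] ℝ :=
  traceWedge (A.differenceForm A' x) (A.curvature x + A'.curvature x -
    (1 / 3 : ℝ) • commutatorForm (A.differenceForm A' x))

variable {p : X} {e : Trivialization F (TotalSpace.proj : TotalSpace F V → X)}
  [MemTrivializationAtlas e]

/-- The difference of two connections is `θ_k - θ'_k` in the trivialization. -/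
theorem repr_differenceForm {x : X} (hx : x ∈ (extChartAt (𝓡 4) p).source)
    (hxe : x ∈ e.baseSet) (k : Fin 4) (w : V x) :
    (e ⟨x, A.differenceForm A' x (coordVec p x k) w⟩).2 =
      (A.connForm p e k (extChartAt (𝓡 4) p x) - A'.connForm p e k (extChartAt (𝓡 4) p x))
        (e ⟨x, w⟩).2 := by
  have hσ := (eventually_smoothSectionAt_extend (F := F) w).self_of_nhds.mdifferentiableAt
    (by simp)
  have hxx := (extChartAt (𝓡 4) p).left_inv hx
  have hloc : ∀ τ : Π x : X, V x, localRep p e τ (extChartAt (𝓡 4) p x) = (e ⟨x, τ x⟩).2 := by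
    intro τ; rw [localRep, hxx]
  have hcv : ∀ v : V x, (e ⟨x, v⟩).2 = e.continuousLinearEquivAt ℝ x hxe v := fun v => by simp
  have hw : extend F w x = w := by simp
  have h1 : A.differenceForm A' x (coordVec p x k) w =
      A.covCoord p k (extend F w) x - A'.covCoord p k (extend F w) x := by
    have := IsCovariantDerivativeOn.difference_apply A.isCovariantDerivativeOnUniv
      A'.isCovariantDerivativeOnUniv (mem_univ x) hσ
    rw [hw] at this
    simp only [differenceForm, LinearMap.mk₂_apply, this]
    rfl
  rw [h1, hcv, map_sub, ← hcv, ← hcv, ← hloc, ← hloc, A.localRep_covCoord hx hxe hσ,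
    A'.localRep_covCoord hx hxe hσ, hloc, hw, sub_apply]
  abel

theorem tracePairing_curvature_coordVec {x : X} (hx : x ∈ (extChartAt (𝓡 4) p).source)
    (hxe : x ∈ e.baseSet) (k l m n : Fin 4) :
    tracePairing (V x) (A.curvature x ![coordVec p x k, coordVec p x l])
      (A.curvature x ![coordVec p x m, coordVec p x n]) = traceCLM F
      (curvOf (A.connForm p e) k l (extChartAt (𝓡 4) p x) *
        curvOf (A.connForm p e) m n (extChartAt (𝓡 4) p x)) :=
  tracePairing_eq_traceCLM (e.continuousLinearEquivAt ℝ x hxe).toLinearEquiv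
    (fun w => by simpa using! A.repr_curvature hx hxe k l w)
    (fun w => by simpa using! A.repr_curvature hx hxe m n w)

theorem traceForm_coordVec {x : X} (hx : x ∈ (extChartAt (𝓡 4) p).source)
    (hxe : x ∈ e.baseSet) : A.traceForm x (coordVec p x) =
      sqComponent (traceCLM F) fun k l => curvOf (A.connForm p e) k l (extChartAt (𝓡 4) p x) := by
  simp only [traceForm, wedge, AlternatingMap.coe_mk, MultilinearMap.coe_mk,
    A.tracePairing_curvature_coordVec hx hxe, sqComponent]
  rw [traceCLM_mul_comm (curvOf _ 1 2 _), traceCLM_mul_comm (curvOf _ 1 3 _),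
    traceCLM_mul_comm (curvOf _ 2 3 _)]
  ring

theorem chernSimonsForm_coordVec {x : X} (hx : x ∈ (extChartAt (𝓡 4) p).source)
    (hxe : x ∈ e.baseSet) (k l m : Fin 4) :
    A.chernSimonsForm A' x ![coordVec p x k, coordVec p x l, coordVec p x m] =
      csComponent (traceCLM F)
        (fun k => A.connForm p e k (extChartAt (𝓡 4) p x) -
          A'.connForm p e k (extChartAt (𝓡 4) p x))
        (fun k l => curvOf (A.connForm p e) k l (extChartAt (𝓡 4) p x) +
          curvOf (A'.connForm p e) k l (extChartAt (𝓡 4) p x)) k l m := by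
  set L := (e.continuousLinearEquivAt ℝ x hxe).toLinearEquiv
  set a : Fin 4 → F →L[ℝ] F := fun k => A.connForm p e k (extChartAt (𝓡 4) p x) -
          A'.connForm p e k (extChartAt (𝓡 4) p x) with ha
  set S : Fin 4 → Fin 4 → F →L[ℝ] F := fun k l =>
    curvOf (A.connForm p e) k l (extChartAt (𝓡 4) p x) +
          curvOf (A'.connForm p e) k l (extChartAt (𝓡 4) p x) with hS
  have h1 : ∀ k w, L (A.differenceForm A' x (coordVec p x k) w) = a k (L w) := fun k w => by
    simpa using! A.repr_differenceForm A' hx hxe k w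
  have h2 : ∀ (A : MetricConnection (𝓡 4) F V) k l w,
      L (A.curvature x ![coordVec p x k, coordVec p x l] w) =
        curvOf (A.connForm p e) k l (extChartAt (𝓡 4) p x) (L w) := fun A k l w => by
    simpa using! A.repr_curvature hx hxe k l w
  have h3 : ∀ k l m, tracePairing (V x) (A.differenceForm A' x (coordVec p x k))
      ((A.curvature x + A'.curvature x - (1 / 3 : ℝ) • commutatorForm (A.differenceForm A' x))
        ![coordVec p x l, coordVec p x m]) =
      traceCLM F (a k * (S l m - (1 / 3 : ℝ) • (a l * a m - a m * a l))) := by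
    intro k l m
    refine tracePairing_eq_traceCLM L (h1 k) fun w => ?_
    simp [commutatorForm, h1, h2, hS]
  have c1 : ∀ k l n, traceCLM F (a k * (a l * a n)) = traceCLM F (a n * (a k * a l)) := by
    intro k l n; rw [← mul_assoc, traceCLM_mul_comm]
  rw [chernSimonsForm, traceWedge_apply, h3, h3, h3]
  simp only [csComponent, mul_sub, mul_smul_comm, map_sub, map_smul, smul_eq_mul]
  have := c1 k l m
  have := c1 k m l
  have := c1 m k l
  have := c1 l k m
  have := c1 l m k
  have := c1 m l k
  linarith

theorem eventually_traceForm {y : ℝ⁴} (hy : y ∈ (extChartAt (𝓡 4) p).target)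
    (hxe : (extChartAt (𝓡 4) p).symm y ∈ e.baseSet) :
    ∀ᶠ z in 𝓝 y, chartComponent p A.traceForm z =
      sqComponent (traceCLM F) fun k l => curvOf (A.connForm p e) k l z := by
  have hx := (extChartAt (𝓡 4) p).map_target hy
  have := eventually_extChartAt_symm hx (P := fun x z => A.traceForm x (coordVec p x) =
      sqComponent (traceCLM F) fun k l => curvOf (A.connForm p e) k l z) (by
    filter_upwards [(isOpen_extChartAt_source p).mem_nhds hx, e.open_baseSet.mem_nhds hxe]
      with x hx hxe using A.traceForm_coordVec hx hxe)
  rwa [(extChartAt (𝓡 4) p).right_inv hy] at this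

theorem eventually_chernSimonsForm {y : ℝ⁴} (hy : y ∈ (extChartAt (𝓡 4) p).target)
    (hxe : (extChartAt (𝓡 4) p).symm y ∈ e.baseSet) (i : Fin 4) :
    ∀ᶠ z in 𝓝 y, chartComponent₃ p (A.chernSimonsForm A') i z =
      csComponent (traceCLM F) (fun k => A.connForm p e k z - A'.connForm p e k z)
        (fun k l => curvOf (A.connForm p e) k l z + curvOf (A'.connForm p e) k l z)
        (i.succAbove 0) (i.succAbove 1) (i.succAbove 2) := by
  have hx := (extChartAt (𝓡 4) p).map_target hy
  have := eventually_extChartAt_symm hx (P := fun x z =>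
      A.chernSimonsForm A' x (i.removeNth (coordVec p x)) =
      csComponent (traceCLM F) (fun k => A.connForm p e k z - A'.connForm p e k z)
        (fun k l => curvOf (A.connForm p e) k l z + curvOf (A'.connForm p e) k l z)
        (i.succAbove 0) (i.succAbove 1) (i.succAbove 2)) (by
    filter_upwards [(isOpen_extChartAt_source p).mem_nhds hx, e.open_baseSet.mem_nhds hxe]
      with x hx hxe
    rw [removeNth_four, A.chernSimonsForm_coordVec A' hx hxe])
  rwa [(extChartAt (𝓡 4) p).right_inv hy] at this

theorem contDiffAt_connForm_of_target {y : ℝ⁴} (hy : y ∈ (extChartAt (𝓡 4) p).target)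
    (hxe : (extChartAt (𝓡 4) p).symm y ∈ e.baseSet) (k : Fin 4) :
    ContDiffAt ℝ ∞ (A.connForm p e k) y := by
  have := A.contDiffAt_connForm ((extChartAt (𝓡 4) p).map_target hy) hxe k
  rwa [(extChartAt (𝓡 4) p).right_inv hy] at this

theorem continuousAt_curvOf_connForm {y : ℝ⁴} (hy : y ∈ (extChartAt (𝓡 4) p).target)
    (hxe : (extChartAt (𝓡 4) p).symm y ∈ e.baseSet) (k l : Fin 4) :
    ContinuousAt (fun z => curvOf (A.connForm p e) k l z) y :=
  (contDiffAt_curvOf (A.contDiffAt_connForm_of_target hy hxe) k l).continuousAt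

variable (p) in
theorem continuousOn_tracePairing_curvature (k l m n : Fin 4) :
    ContinuousOn (fun z => tracePairing (V ((extChartAt (𝓡 4) p).symm z))
      (A.curvature ((extChartAt (𝓡 4) p).symm z)
        ![coordVec p ((extChartAt (𝓡 4) p).symm z) k, coordVec p ((extChartAt (𝓡 4) p).symm z) l])
      (A.curvature ((extChartAt (𝓡 4) p).symm z)
        ![coordVec p ((extChartAt (𝓡 4) p).symm z) m, coordVec p ((extChartAt (𝓡 4) p).symm z) n]))
      (extChartAt (𝓡 4) p).target := by
  intro y hy
  have hxe := mem_baseSet_trivializationAt' (F := F) (E := V) ((extChartAt (𝓡 4) p).symm y)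
  set e := trivializationAt F V ((extChartAt (𝓡 4) p).symm y)
  have hx := (extChartAt (𝓡 4) p).map_target hy
  have h := eventually_extChartAt_symm hx (P := fun x z =>
      tracePairing (V x) (A.curvature x ![coordVec p x k, coordVec p x l])
        (A.curvature x ![coordVec p x m, coordVec p x n]) =
      traceCLM F (curvOf (A.connForm p e) k l z * curvOf (A.connForm p e) m n z)) (by
    filter_upwards [(isOpen_extChartAt_source p).mem_nhds hx, e.open_baseSet.mem_nhds hxe]
      with x hx hxe using A.tracePairing_curvature_coordVec hx hxe k l m n)
  rw [(extChartAt (𝓡 4) p).right_inv hy] at h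
  refine (ContinuousAt.congr ?_ (h.mono fun z hz => hz.symm)).continuousWithinAt
  exact (traceCLM F).continuous.continuousAt.comp
    ((A.continuousAt_curvOf_connForm hy hxe k l).mul (A.continuousAt_curvOf_connForm hy hxe m n))

theorem isContinuousForm_traceForm : IsContinuousForm A.traceForm := by
  intro p
  have h := A.continuousOn_tracePairing_curvature p
  exact ((((((h 0 1 2 3).sub (h 0 2 1 3)).add (h 0 3 1 2)).add (h 1 2 0 3)).sub (h 1 3 0 2)).add
    (h 2 3 0 1))

/-- The Chern-Weil integral of `tr (F ∧ F)` is the same for all connections: by the transgression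
formula, the forms of two connections differ by the exterior derivative of their
Chern-Simons form. -/
theorem integralFourForm_traceForm_eq [CompactSpace X] {o : TangentOrientation X}
    (ho : IsContinuousOrientation o) :
    integralFourForm o A.traceForm = integralFourForm o A'.traceForm := by
  rw [← sub_eq_zero, ← integralFourForm_sub ho A.isContinuousForm_traceForm
    A'.isContinuousForm_traceForm]
  have key : ∀ (p : X) (y : ℝ⁴), y ∈ (extChartAt (𝓡 4) p).target →
      (∀ i, ContDiffAt ℝ ∞ (chartComponent₃ p (A.chernSimonsForm A') i) y) ∧
      chartComponent p (fun x => A.traceForm x - A'.traceForm x) y = ∑ i : Fin 4,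
        (-1) ^ (i : ℕ) * fderiv ℝ (chartComponent₃ p (A.chernSimonsForm A') i) y
          (EuclideanSpace.single i 1) := by
    intro p y hy
    have hxe := mem_baseSet_trivializationAt' (F := F) (E := V) ((extChartAt (𝓡 4) p).symm y)
    set e := trivializationAt F V ((extChartAt (𝓡 4) p).symm y)
    obtain ⟨h1, h2⟩ := transgression (traceCLM F) traceCLM_mul_comm
      (A.contDiffAt_connForm_of_target hy hxe) (A'.contDiffAt_connForm_of_target hy hxe)
      (fun k l m z => rfl)
    have h3 := A.eventually_chernSimonsForm A' hy hxe
    have h5 : ∀ i, fderiv ℝ (chartComponent₃ p (A.chernSimonsForm A') i) y = _ :=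
      fun i => Filter.EventuallyEq.fderiv_eq (h3 i)
    refine ⟨fun i => (h1 _ _ _).congr_of_eventuallyEq (h3 i), ?_⟩
    have h4 : chartComponent p (fun x => A.traceForm x - A'.traceForm x) y =
        chartComponent p A.traceForm y - chartComponent p A'.traceForm y := rfl
    rw [h4, (A.eventually_traceForm hy hxe).self_of_nhds,
      (A'.eventually_traceForm hy hxe).self_of_nhds, ← h2, Fin.sum_univ_four,
      h5 0, h5 1, h5 2, h5 3]
    have c0 : (0 : Fin 4).succAbove (2 : Fin 3) = 3 := rfl
    have c1 : (1 : Fin 4).succAbove (2 : Fin 3) = 3 := rfl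
    have c2 : (2 : Fin 4).succAbove (2 : Fin 3) = 3 := rfl
    have c3 : (3 : Fin 4).succAbove (2 : Fin 3) = 2 := rfl
    have d0 : (0 : Fin 4).succAbove (1 : Fin 3) = 2 := rfl
    have d1 : (1 : Fin 4).succAbove (1 : Fin 3) = 2 := rfl
    have d2 : (2 : Fin 4).succAbove (1 : Fin 3) = 1 := rfl
    have d3 : (3 : Fin 4).succAbove (1 : Fin 3) = 1 := rfl
    have e0 : (0 : Fin 4).succAbove (0 : Fin 3) = 1 := rfl
    have e1 : (1 : Fin 4).succAbove (0 : Fin 3) = 0 := rfl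
    have e2 : (2 : Fin 4).succAbove (0 : Fin 3) = 0 := rfl
    have e3 : (3 : Fin 4).succAbove (0 : Fin 3) = 0 := rfl
    have f3 : ((3 : Fin 4) : ℕ) = 3 := rfl
    simp only [Fin.val_zero, Fin.val_one, Fin.val_two, f3, c0, c1, c2, c3, d0, d1, d2, d3, e0, e1,
      e2, e3]
    ring
  exact integralFourForm_eq_zero_of_exact ho
    (fun p i y hy => ((key p y hy).1 i).of_le (by simp)) fun p y hy => (key p y hy).2

end MetricConnection
end ChernSimonsForm

/-! ### The algebra of definite curvature tensors -/

section DefiniteAlgebra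

open Module

section OrthogonalFrame

variable {W : Type*} [NormedAddCommGroup W] [InnerProductSpace ℝ W]

theorem soInner_comm (S T : W →ₗ[ℝ] W) : soInner W S T = soInner W T S :=
  congrArg Neg.neg (LinearMap.trace_mul_comm ℝ S T)

theorem sum_soInner_smul_soFrame (b : OrthonormalBasis (Fin 3) ℝ W) {S : W →ₗ[ℝ] W}
    (hS : S ∈ soAlgebra W) : ∑ i, soInner W (soFrame b i) S • soFrame b i = S := by
  have hb : ∀ k l, inner ℝ (b k) (b l) = if k = l then (1 : ℝ) else 0 :=
    orthonormal_iff_ite.1 b.orthonormal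
  have h2 : (√2)⁻¹ * (√2)⁻¹ = (1 / 2 : ℝ) := by
    rw [← mul_inv, Real.mul_self_sqrt (by norm_num)]; norm_num
  have hs : ∀ k l, inner ℝ (b k) (S (b l)) = - inner ℝ (b l) (S (b k)) := by
    intro k l
    rw [real_inner_comm, hS]
  have hs0 : ∀ k, inner ℝ (b k) (S (b k)) = 0 := by
    intro k
    have := hs k k
    linarith
  have hc : ∀ i, soInner W (soFrame b i) S = (√2)⁻¹ *
      (2 * inner ℝ (b (i + 2)) (S (b (i + 1)))) := by
    intro i
    simp only [soInner, tracePairing, LinearMap.neg_apply, LinearMap.compr₂_apply,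
      LinearMap.mul_apply', LinearMap.trace_eq_sum_inner _ b, Fin.sum_univ_three]
    fin_cases i <;> simp [soFrame, hb, inner_smul_right, inner_sub_right]
    · rw [hs 1 2]; ring
    · rw [hs 2 0]; ring
    · rw [hs 0 1]; ring
  refine b.toBasis.ext fun k => ?_
  refine b.repr.injective (PiLp.ext fun l => ?_)
  rw [b.repr_apply_apply, b.repr_apply_apply]
  rw [Fin.sum_univ_three, hc, hc, hc]
  simp only [OrthonormalBasis.coe_toBasis, soFrame, smul_smul]
  have h3 : ∀ r : ℝ, (√2)⁻¹ * (2 * r) * (√2)⁻¹ = r := by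
    intro r
    linear_combination (2 * r) * h2
  rw [h3, h3, h3]
  fin_cases k <;> fin_cases l <;>
    simp [hb, inner_add_right, inner_smul_right, hs0]
  · rw [hs, neg_neg]
  · rw [hs, neg_neg]
  · rw [hs, neg_neg]

/-- The Parseval identity in `𝔰𝔬(W)`. -/
theorem soInner_eq_sum (b : OrthonormalBasis (Fin 3) ℝ W) (S : W →ₗ[ℝ] W) {T : W →ₗ[ℝ] W}
    (hT : T ∈ soAlgebra W) :
    soInner W S T = ∑ i, soInner W (soFrame b i) S * soInner W (soFrame b i) T := by
  conv_lhs => rw [← sum_soInner_smul_soFrame b hT]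
  rw [map_sum]
  refine Finset.sum_congr rfl fun i _ => ?_
  rw [map_smul, smul_eq_mul, soInner_comm S, mul_comm]

end OrthogonalFrame

section Wedge

variable {T W : Type*} [AddCommGroup T] [Module ℝ T] [AddCommGroup W] [Module ℝ W]

theorem wedge_apply (B : W →ₗ[ℝ] W →ₗ[ℝ] ℝ) (α β : T [⋀^Fin 2]→ₗ[ℝ] W) (v : Fin 4 → T) :
    wedge B α β v =
    B (α ![v 0, v 1]) (β ![v 2, v 3]) - B (α ![v 0, v 2]) (β ![v 1, v 3])
      + B (α ![v 0, v 3]) (β ![v 1, v 2]) + B (α ![v 1, v 2]) (β ![v 0, v 3])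
      - B (α ![v 1, v 3]) (β ![v 0, v 2]) + B (α ![v 2, v 3]) (β ![v 0, v 1]) := rfl

/-- A 2-form on a 4-dimensional space whose square vanishes is degenerate. -/
theorem exists_ne_zero_of_wedge_self_eq_zero (t : Basis (Fin 4) ℝ T) (β : T [⋀^Fin 2]→ₗ[ℝ] ℝ)
    (h : wedge (LinearMap.mul ℝ ℝ) β β = 0) : ∃ u ≠ 0, ∀ v, β ![u, v] = 0 := by
  have hw := congrArg (fun f => f t) h
  simp only [wedge_apply, LinearMap.mul_apply', AlternatingMap.zero_apply] at hw
  -- It is enough to test `β(u, ·)` on the basis.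
  have hext : ∀ u, (∀ k, β ![u, t k] = 0) → ∀ v, β ![u, v] = 0 := by
    intro u hu v
    let f : T →ₗ[ℝ] ℝ :=
      { toFun := fun v => β ![u, v]
        map_add' := fun a b => twoForm_add_right β a b u
        map_smul' := fun r a => twoForm_smul_right β r a u }
    have : f = 0 := t.ext fun k => hu k
    exact LinearMap.congr_fun this v
  have hlin : ∀ (a b c : ℝ) (i j k l : Fin 4), β ![a • t i + b • t j + c • t k, t l] =
      a * β ![t i, t l] + b * β ![t j, t l] + c * β ![t k, t l] := by
    intro a b c i j k l
    rw [twoForm_add_left, twoForm_add_left, twoForm_smul_left, twoForm_smul_left,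
      twoForm_smul_left]
    rfl
  have hne : ∀ (a b c : ℝ) (i j k : Fin 4), i ≠ j → i ≠ k → j ≠ k →
      (a ≠ 0 ∨ b ≠ 0 ∨ c ≠ 0) → a • t i + b • t j + c • t k ≠ 0 := by
    intro a b c i j k hij hik hjk habc h0
    have hr := congrArg t.repr h0
    have hi := DFunLike.congr_fun hr i
    have hj := DFunLike.congr_fun hr j
    have hk := DFunLike.congr_fun hr k
    simp [hij, hik, hjk, hij.symm, hik.symm, hjk.symm] at hi hj hk
    tauto
  have s10 := twoForm_swap β (t 0) (t 1)
  have s20 := twoForm_swap β (t 0) (t 2)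
  have s30 := twoForm_swap β (t 0) (t 3)
  have s21 := twoForm_swap β (t 1) (t 2)
  have s31 := twoForm_swap β (t 1) (t 3)
  have s32 := twoForm_swap β (t 2) (t 3)
  -- The rows of the adjugate Pfaffian matrix of `β` lie in its kernel.
  by_cases h1 : β ![t 1, t 2] ≠ 0 ∨ -β ![t 0, t 2] ≠ 0 ∨ β ![t 0, t 1] ≠ 0
  · refine ⟨_, hne _ _ _ 0 1 2 (by decide) (by decide) (by decide) h1, hext _ fun k => ?_⟩
    rw [hlin]
    fin_cases k <;> simp only [Fin.zero_eta, Fin.mk_one, Fin.reduceFinMk, twoForm_self, s10, s20,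
      s21] <;> linarith
  by_cases h2 : β ![t 2, t 3] ≠ 0 ∨ -β ![t 1, t 3] ≠ 0 ∨ β ![t 1, t 2] ≠ 0
  · refine ⟨_, hne _ _ _ 1 2 3 (by decide) (by decide) (by decide) h2, hext _ fun k => ?_⟩
    rw [hlin]
    fin_cases k <;> simp only [Fin.zero_eta, Fin.mk_one, Fin.reduceFinMk, twoForm_self, s10, s20,
      s30, s21, s31, s32] <;> linarith
  push Not at h1 h2
  refine ⟨t 1, t.ne_zero 1, hext _ fun k => ?_⟩
  fin_cases k
  · simp [s10, h1]
  · simp [twoForm_self]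
  · simp [h1]
  · simpa using h2.2.1

end Wedge

end DefiniteAlgebra

/-! ### The form `Q(A)` of a definite connection -/

section DefiniteForm

open Module

variable {X : Type*} [TopologicalSpace X] [ChartedSpace ℝ⁴ X] [IsManifold (𝓡 4) ∞ X] [T2Space X]
  {V : X → Type*} [TopologicalSpace (TotalSpace (EuclideanSpace ℝ (Fin 3)) V)]
  [∀ x, NormedAddCommGroup (V x)] [∀ x, InnerProductSpace ℝ (V x)]
  [FiberBundle (EuclideanSpace ℝ (Fin 3)) V] [VectorBundle ℝ (EuclideanSpace ℝ (Fin 3)) V]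
  [ContMDiffVectorBundle ∞ (EuclideanSpace ℝ (Fin 3)) V (𝓡 4)]
  [IsContMDiffRiemannianBundle (𝓡 4) ∞ (EuclideanSpace ℝ (Fin 3)) V]

set_option linter.unusedSectionVars false

theorem soBasis_mem (x : X) (i : Fin 3) : soBasis V x i ∈ soAlgebra (V x) := soFrame_mem _ _

theorem soInner_soBasis (x : X) (i j : Fin 3) :
    soInner (V x) (soBasis V x i) (soBasis V x j) = if i = j then 1 else 0 :=
  soInner_soFrame _ _ _

theorem sum_soInner_smul_soBasis {x : X} {S : V x →ₗ[ℝ] V x} (hS : S ∈ soAlgebra (V x)) :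
    ∑ i, soInner (V x) (soBasis V x i) S • soBasis V x i = S :=
  sum_soInner_smul_soFrame _ hS

theorem soBasis_add_smul_soBasis_ne_zero (x : X) {i j : Fin 3} (hij : i ≠ j) (r : ℝ) :
    soBasis V x j + r • soBasis V x i ≠ 0 := by
  intro h
  have := congrArg (soInner (V x) (soBasis V x j)) h
  simp [soInner_soBasis, hij.symm] at this

namespace MetricConnection

variable (A : MetricConnection (𝓡 4) (EuclideanSpace ℝ (Fin 3)) V)

/-- `(ξ, ζ) ↦ F_A(ξ) ∧ F_A(ζ)`, evaluated at `v`, as a bilinear form. -/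
def curvatureWedgeBilin (x : X) (v : Fin 4 → TangentSpace (𝓡 4) x) :
    (V x →ₗ[ℝ] V x) →ₗ[ℝ] (V x →ₗ[ℝ] V x) →ₗ[ℝ] ℝ :=
  LinearMap.mk₂ ℝ (fun ξ ζ => A.curvatureWedge x ξ ζ v)
    (fun _ _ _ => by simp [curvatureWedge, curvatureForm, wedge_apply]; ring)
    (fun _ _ _ => by simp [curvatureWedge, curvatureForm, wedge_apply]; ring)
    (fun _ _ _ => by simp [curvatureWedge, curvatureForm, wedge_apply]; ring)
    (fun _ _ _ => by simp [curvatureWedge, curvatureForm, wedge_apply]; ring)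

theorem curvatureWedge_comm (x : X) (ξ ζ : V x →ₗ[ℝ] V x) :
    A.curvatureWedge x ξ ζ = A.curvatureWedge x ζ ξ := by
  ext v
  simp only [curvatureWedge, wedge_apply, LinearMap.mul_apply']
  ring

variable {A}

/-- If `⟨F_A, ξ⟩` had square zero, it would be degenerate, with a vector `u` in its kernel, and
`F_A(u, ·)` would map the 4-dimensional tangent space to the plane orthogonal to `ξ`, so that its
kernel would be larger than the line of `u`. -/
theorem IsDefinite.curvatureWedge_self_ne_zero (hA : A.IsDefinite) {x : X}
    {ξ : V x →ₗ[ℝ] V x} (hξ : ξ ∈ soAlgebra (V x)) (h0 : ξ ≠ 0) :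
    A.curvatureWedge x ξ ξ ≠ 0 := by
  intro hw
  obtain ⟨u, hu0, hu⟩ := exists_ne_zero_of_wedge_self_eq_zero (tangentBasis x) _ hw
  let c : Fin 3 → ℝ := fun i => soInner (V x) (soBasis V x i) ξ
  let Φ : TangentSpace (𝓡 4) x →ₗ[ℝ] (Fin 3 → ℝ) :=
    { toFun := fun v i => soInner (V x) (soBasis V x i) (A.curvature x ![u, v])
      map_add' := fun v w => by
        ext i
        rw [twoForm_add_right, map_add]
        rfl
      map_smul' := fun r v => by
        ext i
        rw [twoForm_smul_right, map_smul]
        rfl }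
  have hΦ : ∀ v, ∑ i, c i * Φ v i = 0 := fun v =>
    (soInner_eq_sum (fibreBasis V x) ξ (A.curvature_mem_soAlgebra x ![u, v])).symm.trans (hu v)
  have hc : ∑ i, c i * c i ≠ 0 := by
    intro hc
    have hc' : ∀ i, c i = 0 := fun i => mul_self_eq_zero.1
      ((Finset.sum_eq_zero_iff_of_nonneg fun i _ => mul_self_nonneg (c i)).1 hc i
        (Finset.mem_univ i))
    refine h0 ?_
    rw [← sum_soInner_smul_soBasis hξ]
    exact Finset.sum_eq_zero fun i _ => by rw [show soInner (V x) _ ξ = 0 from hc' i, zero_smul]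
  have hrange : finrank ℝ (LinearMap.range Φ) < 3 := by
    have : LinearMap.range Φ ≠ ⊤ := by
      intro h
      obtain ⟨v, hv⟩ := LinearMap.range_eq_top.1 h c
      exact hc (hv ▸ hΦ v)
    simpa using Submodule.finrank_lt this
  have hdim : finrank ℝ (TangentSpace (𝓡 4) x) = 4 := by
    simp [finrank_eq_card_basis (tangentBasis x)]
  have : Module.Finite ℝ (TangentSpace (𝓡 4) x) := Module.Finite.of_basis (tangentBasis x)
  have hrk := Φ.finrank_range_add_finrank_ker
  have hker : ¬ LinearMap.ker Φ ≤ Submodule.span ℝ {u} := by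
    intro h
    have := Submodule.finrank_mono h
    rw [finrank_span_singleton hu0] at this
    omega
  obtain ⟨v, hv, hvu⟩ := Set.not_subset.1 hker
  refine hA x u v ((LinearIndependent.pair_iff' hu0).2 fun a ha => hvu ?_) ?_
  · exact Submodule.mem_span_singleton.2 ⟨a, ha⟩
  · rw [← sum_soInner_smul_soBasis (A.curvature_mem_soAlgebra x ![u, v])]
    refine Finset.sum_eq_zero fun i _ => ?_
    have := congrFun (LinearMap.mem_ker.1 hv) i
    rw [show soInner (V x) (soBasis V x i) (A.curvature x ![u, v]) = 0 from this, zero_smul]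

/-- The quadratic form `ξ ↦ F_A(ξ) ∧ F_A(ξ)` has no isotropic vectors, so it takes values of one
sign only. -/
theorem IsDefinite.mul_pos (hA : A.IsDefinite) (x : X) (i j : Fin 3) :
    0 < A.curvatureWedge x (soBasis V x i) (soBasis V x i) (tangentBasis x) *
      A.curvatureWedge x (soBasis V x j) (soBasis V x j) (tangentBasis x) := by
  set q : (V x →ₗ[ℝ] V x) →ₗ[ℝ] (V x →ₗ[ℝ] V x) →ₗ[ℝ] ℝ :=
    A.curvatureWedgeBilin x (tangentBasis x)
  have hq : ∀ ξ ∈ soAlgebra (V x), ξ ≠ 0 → q ξ ξ ≠ 0 := fun ξ hξ h0 =>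
    (AlternatingMap.map_basis_ne_zero_iff _ _).2 (hA.curvatureWedge_self_ne_zero hξ h0)
  have hne : ∀ i, soBasis V x i ≠ 0 := by
    intro i h
    have := soInner_soBasis (V := V) x i i
    simp [h] at this
  change 0 < q (soBasis V x i) (soBasis V x i) * q (soBasis V x j) (soBasis V x j)
  -- Otherwise the polynomial `r ↦ q(e_j + r e_i)` has a real root.
  by_contra hneg
  have hi := hq _ (soBasis_mem x i) (hne i)
  have hij : i ≠ j := by
    rintro rfl
    exact hneg (mul_self_pos.2 hi)
  have hcomm : q (soBasis V x i) (soBasis V x j) = q (soBasis V x j) (soBasis V x i) :=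
    congrArg (fun f => f (tangentBasis x)) (A.curvatureWedge_comm x _ _)
  obtain ⟨r, hr⟩ := exists_quadratic_eq_zero (a := q (soBasis V x i) (soBasis V x i))
    (b := 2 * q (soBasis V x i) (soBasis V x j)) (c := q (soBasis V x j) (soBasis V x j)) hi
    ⟨√(discrim _ _ _), (Real.mul_self_sqrt (by
      rw [discrim]
      nlinarith [sq_nonneg (q (soBasis V x i) (soBasis V x j))])).symm⟩
  refine hq (soBasis V x j + r • soBasis V x i)
    (add_mem (soBasis_mem x j) (Submodule.smul_mem _ _ (soBasis_mem x i)))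
    (soBasis_add_smul_soBasis_ne_zero x hij r) ?_
  simp only [map_add, map_smul, LinearMap.add_apply, LinearMap.smul_apply, smul_eq_mul, ← hcomm]
  linarith

theorem IsDefinite.volumeForm_ne_zero (hA : A.IsDefinite) (x : X) : A.volumeForm x ≠ 0 := by
  intro h
  have h1 := congrArg (fun f => f (tangentBasis x)) h
  simp only [volumeForm, Fin.sum_univ_three, AlternatingMap.smul_apply, AlternatingMap.add_apply,
    AlternatingMap.zero_apply, smul_eq_mul] at h1
  have h00 := hA.mul_pos x 0 0
  have h01 := hA.mul_pos x 0 1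
  have h02 := hA.mul_pos x 0 2
  set a := A.curvatureWedge x (soBasis V x 0) (soBasis V x 0) (tangentBasis x)
  set b := A.curvatureWedge x (soBasis V x 1) (soBasis V x 1) (tangentBasis x)
  set c := A.curvatureWedge x (soBasis V x 2) (soBasis V x 2) (tangentBasis x)
  have : a * (a + b + c) = 0 := by
    rw [show a + b + c = 0 by linarith, mul_zero]
  linarith

variable (A)

/-- `tr (F_A ∧ F_A) = -∑ F_i ∧ F_i`. -/
theorem traceForm_eq_smul_volumeForm (x : X) : A.traceForm x = (-3 : ℝ) • A.volumeForm x := by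
  ext v
  have h : ∀ u w, tracePairing (V x) (A.curvature x u) (A.curvature x w) = -∑ i,
      A.curvatureForm x (soBasis V x i) u * A.curvatureForm x (soBasis V x i) w := by
    intro u w
    have := soInner_eq_sum (fibreBasis V x) (A.curvature x u) (A.curvature_mem_soAlgebra x w)
    rw [show tracePairing (V x) (A.curvature x u) (A.curvature x w) =
      -soInner (V x) (A.curvature x u) (A.curvature x w) from (neg_neg _).symm, this]
    rfl
  simp only [traceForm, volumeForm, wedge_apply, h, curvatureWedge, AlternatingMap.smul_apply,
    AlternatingMap.add_apply, Fin.sum_univ_three, LinearMap.mul_apply', smul_eq_mul]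
  ring

theorem pontrjaginForm_eq_smul_traceForm :
    A.pontrjaginForm = fun x => (-(1 / (8 * Real.pi ^ 2))) • A.traceForm x := rfl

theorem fourFormRatio_eq {x : X} (t : Basis (Fin 4) ℝ (TangentSpace (𝓡 4) x))
    (α β : TangentSpace (𝓡 4) x [⋀^Fin 4]→ₗ[ℝ] ℝ) : fourFormRatio x α β = α t / β t := by
  have hd : t.det (tangentBasis x) ≠ 0 :=
    (AlternatingMap.map_basis_ne_zero_iff (tangentBasis x) t.det).2 t.det_ne_zero
  rw [fourFormRatio, α.eq_smul_basis_det t, β.eq_smul_basis_det t]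
  simp only [AlternatingMap.smul_apply, smul_eq_mul, Basis.det_self, mul_one]
  rw [mul_div_mul_right _ _ hd]

theorem Q_comm (x : X) (ξ ζ : V x →ₗ[ℝ] V x) : A.Q x ξ ζ = A.Q x ζ ξ := by
  rw [Q, Q, curvatureWedge_comm]

variable {A}

/-- Since `tr Q(A) = 3`, the number `|Q(A)|² - 3` is the squared distance of `Q(A)` to the
identity. -/
theorem IsDefinite.normSqQ_sub_three (hA : A.IsDefinite) (x : X) : A.normSqQ x - 3 =
    ∑ i, ∑ j, (A.Q x (soBasis V x i) (soBasis V x j) - if i = j then 1 else 0) ^ 2 := by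
  have hm : A.volumeForm x (tangentBasis x) ≠ 0 :=
    (AlternatingMap.map_basis_ne_zero_iff _ _).2 (hA.volumeForm_ne_zero x)
  have htr : ∑ i, A.Q x (soBasis V x i) (soBasis V x i) = 3 := by
    simp only [Q, fourFormRatio]
    rw [← Finset.sum_div, div_eq_iff hm]
    simp only [volumeForm, Fin.sum_univ_three, AlternatingMap.smul_apply, AlternatingMap.add_apply,
      smul_eq_mul]
    ring
  have h01 := A.Q_comm x (soBasis V x 0) (soBasis V x 1)
  have h02 := A.Q_comm x (soBasis V x 0) (soBasis V x 2)
  have h12 := A.Q_comm x (soBasis V x 1) (soBasis V x 2)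
  rw [Fin.sum_univ_three] at htr
  simp only [normSqQ, Fin.sum_univ_three]
  simp
  rw [h01, h02, h12]
  linear_combination 2 * htr

theorem IsDefinite.three_le_normSqQ (hA : A.IsDefinite) (x : X) : 3 ≤ A.normSqQ x := by
  rw [← sub_nonneg, hA.normSqQ_sub_three]
  positivity

theorem IsDefinite.isPerfect_iff (hA : A.IsDefinite) :
    A.IsPerfect ↔ ∀ x, A.normSqQ x = 3 := by
  have hm : ∀ x, A.volumeForm x (tangentBasis x) ≠ 0 := fun x =>
    (AlternatingMap.map_basis_ne_zero_iff _ _).2 (hA.volumeForm_ne_zero x)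
  constructor
  · intro h x
    rw [← sub_eq_zero, hA.normSqQ_sub_three]
    refine Finset.sum_eq_zero fun i _ => Finset.sum_eq_zero fun j _ => ?_
    rw [Q, h x _ (soBasis_mem x i) _ (soBasis_mem x j), soInner_soBasis, fourFormRatio,
      AlternatingMap.smul_apply, smul_eq_mul, mul_div_cancel_right₀ _ (hm x), sub_self]
    simp
  · intro h x ξ hξ ζ hζ
    have hQ : ∀ i j, A.curvatureWedge x (soBasis V x i) (soBasis V x j) (tangentBasis x) =
        (if i = j then 1 else 0) * A.volumeForm x (tangentBasis x) := by
      intro i j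
      have h0 := hA.normSqQ_sub_three x
      rw [h x, sub_self, eq_comm, Finset.sum_eq_zero_iff_of_nonneg fun _ _ => by positivity] at h0
      have h1 := h0 i (Finset.mem_univ i)
      rw [Finset.sum_eq_zero_iff_of_nonneg fun _ _ => by positivity] at h1
      have h2 := sub_eq_zero.1 (pow_eq_zero_iff (two_ne_zero)|>.1 (h1 j (Finset.mem_univ j)))
      rwa [Q, fourFormRatio, div_eq_iff (hm x)] at h2
    have h1 : A.curvatureWedge x ξ ζ (tangentBasis x) =
        soInner (V x) ξ ζ * A.volumeForm x (tangentBasis x) := by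
      change A.curvatureWedgeBilin x (tangentBasis x) ξ ζ = _
      conv_lhs => rw [← sum_soInner_smul_soBasis hξ, ← sum_soInner_smul_soBasis hζ]
      rw [soInner_eq_sum (fibreBasis V x) ξ hζ, Finset.sum_mul]
      simp only [map_sum, LinearMap.sum_apply, map_smul, LinearMap.smul_apply, smul_eq_mul]
      refine Finset.sum_congr rfl fun i _ => ?_
      rw [Finset.sum_eq_single i]
      · rw [show A.curvatureWedgeBilin x (tangentBasis x) (soBasis V x i) (soBasis V x i) = _
          from hQ i i, if_pos rfl]
        simp only [soBasis]
        ring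
      · intro j _ hj
        rw [show A.curvatureWedgeBilin x (tangentBasis x) (soBasis V x j) (soBasis V x i) = _
          from hQ j i, if_neg hj]
        ring
      · exact fun h => absurd (Finset.mem_univ i) h
    rw [(A.curvatureWedge x ξ ζ).eq_smul_basis_det (tangentBasis x), h1, mul_smul,
      ← (A.volumeForm x).eq_smul_basis_det (tangentBasis x)]

end MetricConnection
end DefiniteForm

/-! ### Continuity of the energy density -/

section ShuffleSums

variable {T W : Type*} [AddCommGroup T] [Module ℝ T] [AddCommGroup W] [Module ℝ W]

/-- The signs of the six (2,2)-shuffles, in lexicographic order. -/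
def shuffleSign : Fin 6 → ℝ := ![1, -1, 1, 1, -1, 1]

/-- The first pair of indices of each of the six (2,2)-shuffles. -/
def shuffleFst : Fin 6 → Fin 4 × Fin 4 := ![(0, 1), (0, 2), (0, 3), (1, 2), (1, 3), (2, 3)]

/-- The second pair of indices of each of the six (2,2)-shuffles. -/
def shuffleSnd : Fin 6 → Fin 4 × Fin 4 := ![(2, 3), (1, 3), (1, 2), (0, 3), (0, 2), (0, 1)]

theorem wedge_apply_eq_sum (B : W →ₗ[ℝ] W →ₗ[ℝ] ℝ) (α β : T [⋀^Fin 2]→ₗ[ℝ] W) (v : Fin 4 → T) :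
    wedge B α β v = ∑ a, shuffleSign a * B (α ![v (shuffleFst a).1, v (shuffleFst a).2])
      (β ![v (shuffleSnd a).1, v (shuffleSnd a).2]) := by
  rw [Fin.sum_univ_six]
  simp [wedge_apply, shuffleSign, shuffleFst, shuffleSnd]
  ring

/-- Reordering of the sum of the products of two expressions of the form of `wedge_apply_eq_sum`:
the sums over the frame, `i` and `j`, become innermost. -/
theorem sum_mul_sum_shuffle {ι κ : Type*} [Fintype ι] [Fintype κ] (s : κ → ℝ) (f g : ι → κ → ℝ) :
    ∑ i, ∑ j, (∑ a, s a * (f i a * g j a)) * (∑ b, s b * (f j b * g i b)) =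
      ∑ a, ∑ b, s a * s b * ((∑ i, f i a * g i b) * ∑ j, g j a * f j b) := by
  simp only [Finset.sum_mul_sum]
  simp only [Finset.mul_sum]
  calc _ = ∑ i, ∑ a, ∑ j, ∑ b, s a * (f i a * g j a) * (s b * (f j b * g i b)) :=
        Finset.sum_congr rfl fun i _ => Finset.sum_comm
    _ = ∑ a, ∑ i, ∑ b, ∑ j, s a * (f i a * g j a) * (s b * (f j b * g i b)) := by
        rw [Finset.sum_comm]
        exact Finset.sum_congr rfl fun a _ => Finset.sum_congr rfl fun i _ => Finset.sum_comm
    _ = ∑ a, ∑ b, ∑ i, ∑ j, s a * (f i a * g j a) * (s b * (f j b * g i b)) :=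
        Finset.sum_congr rfl fun a _ => Finset.sum_comm
    _ = _ := by
        refine Finset.sum_congr rfl fun a _ => Finset.sum_congr rfl fun b _ =>
          Finset.sum_congr rfl fun i _ => Finset.sum_congr rfl fun j _ => ?_
        ring

end ShuffleSums

section EnergyDensity

variable {X : Type*} [TopologicalSpace X] [ChartedSpace ℝ⁴ X] [IsManifold (𝓡 4) ∞ X] [T2Space X]
  {V : X → Type*} [TopologicalSpace (TotalSpace (EuclideanSpace ℝ (Fin 3)) V)]
  [∀ x, NormedAddCommGroup (V x)] [∀ x, InnerProductSpace ℝ (V x)]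
  [FiberBundle (EuclideanSpace ℝ (Fin 3)) V] [VectorBundle ℝ (EuclideanSpace ℝ (Fin 3)) V]
  [ContMDiffVectorBundle ∞ (EuclideanSpace ℝ (Fin 3)) V (𝓡 4)]
  [IsContMDiffRiemannianBundle (𝓡 4) ∞ (EuclideanSpace ℝ (Fin 3)) V]

set_option linter.unusedSectionVars false

namespace MetricConnection

variable (A : MetricConnection (𝓡 4) (EuclideanSpace ℝ (Fin 3)) V)

/-- An expression of `∑ (F_i ∧ F_j) (F_j ∧ F_i)` that does not involve the orthonormal frame of
`𝔰𝔬(V x)`. As no continuity of the frames is at hand, the continuity of `|Q(A)|²` is read off from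
this formula. -/
theorem sum_curvatureWedge_mul_curvatureWedge (x : X) (v : Fin 4 → TangentSpace (𝓡 4) x) :
    ∑ i, ∑ j, A.curvatureWedge x (soBasis V x i) (soBasis V x j) v *
      A.curvatureWedge x (soBasis V x j) (soBasis V x i) v =
    ∑ a, ∑ b, shuffleSign a * shuffleSign b *
      (tracePairing (V x) (A.curvature x ![v (shuffleFst a).1, v (shuffleFst a).2])
          (A.curvature x ![v (shuffleSnd b).1, v (shuffleSnd b).2]) *
        tracePairing (V x) (A.curvature x ![v (shuffleSnd a).1, v (shuffleSnd a).2])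
          (A.curvature x ![v (shuffleFst b).1, v (shuffleFst b).2])) := by
  simp only [curvatureWedge, wedge_apply_eq_sum, LinearMap.mul_apply']
  rw [sum_mul_sum_shuffle]
  refine Finset.sum_congr rfl fun a _ => Finset.sum_congr rfl fun b _ => congrArg _ ?_
  have h : ∀ u w, ∑ i, A.curvatureForm x (soBasis V x i) u * A.curvatureForm x (soBasis V x i) w =
      - tracePairing (V x) (A.curvature x u) (A.curvature x w) := fun u w =>
    (soInner_eq_sum (fibreBasis V x) (A.curvature x u) (A.curvature_mem_soAlgebra x w)).symm
  rw [h, h, neg_mul_neg]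

theorem volumeForm_eq_smul_traceForm :
    A.volumeForm = fun x => (-(1 / 3) : ℝ) • A.traceForm x := by
  ext1 x
  rw [A.traceForm_eq_smul_volumeForm, smul_smul]
  norm_num

theorem isContinuousForm_volumeForm : IsContinuousForm A.volumeForm := by
  rw [A.volumeForm_eq_smul_traceForm]
  exact A.isContinuousForm_traceForm.smul _

variable {A}

theorem IsDefinite.chartComponent_volumeForm_ne_zero (hA : A.IsDefinite) {p : X} {y : ℝ⁴}
    (hy : y ∈ (extChartAt (𝓡 4) p).target) : chartComponent p A.volumeForm y ≠ 0 :=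
  (apply_coordVec_ne_zero ((extChartAt (𝓡 4) p).map_target hy)).2 (hA.volumeForm_ne_zero _)

theorem IsDefinite.isContinuousForm_normSqQ_smul (hA : A.IsDefinite) :
    IsContinuousForm fun x => A.normSqQ x • A.volumeForm x := by
  intro p
  have h := A.continuousOn_tracePairing_curvature p
  have h1 := ContinuousOn.div (continuousOn_finsetSum Finset.univ fun a _ =>
    continuousOn_finsetSum Finset.univ fun b _ =>
      (continuousOn_const (c := shuffleSign a * shuffleSign b)).mul
      ((h (shuffleFst a).1 (shuffleFst a).2 (shuffleSnd b).1 (shuffleSnd b).2).mul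
        (h (shuffleSnd a).1 (shuffleSnd a).2 (shuffleFst b).1 (shuffleFst b).2)))
    (A.isContinuousForm_volumeForm p) fun y hy => hA.chartComponent_volumeForm_ne_zero hy
  refine h1.congr fun y hy => ?_
  have hm := hA.chartComponent_volumeForm_ne_zero hy
  refine (eq_div_iff hm).2 ?_
  set x := (extChartAt (𝓡 4) p).symm y with hx
  obtain ⟨t, ht⟩ := exists_basis_coordVec ((extChartAt (𝓡 4) p).map_target hy)
  have hm' : A.volumeForm x (coordVec p x) ≠ 0 := hm
  have hQ : ∀ ξ ζ, A.Q x ξ ζ * A.volumeForm x (coordVec p x) =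
      A.curvatureWedge x ξ ζ (coordVec p x) := by
    intro ξ ζ
    rw [Q, fourFormRatio_eq t, ht, div_mul_cancel₀ _ hm']
  refine Eq.trans ?_ (A.sum_curvatureWedge_mul_curvatureWedge x (coordVec p x))
  simp only [← hQ]
  change (A.normSqQ x * A.volumeForm x (coordVec p x)) * A.volumeForm x (coordVec p x) = _
  rw [normSqQ, Finset.sum_mul, Finset.sum_mul]
  refine Finset.sum_congr rfl fun i _ => ?_
  rw [Finset.sum_mul, Finset.sum_mul]
  refine Finset.sum_congr rfl fun j _ => ?_
  ring

theorem IsDefinite.orientationSign_orientation (hA : A.IsDefinite) (x : X)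
    (v : Fin 4 → TangentSpace (𝓡 4) x) :
    orientationSign (A.orientation x) v = (SignType.sign (A.volumeForm x v) : ℝ) := by
  have h0 := hA.volumeForm_ne_zero x
  have h1 : SameRay ℝ (A.volumeForm x) (A.orientation x).someVector := by
    rw [← ray_eq_iff h0 (A.orientation x).someVector_ne_zero]
    refine Eq.trans ?_ (A.orientation x).someVector_ray.symm
    rw [orientation, dif_pos h0]
  obtain ⟨r, hr, hr'⟩ := h1.exists_pos_left h0 (A.orientation x).someVector_ne_zero
  rw [orientationSign, ← hr', AlternatingMap.smul_apply, smul_eq_mul, sign_mul, sign_pos hr,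
    one_mul]

theorem IsDefinite.chartSign_orientation (hA : A.IsDefinite) (p : X) (y : ℝ⁴) :
    chartSign A.orientation p y = (SignType.sign (chartComponent p A.volumeForm y) : ℝ) :=
  hA.orientationSign_orientation _ _

/-- The sign of a chart is the sign of the component of the nowhere vanishing continuous form
`μ(A)`. -/
theorem IsDefinite.isContinuousOrientation (hA : A.IsDefinite) :
    IsContinuousOrientation A.orientation := by
  intro p y hy
  have hc : ContinuousAt (chartComponent p A.volumeForm) y :=
    (A.isContinuousForm_volumeForm p).continuousAt ((isOpen_extChartAt_target p).mem_nhds hy)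
  simp only [hA.chartSign_orientation]
  rcases lt_or_gt_of_ne (hA.chartComponent_volumeForm_ne_zero hy) with h | h
  · filter_upwards [hc.eventually_lt continuousAt_const h] with z hz
    rw [sign_neg h, sign_neg hz]
  · filter_upwards [continuousAt_const.eventually_lt hc h] with z hz
    rw [sign_pos h, sign_pos hz]

end MetricConnection
end EnergyDensity

/-! ### The energy and the Pontrjagin number -/

section Energy

open MeasureTheory

variable {X : Type*} [TopologicalSpace X] [ChartedSpace ℝ⁴ X] [IsManifold (𝓡 4) ∞ X] [T2Space X]
  [CompactSpace X]
  {V : X → Type*} [TopologicalSpace (TotalSpace (EuclideanSpace ℝ (Fin 3)) V)]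
  [∀ x, NormedAddCommGroup (V x)] [∀ x, InnerProductSpace ℝ (V x)]
  [FiberBundle (EuclideanSpace ℝ (Fin 3)) V] [VectorBundle ℝ (EuclideanSpace ℝ (Fin 3)) V]
  [ContMDiffVectorBundle ∞ (EuclideanSpace ℝ (Fin 3)) V (𝓡 4)]
  [IsContMDiffRiemannianBundle (𝓡 4) ∞ (EuclideanSpace ℝ (Fin 3)) V]

namespace MetricConnection

variable {A : MetricConnection (𝓡 4) (EuclideanSpace ℝ (Fin 3)) V}

theorem IsDefinite.integralFourForm_pontrjaginForm (hA : A.IsDefinite)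
    (B : MetricConnection (𝓡 4) (EuclideanSpace ℝ (Fin 3)) V) :
    integralFourForm A.orientation B.pontrjaginForm = pontrjaginNumber V A.orientation := by
  have h : Nonempty (MetricConnection (𝓡 4) (EuclideanSpace ℝ (Fin 3)) V) := ⟨A⟩
  rw [pontrjaginNumber, dif_pos h, pontrjaginForm_eq_smul_traceForm,
    pontrjaginForm_eq_smul_traceForm, integralFourForm_smul, integralFourForm_smul,
    B.integralFourForm_traceForm_eq (Classical.choice h) hA.isContinuousOrientation]

/-- The excess of the energy over the topological bound is the integral of `(|Q(A)|² - 3) μ(A)`,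
because `8π² p₁(A) = 3 μ(A)`. -/
theorem IsDefinite.energy_sub (hA : A.IsDefinite) :
    A.energy - 8 * Real.pi ^ 2 * pontrjaginNumber V A.orientation =
      integralFourForm A.orientation fun x => (A.normSqQ x - 3) • A.volumeForm x := by
  have h1 : 8 * Real.pi ^ 2 * pontrjaginNumber V A.orientation =
      integralFourForm A.orientation fun x => (3 : ℝ) • A.volumeForm x := by
    rw [← hA.integralFourForm_pontrjaginForm A, ← integralFourForm_smul]
    congr 1
    ext1 x
    change (8 * Real.pi ^ 2) • (-(1 / (8 * Real.pi ^ 2))) • A.traceForm x = _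
    rw [traceForm_eq_smul_volumeForm, smul_smul, smul_smul]
    congr 1
    field_simp [Real.pi_ne_zero]
  rw [h1, energy, ← integralFourForm_sub hA.isContinuousOrientation
    hA.isContinuousForm_normSqQ_smul (A.isContinuousForm_volumeForm.smul 3)]
  congr 1
  ext1 x
  exact (sub_smul _ _ _).symm

/-- The integrand of `(|Q(A)|² - 3) μ(A)` in a chart. -/
theorem IsDefinite.integrand_eq (hA : A.IsDefinite) (p : X) (y : ℝ⁴) :
    chartSign A.orientation p y * chartComponent p
        (fun x => chartPartition X p x • (A.normSqQ x - 3) • A.volumeForm x) y =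
      chartPartition X p ((extChartAt (𝓡 4) p).symm y) *
        ((A.normSqQ ((extChartAt (𝓡 4) p).symm y) - 3) * |chartComponent p A.volumeForm y|) := by
  have h : chartComponent p
        (fun x => chartPartition X p x • (A.normSqQ x - 3) • A.volumeForm x) y =
      chartPartition X p ((extChartAt (𝓡 4) p).symm y) *
        ((A.normSqQ ((extChartAt (𝓡 4) p).symm y) - 3) * chartComponent p A.volumeForm y) := rfl
  rw [h, hA.chartSign_orientation, ← sign_mul_self (chartComponent p A.volumeForm y)]
  ring

theorem IsDefinite.integrand_nonneg (hA : A.IsDefinite) (p : X) (y : ℝ⁴) :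
    0 ≤ chartSign A.orientation p y * chartComponent p
        (fun x => chartPartition X p x • (A.normSqQ x - 3) • A.volumeForm x) y := by
  rw [hA.integrand_eq]
  exact mul_nonneg ((chartPartition X).nonneg p _)
    (mul_nonneg (sub_nonneg.2 (hA.three_le_normSqQ _)) (abs_nonneg _))

theorem IsDefinite.integral_normSqQ_sub_three_nonneg (hA : A.IsDefinite) :
    0 ≤ integralFourForm A.orientation fun x => (A.normSqQ x - 3) • A.volumeForm x := by
  rw [integralFourForm_eq_sum]
  exact Finset.sum_nonneg fun p _ => integral_nonneg fun y => hA.integrand_nonneg p y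

theorem IsDefinite.integral_normSqQ_sub_three_eq_zero_iff (hA : A.IsDefinite) :
    integralFourForm A.orientation (fun x => (A.normSqQ x - 3) • A.volumeForm x) = 0 ↔
      ∀ x, A.normSqQ x = 3 := by
  constructor
  · intro h x
    have hcont : IsContinuousForm fun x => (A.normSqQ x - 3) • A.volumeForm x := by
      intro p
      refine ((hA.isContinuousForm_normSqQ_smul p).sub
        ((A.isContinuousForm_volumeForm.smul 3) p)).congr fun y _ => ?_
      exact sub_mul _ _ _
    rw [integralFourForm_eq_sum, Finset.sum_eq_zero_iff_of_nonneg
      fun p _ => integral_nonneg fun y => hA.integrand_nonneg p y] at h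
    obtain ⟨p, hp, hpx⟩ : ∃ p ∈ chartIndices X, chartPartition X p x ≠ 0 := by
      by_contra! hne
      have := sum_chartPartition x
      rw [Finset.sum_eq_zero hne] at this
      exact zero_ne_one this
    have hx : x ∈ (extChartAt (𝓡 4) p).source :=
      tsupport_chartPartition_subset p (subset_tsupport _ hpx)
    have hy := (extChartAt (𝓡 4) p).map_source hx
    have hae := (setIntegral_eq_zero_iff_of_nonneg_ae
      (Filter.Eventually.of_forall fun y => hA.integrand_nonneg p y)
      (hcont.integrableOn hA.isContinuousOrientation p)).1 (h p hp)
    have heq := Measure.eqOn_open_of_ae_eq hae (isOpen_extChartAt_target p)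
      (hcont.continuousOn_integrand hA.isContinuousOrientation p) continuousOn_const hy
    replace heq := (hA.integrand_eq p _).symm.trans heq
    rw [(extChartAt (𝓡 4) p).left_inv hx] at heq
    have h3 := mul_eq_zero.1 ((mul_eq_zero.1 heq).resolve_left hpx)
    exact sub_eq_zero.1 (h3.resolve_right
      (abs_ne_zero.2 (hA.chartComponent_volumeForm_ne_zero hy)))
  · intro h
    have h0 : (fun x => (A.normSqQ x - 3) • A.volumeForm x) =
        fun x => (0 : ℝ) • A.volumeForm x := by
      ext1 x
      rw [h x, sub_self]
    rw [h0, integralFourForm_smul, zero_mul]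

end MetricConnection
end Energy

end

theorem mainTheorem7 {X : Type*} [TopologicalSpace X] [T2Space X] [CompactSpace X]
    [ChartedSpace (EuclideanSpace ℝ (Fin 4)) X] [IsManifold (𝓡 4) ∞ X]
    {V : X → Type*} [TopologicalSpace (TotalSpace (EuclideanSpace ℝ (Fin 3)) V)]
    [∀ x, NormedAddCommGroup (V x)] [∀ x, InnerProductSpace ℝ (V x)]
    [FiberBundle (EuclideanSpace ℝ (Fin 3)) V] [VectorBundle ℝ (EuclideanSpace ℝ (Fin 3)) V]
    [ContMDiffVectorBundle ∞ (EuclideanSpace ℝ (Fin 3)) V (𝓡 4)]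
    [IsContMDiffRiemannianBundle (𝓡 4) ∞ (EuclideanSpace ℝ (Fin 3)) V]
    (A : MetricConnection (𝓡 4) (EuclideanSpace ℝ (Fin 3)) V) (hA : A.IsDefinite) :
    (∀ B : MetricConnection (𝓡 4) (EuclideanSpace ℝ (Fin 3)) V,
      integralFourForm A.orientation B.pontrjaginForm = pontrjaginNumber V A.orientation) ∧
    8 * Real.pi ^ 2 * pontrjaginNumber V A.orientation ≤ A.energy ∧
    (A.energy = 8 * Real.pi ^ 2 * pontrjaginNumber V A.orientation ↔ A.IsPerfect) := by
  refine ⟨hA.integralFourForm_pontrjaginForm, ?_, ?_⟩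
  · rw [← sub_nonneg, hA.energy_sub]
    exact hA.integral_normSqQ_sub_three_nonneg
  · rw [← sub_eq_zero, hA.energy_sub, hA.integral_normSqQ_sub_three_eq_zero_iff,
      hA.isPerfect_iff]
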